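/- **Setting.** All systems are real, rational and discrete-time; $\mathcal{RH}_\infty$ is the set of proper real rational functions (matrices) with all poles in $|z|<1$, and $\|f\|_2^2=\frac1{2\pi}\int_{-\pi}^{\pi}|f(e^{j\theta})|^2d\theta$. Let $m\ge 1$. *Channel.* $\Delta=\mathrm{diag}\{\Delta_1,\dots,\Delta_m\}$ with $u_{di}(k)=\sum_{j=0}^{\bar\chi_i}\alpha_{i,j}\,\delta(\chi_{i,k-j}-j)\,u_i(k-j)$, $\alpha_{i,j}\ge 0$, where the delays $\chi_{i,k}\in\{0,\dots,\bar\chi_i\}$ are independent over all $(i,k)$ with $\Pr\{\chi_{i,k}=j\}=p_{ij}$, $\sum_j p_{ij}=1$. Put $h_{i,j}=\alpha_{i,j}\delta(\chi_{i,n}-j)$, $\mu_{i,j}=\mathbf E h_{i,j}$, $r_{i,jl}=\mathrm{Cov}(h_{i,j},h_{i,l})$, $H_i(z)=\sum_j\mu_{i,j}z^{-j}$, $H=\mathrm{diag}\{H_i\}$, $r_i(t)=\sum_j r_{i,j(j+|t|)}$ and $S_{\Omega_i}(z)=\sum_{|t|\le\bar\chi_i}r_i(t)z^{-t}$. Assume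 that $H_i$ is minimum phase (no zero in $|z|\ge1$, $z=\infty$ included) and that $S_{\Omega_i}(z)=\Phi_i(z)\Phi_i(z^{-1})$ with $\Phi_i$ a minimum-phase polynomial in $z^{-1}$; let $W_i=H_i^{-1}\Phi_i$. *Plant.* $P=P_0\,\mathrm{diag}\{\frac{z-s_1}{z},\dots,\frac{z-s_m}{z}\}$ is $m\times m$, where $P_0$ is minimum phase (nonsingular, no transmission zeros in $|z|\ge 1$) with relative degree one ($\lim_{z\to\infty}zP_0(z)$ exists and is invertible), $s_i\in\mathbb R$, $|s_i|>1$, and no $s_i$ is a pole of $P_0$. *Loop.* With a proper LTI controller $K$ and $G=K(I+PHK)^{-1}P$, the signals (from zero initial conditions) satisfy $e=v-d$, $u=Ge$, $d_i(k)=\sum_j\big(\alpha_{i,j}\delta(\chi_{i,k-j}-j)-\mu_{i,j}\big)u_i(k-j)$. The system is mean-square internally stable if the feedback loop of $PH$ and $K$ is internally stable and, for every i.i.d. zero-mean noise $v$ with finite diagonal covariance, independent of the delays, $\mathbf E\{e(k)e(k)^T\}$ and $\mathbf E\{u(k)u(k)^T\}$ are bounded uniformly in $k$. It is mean-square stabilizable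 if some proper $K$ achieves this. *Factorizations.* Let $PH=NM^{-1}=\tilde M^{-1}\tilde N$ be a doubly coprime factorization over $\mathcal{RH}_\infty$ with $\begin{bmatrix}\tilde V&\tilde U\\-\tilde N&\tilde M\end{bmatrix}\begin{bmatrix}M&-U\\N&V\end{bmatrix}=\begin{bmatrix}M&-U\\N&V\end{bmatrix}\begin{bmatrix}\tilde V&\tilde U\\-\tilde N&\tilde M\end{bmatrix}=I$, let $$\rho_{\min}=\inf_{Q\in\mathcal{RH}_\infty}\rho(J(Q)),\qquad J(Q)_{ij}=\big\|[(U+MQ)\tilde N]_{ij}W_j\big\|_2^2,$$ where $\rho$ is the spectral radius, and let $M=M_{in}M_{out}$ be an inner-outer factorization with a minimal realization $M_{in}(z)=C_{in}(zI-A_{in})^{-1}B_{in}+D_{in}$. Put $\hat A=A_{in}-B_{in}D_{in}^{-1}C_{in}$, $\bar N_{i,in}(\hat A)=(I-s_i\hat A)(\hat A-s_iI)^{-1}$ and $b_i=\bar N_{i,in}(\hat A)W_i(\hat A)B_{in}D_{in}^{-1}e_i$. **Theorem.** $D_{in}$, $\hat A-s_iI$ and the denominator of $W_i$ evaluated at $\hat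 A$ are invertible. For every positive diagonal $\Gamma$ the Riccati equation $$X=A_{in}^TXA_{in}+C_{in}^T\Gamma C_{in}-(A_{in}^TXB_{in}+C_{in}^T\Gamma D_{in})(D_{in}^T\Gamma D_{in}+B_{in}^TXB_{in})^{-1}(B_{in}^TXA_{in}+D_{in}^T\Gamma C_{in})$$ has exactly one solution $X=X(\Gamma)>0$, and for each $i$ the equation $X_i=\hat AX_i\hat A^T-B_{in}D_{in}^{-1}e_ie_i^TD_{in}^{-T}B_{in}^T$ has exactly one solution $X_i\ge0$. Moreover $$\rho_{\min}=\inf\big\{\mu:\ \exists\,\Gamma>0\text{ diagonal},\ b_i^TX(\Gamma)b_i\le\mu\,e_i^T\Gamma e_i,\ i=1,\dots,m\big\},$$ $$\rho_{\min}=\inf\Big\{\mu>0:\ \exists\,\gamma_1,\dots,\gamma_m>0,\ \sum_{j=1}^m\gamma_jX_j>\frac{\gamma_i}{\mu}\,b_ib_i^T,\ i=1,\dots,m\Big\},$$ and the stochastic feedback system is mean-square stabilizable if and only if $\rho_{\min}<1$. -/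

import Mathlib

open Polynomial MeasureTheory ProbabilityTheory
open scoped Matrix ENNReal NNReal

noncomputable section

namespace MSStab

/-! ### Real rational transfer functions in the variable `z = RatFunc.X` -/

/-- Value of a real rational function at a complex point (meaningful away from its poles). -/
def evalC (w : ℂ) (f : RatFunc ℝ) : ℂ := f.eval (algebraMap ℝ ℂ) w

/-- Properness: finite value at `z = ∞`. -/
def IsProper (f : RatFunc ℝ) : Prop := f.num.natDegree ≤ f.denom.natDegree

/-- `f` has no pole at the complex point `w`. -/
def NoPole (f : RatFunc ℝ) (w : ℂ) : Prop := aeval w f.denom ≠ 0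

/-- Scalar `RH_∞`: proper, with all poles in the open unit disc. -/
def RHInf (f : RatFunc ℝ) : Prop := IsProper f ∧ ∀ w : ℂ, 1 ≤ ‖w‖ → NoPole f w

/-- Square transfer matrices. -/
abbrev TM (m : ℕ) := Matrix (Fin m) (Fin m) (RatFunc ℝ)

def ProperM {m : ℕ} (F : TM m) : Prop := ∀ i j, IsProper (F i j)

def RHInfM {m : ℕ} (F : TM m) : Prop := ∀ i j, RHInf (F i j)

/-- The squared `H_2` norm `(1/2π) ∫_{-π}^{π} |f(e^{jθ})|² dθ`. -/
def h2sq (f : RatFunc ℝ) : ℝ :=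
  (2 * Real.pi)⁻¹ *
    ∫ θ in (-Real.pi)..Real.pi, ‖evalC (Complex.exp ((θ : ℂ) * Complex.I)) f‖ ^ 2

/-- The substitution `z ↦ z⁻¹`. -/
def substInv (f : RatFunc ℝ) : RatFunc ℝ := f.eval RatFunc.C RatFunc.X⁻¹

/-- The impulse response of `f`: the coefficient of `z^{-k}` in the Laurent expansion of `f`
at `z = ∞`. -/
def impulse (f : RatFunc ℝ) (k : ℕ) : ℝ :=
  ((substInv f : RatFunc ℝ) : LaurentSeries ℝ).coeff (k : ℤ)

/-- The polynomial `q` in `z⁻¹`, as a transfer function. -/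
def inZInv (q : ℝ[X]) : RatFunc ℝ := aeval (RatFunc.X⁻¹ : RatFunc ℝ) q

/-- The polynomial `q` in `z⁻¹` is minimum phase: no zero in `|z| ≥ 1`, `z = ∞` included
(that is, `q` has no root in the closed unit disc of the variable `z⁻¹`). -/
def MinPhasePoly (q : ℝ[X]) : Prop := ∀ w : ℂ, ‖w‖ ≤ 1 → aeval w q ≠ 0

/-- A scalar rational function of a square matrix. -/
def matEval {n : ℕ} (f : RatFunc ℝ) (A : Matrix (Fin n) (Fin n) ℝ) : Matrix (Fin n) (Fin n) ℝ :=
  aeval A f.num * (aeval A f.denom)⁻¹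

/-- A square plant is minimum phase: it is nonsingular and has no transmission zero in
`|z| ≥ 1` (the zeros of a nonsingular square rational matrix are the poles of its inverse). -/
def MinPhasePlant {m : ℕ} (P : TM m) : Prop :=
  P.det ≠ 0 ∧ ∀ i j, ∀ w : ℂ, 1 ≤ ‖w‖ → NoPole (P⁻¹ i j) w

/-- Relative degree one: `z P(z)` has a finite invertible limit at `z = ∞`. -/
def RelDegOne {m : ℕ} (P : TM m) : Prop :=
  P.det ≠ 0 ∧ ProperM ((RatFunc.X : RatFunc ℝ) • P) ∧ ProperM ((RatFunc.X : RatFunc ℝ) • P)⁻¹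

/-- `diag{(z - s_1)/z, …, (z - s_m)/z}`. -/
def zeroFactor {m : ℕ} (s : Fin m → ℝ) : TM m :=
  Matrix.diagonal fun i => (RatFunc.X - RatFunc.C (s i)) / RatFunc.X

/-! ### Factorizations -/

/-- Doubly coprime factorization `G = N M⁻¹ = M̃⁻¹ Ñ` over `RH_∞` with the double Bezout identity. -/
structure DoublyCoprime {m : ℕ} (G N M Nt Mt U V Ut Vt : TM m) : Prop where
  stable : RHInfM N ∧ RHInfM M ∧ RHInfM Nt ∧ RHInfM Mt ∧
    RHInfM U ∧ RHInfM V ∧ RHInfM Ut ∧ RHInfM Vt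
  det_M : M.det ≠ 0
  det_Mt : Mt.det ≠ 0
  right : G = N * M⁻¹
  left : G = Mt⁻¹ * Nt
  bezout : Matrix.fromBlocks Vt Ut (-Nt) Mt * Matrix.fromBlocks M (-U) N V = 1
  bezout' : Matrix.fromBlocks M (-U) N V * Matrix.fromBlocks Vt Ut (-Nt) Mt = 1

/-- Inner: stable and unitary on the unit circle. -/
def IsInner {m : ℕ} (F : TM m) : Prop :=
  RHInfM F ∧ ∀ w : ℂ, ‖w‖ = 1 → (F.map (evalC w))ᴴ * F.map (evalC w) = 1

/-- Outer (square case): stable, with an inverse that is proper and analytic in `|z| > 1`. -/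
def IsOuter {m : ℕ} (F : TM m) : Prop :=
  RHInfM F ∧ F.det ≠ 0 ∧ ProperM F⁻¹ ∧ ∀ i j, ∀ w : ℂ, 1 < ‖w‖ → NoPole (F⁻¹ i j) w

/-- `F(z) = C (zI - A)⁻¹ B + D`. -/
def IsRealization {m n : ℕ} (F : TM m) (A : Matrix (Fin n) (Fin n) ℝ)
    (B : Matrix (Fin n) (Fin m) ℝ) (C : Matrix (Fin m) (Fin n) ℝ)
    (D : Matrix (Fin m) (Fin m) ℝ) : Prop :=
  F = C.map RatFunc.C *
      ((RatFunc.X : RatFunc ℝ) • (1 : Matrix (Fin n) (Fin n) (RatFunc ℝ)) - A.map RatFunc.C)⁻¹ *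
      B.map RatFunc.C + D.map RatFunc.C

def Controllable {m n : ℕ} (A : Matrix (Fin n) (Fin n) ℝ) (B : Matrix (Fin n) (Fin m) ℝ) : Prop :=
  ∀ x : Fin n → ℝ, (∀ k : ℕ, x ᵥ* (A ^ k * B) = 0) → x = 0

def Observable {m n : ℕ} (A : Matrix (Fin n) (Fin n) ℝ) (C : Matrix (Fin m) (Fin n) ℝ) : Prop :=
  ∀ x : Fin n → ℝ, (∀ k : ℕ, (C * A ^ k) *ᵥ x = 0) → x = 0

/-! ### The random-delay channel -/

/-- Data of the `m` parallel subchannels: largest delays `χ̄_i`, receiver weights `α_{i,j} ≥ 0`, and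
delay probabilities `p_{ij}`, for `j ∈ {0, …, χ̄_i}`. -/
structure Channel (m : ℕ) where
  dmax : Fin m → ℕ
  weight : (i : Fin m) → Fin (dmax i + 1) → ℝ
  prob : (i : Fin m) → Fin (dmax i + 1) → ℝ
  weight_nonneg : ∀ i j, 0 ≤ weight i j
  prob_nonneg : ∀ i j, 0 ≤ prob i j
  prob_sum : ∀ i, ∑ j, prob i j = 1

namespace Channel

variable {m : ℕ} (ch : Channel m)

/-- `h_i(n + j, n) = α_{i,j} δ(χ_{i,n} - j)`, as a function of the delay `c = χ_{i,n}`. -/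
def h (i : Fin m) (j c : Fin (ch.dmax i + 1)) : ℝ := if c = j then ch.weight i j else 0

/-- `μ_{i,j} = E h_i(n + j, n)`. -/
def mean (i : Fin m) (j : Fin (ch.dmax i + 1)) : ℝ := ∑ c, ch.prob i c * ch.h i j c

/-- `r_{i,jl} = Cov(h_i(n + j, n), h_i(n + l, n))`. -/
def cov (i : Fin m) (j l : Fin (ch.dmax i + 1)) : ℝ :=
  ∑ c, ch.prob i c * ((ch.h i j c - ch.mean i j) * (ch.h i l c - ch.mean i l))

/-- `r_i(t) = ∑_{j} r_{i,j(j+t)}` for `t ≥ 0`. -/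
def autocorr (i : Fin m) (t : ℕ) : ℝ :=
  ∑ j : Fin (ch.dmax i + 1), ∑ l : Fin (ch.dmax i + 1),
    if (l : ℕ) = (j : ℕ) + t then ch.cov i j l else 0

/-- The energy spectral density `S_{Ω_i}(z) = ∑_{|t| ≤ χ̄_i} r_i(|t|) z^{-t}`. -/
def density (i : Fin m) : RatFunc ℝ :=
  ∑ t ∈ Finset.Icc (-(ch.dmax i : ℤ)) (ch.dmax i : ℤ),
    RatFunc.C (ch.autocorr i t.natAbs) * RatFunc.X ^ (-t)

/-- The nominal subsystem as a polynomial in `z⁻¹`. -/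
def meanPoly (i : Fin m) : ℝ[X] :=
  ∑ j : Fin (ch.dmax i + 1), Polynomial.monomial (j : ℕ) (ch.mean i j)

/-- `H(z) = diag{H_1(z), …, H_m(z)}`. -/
def H : TM m := Matrix.diagonal fun i => inZInv (ch.meanPoly i)

/-- `Φ_i` (a polynomial in `z⁻¹`) is the minimum-phase spectral factor of `S_{Ω_i}`:
`S_{Ω_i}(z) = Φ_i(z) Φ_i(z⁻¹)`. -/
def IsSpectralFactor (Φ : Fin m → ℝ[X]) : Prop :=
  ∀ i, MinPhasePoly (Φ i) ∧ ch.density i = inZInv (Φ i) * substInv (inZInv (Φ i))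

/-- The coefficient of frequency variation `W_i = H_i⁻¹ Φ_i`. -/
def W (Φ : Fin m → ℝ[X]) (i : Fin m) : RatFunc ℝ := (inZInv (ch.meanPoly i))⁻¹ * inZInv (Φ i)

end Channel

/-! ### Mean-square stability and stabilizability -/

/-- Internal stability of the negative feedback loop of `G` and `K`. -/
def InternallyStable {m : ℕ} (G K : TM m) : Prop :=
  (1 + G * K).det ≠ 0 ∧
  RHInfM (1 + G * K)⁻¹ ∧ RHInfM ((1 + G * K)⁻¹ * G) ∧
  RHInfM (K * (1 + G * K)⁻¹) ∧ RHInfM (K * (1 + G * K)⁻¹ * G)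

/-- The nominal feedback system `K (I + P H K)⁻¹ P` from `e = v - d` to `u`. -/
def nominal {m : ℕ} (P H K : TM m) : TM m := K * (1 + P * H * K)⁻¹ * P

/-- The delays `χ_{i,k}` take values in `{0, …, χ̄_i}`, are independent over all `(i, k)`,
and have the prescribed probability mass functions. -/
structure IsDelayProcess {m : ℕ} (ch : Channel m) {Ω : Type} [MeasurableSpace Ω] (Pr : Measure Ω)
    (χ : (i : Fin m) → ℕ → Ω → Fin (ch.dmax i + 1)) : Prop where
  meas : ∀ i k, Measurable (χ i k)
  indep : iIndepFun (fun q : Fin m × ℕ => χ q.1 q.2) Pr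
  law : ∀ i k j, Pr (χ i k ⁻¹' {j}) = ENNReal.ofReal (ch.prob i j)

/-- `v` is an i.i.d. zero-mean vector process with finite diagonal covariance. -/
structure IsWhiteNoise {m : ℕ} {Ω : Type} [MeasurableSpace Ω] (Pr : Measure Ω)
    (v : ℕ → Ω → Fin m → ℝ) : Prop where
  meas : ∀ k, Measurable (v k)
  indep : iIndepFun v Pr
  ident : ∀ k, IdentDistrib (v k) (v 0) Pr Pr
  sq_integrable : ∀ k i, MemLp (fun ω => v k ω i) 2 Pr
  mean_zero : ∀ k i, ∫ ω, v k ω i ∂Pr = 0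
  cov_diag : ∀ k i j, i ≠ j → ∫ ω, v k ω i * v k ω j ∂Pr = 0

/-- The signals of the closed loop from zero initial conditions (all signals vanish at negative
times): `e = v - d`, `u = G e`, and
`d_i(k) = ∑_j (h_i(k, k-j) - μ_{i,j}) u_i(k-j)`. -/
structure IsClosedLoop {m : ℕ} (ch : Channel m) (G : TM m) {Ω : Type}
    (χ : (i : Fin m) → ℕ → Ω → Fin (ch.dmax i + 1)) (v e u d : ℕ → Ω → Fin m → ℝ) : Prop where
  err : ∀ k ω i, e k ω i = v k ω i - d k ω i
  out : ∀ k ω i, u k ω i =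
    ∑ n ∈ Finset.range (k + 1), ∑ l, impulse (G i l) (k - n) * e n ω l
  unc : ∀ k ω i, d k ω i =
    ∑ j : Fin (ch.dmax i + 1),
      if (j : ℕ) ≤ k then (ch.h i j (χ i (k - j) ω) - ch.mean i j) * u (k - j) ω i else 0

/-- A vector process has second moments bounded uniformly in time. -/
def BoundedVariance {m : ℕ} {Ω : Type} [MeasurableSpace Ω] (Pr : Measure Ω)
    (x : ℕ → Ω → Fin m → ℝ) : Prop :=
  ∃ c : ℝ≥0, ∀ k i, ∫⁻ ω, ‖x k ω i‖ₑ ^ 2 ∂Pr ≤ c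

/-- Mean-square internal stability of the stochastic feedback system. -/
def MeanSquareStable {m : ℕ} (P : TM m) (ch : Channel m) (K : TM m) : Prop :=
  InternallyStable (P * ch.H) K ∧
  ∀ (Ω : Type) [MeasurableSpace Ω] (Pr : Measure Ω) [IsProbabilityMeasure Pr]
    (χ : (i : Fin m) → ℕ → Ω → Fin (ch.dmax i + 1)) (v e u d : ℕ → Ω → Fin m → ℝ),
    IsDelayProcess ch Pr χ → IsWhiteNoise Pr v →
    IndepFun (fun ω k => v k ω) (fun ω i k => χ i k ω) Pr →
    IsClosedLoop ch (nominal P ch.H K) χ v e u d →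
    BoundedVariance Pr e ∧ BoundedVariance Pr u

/-- Mean-square stabilizability by a proper LTI controller. -/
def MeanSquareStabilizable {m : ℕ} (P : TM m) (ch : Channel m) : Prop :=
  ∃ K : TM m, ProperM K ∧ MeanSquareStable P ch K

/-! ### The stabilization radius -/

/-- Spectral radius of a real matrix (largest modulus of a complex eigenvalue). -/
def specRad {m : ℕ} (J : Matrix (Fin m) (Fin m) ℝ) : ℝ :=
  (spectralRadius ℂ (J.map (algebraMap ℝ ℂ))).toReal

/-- `J(Q)_{ij} = ‖[(U + M Q) Ñ]_{ij} W_j‖₂²`. -/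
def Jmat {m : ℕ} (U M Nt : TM m) (W : Fin m → RatFunc ℝ) (Q : TM m) :
    Matrix (Fin m) (Fin m) ℝ :=
  Matrix.of fun i j => h2sq (((U + M * Q) * Nt) i j * W j)

/-- `ρ_min = inf_{Q ∈ RH_∞} ρ(J(Q))`. -/
def rhoMin {m : ℕ} (U M Nt : TM m) (W : Fin m → RatFunc ℝ) : ℝ :=
  sInf {r | ∃ Q : TM m, RHInfM Q ∧ r = specRad (Jmat U M Nt W Q)}

section StateSpace

variable {m n : ℕ} (A : Matrix (Fin n) (Fin n) ℝ) (B : Matrix (Fin n) (Fin m) ℝ)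
  (C : Matrix (Fin m) (Fin n) ℝ) (D : Matrix (Fin m) (Fin m) ℝ)

/-- `Â = A_in - B_in D_in⁻¹ C_in`. -/
def Ahat : Matrix (Fin n) (Fin n) ℝ := A - B * D⁻¹ * C

/-- `X` solves the discrete algebraic Riccati equation with weight `Γ = diag γ`. -/
def IsDARE (γ : Fin m → ℝ) (X : Matrix (Fin n) (Fin n) ℝ) : Prop :=
  X = Aᵀ * X * A + Cᵀ * Matrix.diagonal γ * C -
    (Aᵀ * X * B + Cᵀ * Matrix.diagonal γ * D) *
      (Dᵀ * Matrix.diagonal γ * D + Bᵀ * X * B)⁻¹ *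
      (Bᵀ * X * A + Dᵀ * Matrix.diagonal γ * C)

/-- The column `B_in D_in⁻¹ e_i`. -/
def inCol (i : Fin m) : Fin n → ℝ := (B * D⁻¹).col i

/-- `Y` solves `Y = Â Y Âᵀ - B_in D_in⁻¹ e_i e_iᵀ D_in⁻ᵀ B_inᵀ`. -/
def IsLyap (i : Fin m) (Y : Matrix (Fin n) (Fin n) ℝ) : Prop :=
  Y = Ahat A B C D * Y * (Ahat A B C D)ᵀ - Matrix.vecMulVec (inCol B D i) (inCol B D i)

/-- `N̄(Â) = (I - s Â)(Â - s I)⁻¹`. -/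
def Nbar (s : ℝ) : Matrix (Fin n) (Fin n) ℝ :=
  (1 - s • Ahat A B C D) * (Ahat A B C D - s • 1)⁻¹

/-- `b_i = N̄_{i,in}(Â) W_i(Â) B_in D_in⁻¹ e_i`. -/
def bvec (s : Fin m → ℝ) (W : Fin m → RatFunc ℝ) (i : Fin m) : Fin n → ℝ :=
  (Nbar A B C D (s i) * matEval (W i) (Ahat A B C D)) *ᵥ inCol B D i

/-- The values `μ` for which, for some `Γ = diag γ > 0` with Riccati solution `X > 0`,
`b_iᵀ X b_i ≤ μ e_iᵀ Γ e_i` for all `i`. -/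
def riccatiSet (s : Fin m → ℝ) (W : Fin m → RatFunc ℝ) : Set ℝ :=
  {μ | ∃ γ : Fin m → ℝ, (∀ i, 0 < γ i) ∧ ∃ X : Matrix (Fin n) (Fin n) ℝ,
    X.PosDef ∧ IsDARE A B C D γ X ∧
    ∀ i, bvec A B C D s W i ⬝ᵥ (X *ᵥ bvec A B C D s W i) ≤ μ * γ i}

/-- The values `μ > 0` for which, for some `γ_1, …, γ_m > 0`,
`∑_j γ_j X_j > (γ_i / μ) b_i b_iᵀ` for all `i`, with `X_j ≥ 0` the Lyapunov solutions. -/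
def lmiSet (s : Fin m → ℝ) (W : Fin m → RatFunc ℝ) : Set ℝ :=
  {μ | 0 < μ ∧ ∃ γ : Fin m → ℝ, (∀ i, 0 < γ i) ∧
    ∃ Y : Fin m → Matrix (Fin n) (Fin n) ℝ,
    (∀ i, (Y i).PosSemidef ∧ IsLyap A B C D i (Y i)) ∧
    ∀ i, (∑ j, γ j • Y j -
      (γ i / μ) • Matrix.vecMulVec (bvec A B C D s W i) (bvec A B C D s W i)).PosDef}

end StateSpace

end MSStab

end

noncomputable section

namespace MSStab

section

/-! ### Poles and properness of rational functions -/

theorem noPole_iff {f : RatFunc ℝ} {w : ℂ} : NoPole f w ↔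
    ∃ p q : ℝ[X], aeval w q ≠ 0 ∧ f = algebraMap _ _ p / algebraMap _ _ q := by
  constructor
  · exact fun h => ⟨f.num, f.denom, h, (RatFunc.num_div_denom f).symm⟩
  · rintro ⟨p, q, hq, rfl⟩ h
    obtain ⟨r, hr⟩ := RatFunc.denom_div_dvd (K := ℝ) p q
    apply hq
    rw [hr, map_mul, h, zero_mul]

theorem noPole_of_denom_dvd {f : RatFunc ℝ} {w : ℂ} {q : ℝ[X]} (h : f.denom ∣ q)
    (hq : aeval w q ≠ 0) : NoPole f w := by
  intro h0
  obtain ⟨r, hr⟩ := h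
  apply hq
  rw [hr, map_mul, h0, zero_mul]

theorem NoPole.add {f g : RatFunc ℝ} {w : ℂ} (hf : NoPole f w) (hg : NoPole g w) :
    NoPole (f + g) w :=
  noPole_of_denom_dvd (RatFunc.denom_add_dvd f g) (by rw [map_mul]; exact mul_ne_zero hf hg)

theorem NoPole.mul {f g : RatFunc ℝ} {w : ℂ} (hf : NoPole f w) (hg : NoPole g w) :
    NoPole (f * g) w :=
  noPole_of_denom_dvd (RatFunc.denom_mul_dvd f g) (by rw [map_mul]; exact mul_ne_zero hf hg)

theorem noPole_algebraMap (p : ℝ[X]) (w : ℂ) : NoPole (algebraMap _ _ p) w := by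
  simp [NoPole]

theorem noPole_C (c : ℝ) (w : ℂ) : NoPole (RatFunc.C c) w := by
  simp [NoPole]

theorem noPole_X (w : ℂ) : NoPole RatFunc.X w := by
  simp [NoPole]

theorem noPole_one (w : ℂ) : NoPole 1 w := by
  simp [NoPole]

theorem noPole_zero (w : ℂ) : NoPole 0 w := by
  simp [NoPole]

theorem NoPole.neg {f : RatFunc ℝ} {w : ℂ} (hf : NoPole f w) : NoPole (-f) w := by
  have := (noPole_C (-1) w).mul hf
  simpa using this

/-- The rational functions without a pole at `w`. -/
def noPoleSubring (w : ℂ) : Subring (RatFunc ℝ) where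
  carrier := {f | NoPole f w}
  mul_mem' := NoPole.mul
  one_mem' := noPole_one w
  add_mem' := NoPole.add
  zero_mem' := noPole_zero w
  neg_mem' := NoPole.neg

theorem isProper_iff_intDegree {f : RatFunc ℝ} : IsProper f ↔ f.intDegree ≤ 0 := by
  simp [IsProper, RatFunc.intDegree]

theorem IsProper.mul {f g : RatFunc ℝ} (hf : IsProper f) (hg : IsProper g) :
    IsProper (f * g) := by
  rw [isProper_iff_intDegree] at *
  by_cases h1 : f = 0
  · simp [h1]
  by_cases h2 : g = 0
  · simp [h2]
  rw [RatFunc.intDegree_mul h1 h2]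
  omega

theorem IsProper.add {f g : RatFunc ℝ} (hf : IsProper f) (hg : IsProper g) :
    IsProper (f + g) := by
  by_cases h2 : g = 0
  · simpa [h2] using hf
  by_cases h1 : f + g = 0
  · simp [h1, IsProper]
  rw [isProper_iff_intDegree] at *
  exact (RatFunc.intDegree_add_le h2 h1).trans (max_le hf hg)

/-- The proper rational functions. -/
def properSubring : Subring (RatFunc ℝ) where
  carrier := {f | IsProper f}
  mul_mem' := IsProper.mul
  one_mem' := by simp [IsProper]
  add_mem' := IsProper.add
  zero_mem' := by simp [IsProper]
  neg_mem' := by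
    intro f hf
    simp only [Set.mem_ofPred_eq, isProper_iff_intDegree, RatFunc.intDegree_neg] at *
    exact hf

theorem isProper_C (c : ℝ) : IsProper (RatFunc.C c) := by
  simp [IsProper]

theorem isProper_X_inv : IsProper (RatFunc.X⁻¹ : RatFunc ℝ) := by
  rw [isProper_iff_intDegree, RatFunc.intDegree_inv, RatFunc.intDegree_X]; norm_num

/-- The rational functions without a pole in the closed exterior of the unit disc, `∞` excluded. -/
def stableSubring : Subring (RatFunc ℝ) := ⨅ w : {w : ℂ // 1 ≤ ‖w‖}, noPoleSubring w.1

/-- Scalar `RH_∞` as a subring. -/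
def rhSubring : Subring (RatFunc ℝ) := properSubring ⊓ stableSubring

theorem mem_noPoleSubring {w : ℂ} {f : RatFunc ℝ} : f ∈ noPoleSubring w ↔ NoPole f w := Iff.rfl

theorem mem_properSubring {f : RatFunc ℝ} : f ∈ properSubring ↔ IsProper f := Iff.rfl

theorem mem_stableSubring {f : RatFunc ℝ} :
    f ∈ stableSubring ↔ ∀ w : ℂ, 1 ≤ ‖w‖ → NoPole f w := by
  simp [stableSubring, Subring.mem_iInf, mem_noPoleSubring]

theorem mem_rhSubring {f : RatFunc ℝ} : f ∈ rhSubring ↔ RHInf f := by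
  simp [rhSubring, Subring.mem_inf, mem_properSubring, mem_stableSubring, RHInf]

theorem C_mem_noPole (w : ℂ) (c : ℝ) : RatFunc.C c ∈ noPoleSubring w := noPole_C c w

theorem C_mem_proper (c : ℝ) : RatFunc.C c ∈ properSubring := isProper_C c

theorem C_mem_stable (c : ℝ) : RatFunc.C c ∈ stableSubring :=
  mem_stableSubring.2 fun w _ => noPole_C c w

theorem C_mem_rh (c : ℝ) : RatFunc.C c ∈ rhSubring := ⟨C_mem_proper c, C_mem_stable c⟩

theorem noPole_inv_X_sub_C {a : ℝ} {w : ℂ} (h : w ≠ a) :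
    NoPole (RatFunc.X - RatFunc.C a)⁻¹ w := by
  refine noPole_iff.2 ⟨1, X - Polynomial.C a, ?_, ?_⟩
  · simpa [sub_eq_zero] using h
  · simp

theorem X_inv_mem_rh : (RatFunc.X⁻¹ : RatFunc ℝ) ∈ rhSubring := by
  refine ⟨isProper_X_inv, mem_stableSubring.2 fun w hw => ?_⟩
  have := noPole_inv_X_sub_C (a := 0) (w := w) (by rintro rfl; norm_num at hw)
  simpa using this

/-! ### Evaluation at a complex point -/

theorem evalC_add {f g : RatFunc ℝ} {w : ℂ} (hf : NoPole f w) (hg : NoPole g w) :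
    evalC w (f + g) = evalC w f + evalC w g :=
  RatFunc.eval_add (f := algebraMap ℝ ℂ) (a := w) hf hg

theorem evalC_mul {f g : RatFunc ℝ} {w : ℂ} (hf : NoPole f w) (hg : NoPole g w) :
    evalC w (f * g) = evalC w f * evalC w g :=
  RatFunc.eval_mul (f := algebraMap ℝ ℂ) (a := w) hf hg

theorem evalC_C (c : ℝ) (w : ℂ) : evalC w (RatFunc.C c) = c := by
  simp [evalC]

theorem evalC_X (w : ℂ) : evalC w RatFunc.X = w := by
  simp [evalC]

theorem evalC_algebraMap (p : ℝ[X]) (w : ℂ) : evalC w (algebraMap _ _ p) = aeval w p := by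
  simp [evalC, RatFunc.eval_algebraMap, aeval_def]

theorem evalC_sum {ι : Type*} (s : Finset ι) (f : ι → RatFunc ℝ) {w : ℂ}
    (h : ∀ i ∈ s, NoPole (f i) w) : evalC w (∑ i ∈ s, f i) = ∑ i ∈ s, evalC w (f i) := by
  classical
  induction s using Finset.induction_on with
  | empty => simp [evalC]
  | insert a s ha ih =>
    rw [Finset.sum_insert ha, Finset.sum_insert ha, evalC_add (h a (by simp)), ih]
    · exact fun i hi => h i (by simp [hi])
    · exact (noPoleSubring w).sum_mem fun i hi => h i (by simp [hi])

theorem evalC_div {p q : ℝ[X]} {w : ℂ} (hq : aeval w q ≠ 0) :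
    evalC w (algebraMap _ _ p / algebraMap _ _ q) = aeval w p / aeval w q := by
  have hq0 : q ≠ 0 := by rintro rfl; simp at hq
  have h1 : NoPole (algebraMap _ _ p / algebraMap _ (RatFunc ℝ) q) w :=
    noPole_iff.2 ⟨p, q, hq, rfl⟩
  have h2 := evalC_mul h1 (noPole_algebraMap q w)
  rw [div_mul_cancel₀ _ (RatFunc.algebraMap_ne_zero hq0), evalC_algebraMap, evalC_algebraMap] at h2
  rw [h2, mul_div_assoc, div_self hq, mul_one]

theorem evalC_inv {f : RatFunc ℝ} {w : ℂ} (hf : NoPole f w) (hfi : NoPole f⁻¹ w) :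
    evalC w f⁻¹ = (evalC w f)⁻¹ := by
  by_cases h : f = 0
  · simp [h, evalC]
  have := evalC_mul hf hfi
  rw [mul_inv_cancel₀ h] at this
  apply eq_inv_of_mul_eq_one_right
  rw [← this]; simp [evalC]

theorem NoPole.inv {f : RatFunc ℝ} {w : ℂ} (hf : evalC w f ≠ 0) : NoPole f⁻¹ w := by
  have hf' : NoPole f w := fun h => hf (by
    simp only [evalC, RatFunc.eval]
    rw [aeval_def] at h
    rw [h, div_zero])
  refine noPole_iff.2 ⟨f.denom, f.num, ?_, ?_⟩
  · intro h
    apply hf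
    simp only [evalC, RatFunc.eval]
    rw [aeval_def] at h
    rw [h, zero_div]
  · rw [← inv_div, RatFunc.num_div_denom]

/-- A rational function is zero if it vanishes at infinitely many points. -/
theorem eq_zero_of_evalC {f : RatFunc ℝ} {s : Set ℂ} (hs : s.Infinite)
    (hp : ∀ w ∈ s, NoPole f w) (h : ∀ w ∈ s, evalC w f = 0) : f = 0 := by
  rw [← RatFunc.num_eq_zero_iff]
  have hinj : Function.Injective (algebraMap ℝ ℂ) := (algebraMap ℝ ℂ).injective
  apply Polynomial.map_injective _ hinj
  rw [Polynomial.map_zero]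
  apply Polynomial.eq_zero_of_infinite_isRoot
  apply hs.mono
  intro w hw
  have h1 := h w hw
  simp only [evalC, RatFunc.eval, div_eq_zero_iff] at h1
  rcases h1 with h1 | h1
  · simpa [Polynomial.IsRoot, eval_map] using h1
  · exact absurd h1 (hp w hw)

/-! ### The substitution `z ↦ z⁻¹` -/

theorem eval₂_X_inv_ne_zero {q : ℝ[X]} (hq : q ≠ 0) :
    q.eval₂ RatFunc.C (RatFunc.X⁻¹ : RatFunc ℝ) ≠ 0 := by
  have h1 : Transcendental ℝ (RatFunc.X⁻¹ : RatFunc ℝ) := by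
    intro h
    exact RatFunc.transcendental_X (by simpa using h.inv)
  intro h
  exact h1 ⟨q, hq, h⟩

/-- The substitution `z ↦ z⁻¹` as a ring homomorphism. -/
def substInvHom : RatFunc ℝ →+* RatFunc ℝ :=
  RatFunc.liftRingHom (Polynomial.eval₂RingHom RatFunc.C (RatFunc.X⁻¹ : RatFunc ℝ)) (by
    intro q hq
    simp only [Submonoid.mem_comap, mem_nonZeroDivisors_iff_ne_zero] at *
    exact eval₂_X_inv_ne_zero hq)

theorem substInvHom_apply (f : RatFunc ℝ) : substInvHom f = substInv f := by
  rw [substInvHom, RatFunc.liftRingHom_apply]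
  rfl

theorem substInv_algebraMap (p : ℝ[X]) :
    substInv (algebraMap _ _ p) = p.eval₂ RatFunc.C (RatFunc.X⁻¹ : RatFunc ℝ) := by
  simp [substInv, RatFunc.eval]

theorem substInv_C (c : ℝ) : substInv (RatFunc.C c) = RatFunc.C c := by
  simp [substInv]

theorem substInv_X : substInv RatFunc.X = RatFunc.X⁻¹ := by
  simp [substInv]

theorem substInv_mul (f g : RatFunc ℝ) : substInv (f * g) = substInv f * substInv g := by
  simp only [← substInvHom_apply, map_mul]

theorem substInv_add (f g : RatFunc ℝ) : substInv (f + g) = substInv f + substInv g := by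
  simp only [← substInvHom_apply, map_add]

theorem substInv_inZInv (p : ℝ[X]) : substInv (inZInv p) = algebraMap _ _ p := by
  rw [← substInvHom_apply, inZInv, aeval_def, Polynomial.hom_eval₂, map_inv₀, substInvHom_apply,
    substInv_X, inv_inv]
  have : substInvHom.comp (algebraMap ℝ (RatFunc ℝ)) = RatFunc.C := by
    ext c
    simp [substInvHom_apply, RatFunc.algebraMap_eq_C, substInv_C]
  rw [this, ← RatFunc.aeval_X_left_eq_algebraMap, aeval_def]
  rfl

theorem eval₂_X_inv_eq (p : ℝ[X]) (d : ℕ) (hd : p.natDegree ≤ d) :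
    p.eval₂ RatFunc.C (RatFunc.X⁻¹ : RatFunc ℝ) =
      algebraMap _ _ (p.reflect d) / RatFunc.X ^ d := by
  let _ : Invertible (RatFunc.X⁻¹ : RatFunc ℝ) :=
    invertibleOfNonzero (inv_ne_zero RatFunc.X_ne_zero)
  have h := Polynomial.eval₂_reflect_mul_pow RatFunc.C (RatFunc.X⁻¹ : RatFunc ℝ) d p hd
  rw [← h, invOf_eq_inv, inv_inv, inv_pow, div_eq_mul_inv, ← RatFunc.aeval_X_left_eq_algebraMap]
  rfl

theorem substInv_div (p q : ℝ[X]) (d : ℕ) (hp : p.natDegree ≤ d) (hq : q.natDegree ≤ d) :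
    substInv (algebraMap _ _ p / algebraMap _ _ q) =
      algebraMap _ _ (p.reflect d) / algebraMap _ _ (q.reflect d) := by
  rw [← substInvHom_apply, map_div₀, substInvHom_apply, substInvHom_apply, substInv_algebraMap,
    substInv_algebraMap, eval₂_X_inv_eq p d hp, eval₂_X_inv_eq q d hq,
    div_div_div_cancel_right₀ (pow_ne_zero _ RatFunc.X_ne_zero)]

theorem aeval_reflect (q : ℝ[X]) (d : ℕ) (hq : q.natDegree ≤ d) {w : ℂ} (hw : w ≠ 0) :
    aeval w (q.reflect d) = w ^ d * aeval w⁻¹ q := by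
  let _ : Invertible (w⁻¹ : ℂ) := invertibleOfNonzero (inv_ne_zero hw)
  have h := Polynomial.eval₂_reflect_mul_pow (algebraMap ℝ ℂ) w⁻¹ d q hq
  rw [invOf_eq_inv, inv_inv] at h
  rw [aeval_def, aeval_def, ← h, mul_comm (w ^ d), mul_assoc, inv_pow, inv_mul_cancel₀ (pow_ne_zero _ hw),
    mul_one]

theorem substInv_eq {f : RatFunc ℝ} (hf : IsProper f) :
    substInv f = algebraMap _ _ (f.num.reflect f.denom.natDegree) /
      algebraMap _ _ f.denom.reverse := by
  conv_lhs => rw [← RatFunc.num_div_denom f]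
  exact substInv_div _ _ _ hf le_rfl

theorem reverse_denom_coeff_zero (f : RatFunc ℝ) : f.denom.reverse.coeff 0 = 1 := by
  rw [coeff_zero_reverse]; exact RatFunc.monic_denom f

theorem aeval_reverse_denom_ne_zero {f : RatFunc ℝ} {w : ℂ} (h : w ≠ 0 → NoPole f w⁻¹) :
    aeval w f.denom.reverse ≠ 0 := by
  by_cases hw : w = 0
  · subst hw
    rw [aeval_def, eval₂_at_zero, reverse_denom_coeff_zero]
    simp
  · rw [Polynomial.reverse, aeval_reflect _ _ le_rfl hw]
    exact mul_ne_zero (pow_ne_zero _ hw) (h hw)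

theorem NoPole.substInv {f : RatFunc ℝ} (hf : IsProper f) {w : ℂ} (h : w ≠ 0 → NoPole f w⁻¹) :
    NoPole (substInv f) w :=
  noPole_iff.2 ⟨_, _, aeval_reverse_denom_ne_zero h, substInv_eq hf⟩

theorem evalC_substInv {f : RatFunc ℝ} (hf : IsProper f) {w : ℂ} (hw : w ≠ 0)
    (h : NoPole f w⁻¹) : evalC w (MSStab.substInv f) = evalC w⁻¹ f := by
  rw [substInv_eq hf, evalC_div (aeval_reverse_denom_ne_zero fun _ => h), Polynomial.reverse,
    aeval_reflect _ _ hf hw, aeval_reflect _ _ le_rfl hw, mul_div_mul_left _ _ (pow_ne_zero _ hw)]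
  rfl

theorem evalC_conj (f : RatFunc ℝ) (w : ℂ) :
    evalC (starRingEnd ℂ w) f = starRingEnd ℂ (evalC w f) := by
  have h : ∀ p : ℝ[X], aeval (starRingEnd ℂ w) p = starRingEnd ℂ (aeval w p) :=
    fun p => Polynomial.aeval_conj p w
  simp only [aeval_def] at h
  simp only [evalC, RatFunc.eval, map_div₀, h]

/-! ### Impulse responses -/

/-- The power series in `z⁻¹` of a proper rational function. -/
def series (f : RatFunc ℝ) : PowerSeries ℝ :=
  (f.num.reflect f.denom.natDegree : PowerSeries ℝ) * (f.denom.reverse : PowerSeries ℝ)⁻¹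

theorem denom_reverse_mul_inv (f : RatFunc ℝ) :
    (f.denom.reverse : PowerSeries ℝ) * (f.denom.reverse : PowerSeries ℝ)⁻¹ = 1 := by
  apply PowerSeries.mul_inv_cancel
  rw [← PowerSeries.coeff_zero_eq_constantCoeff_apply, Polynomial.coeff_coe,
    reverse_denom_coeff_zero]
  exact one_ne_zero

theorem denom_reverse_mul_series (f : RatFunc ℝ) :
    (f.denom.reverse : PowerSeries ℝ) * series f =
      (f.num.reflect f.denom.natDegree : PowerSeries ℝ) := by
  rw [series, mul_left_comm, denom_reverse_mul_inv, mul_one]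

theorem coe_substInv {f : RatFunc ℝ} (hf : IsProper f) :
    ((substInv f : RatFunc ℝ) : LaurentSeries ℝ) = (series f : PowerSeries ℝ) := by
  have h0 : (f.denom.reverse : RatFunc ℝ) ≠ 0 := by
    apply RatFunc.algebraMap_ne_zero
    simpa using RatFunc.denom_ne_zero f
  have h1 : ((substInv f : RatFunc ℝ) : LaurentSeries ℝ) *
      ((f.denom.reverse : RatFunc ℝ) : LaurentSeries ℝ) =
      ((f.num.reflect f.denom.natDegree : RatFunc ℝ) : LaurentSeries ℝ) := by
    rw [← map_mul, substInv_eq hf]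
    congr 1
    exact div_mul_cancel₀ _ h0
  have h2 : ((f.denom.reverse : RatFunc ℝ) : LaurentSeries ℝ) ≠ 0 := by
    simpa using h0
  apply mul_right_cancel₀ h2
  rw [h1, ← RatFunc.coe_coe, ← RatFunc.coe_coe, ← PowerSeries.coe_mul, mul_comm,
    denom_reverse_mul_series]

theorem impulse_eq_coeff {f : RatFunc ℝ} (hf : IsProper f) (k : ℕ) :
    impulse f k = PowerSeries.coeff k (series f) := by
  rw [impulse, coe_substInv hf, LaurentSeries.coeff_coe_powerSeries]

theorem series_mul {f g : RatFunc ℝ} (hf : IsProper f) (hg : IsProper g) :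
    series (f * g) = series f * series g := by
  have h : ((series (f * g) : PowerSeries ℝ) : LaurentSeries ℝ) =
      ((series f * series g : PowerSeries ℝ) : LaurentSeries ℝ) := by
    rw [PowerSeries.coe_mul, ← coe_substInv hf, ← coe_substInv hg, ← coe_substInv (hf.mul hg),
      substInv_mul, map_mul]
  exact HahnSeries.ofPowerSeries_injective h

theorem impulse_mul {f g : RatFunc ℝ} (hf : IsProper f) (hg : IsProper g) (k : ℕ) :
    impulse (f * g) k = ∑ p ∈ Finset.HasAntidiagonal.antidiagonal k, impulse f p.1 * impulse g p.2 := by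
  rw [impulse_eq_coeff (hf.mul hg), series_mul hf hg, PowerSeries.coeff_mul]
  simp_rw [impulse_eq_coeff hf, impulse_eq_coeff hg]

theorem impulse_add (f g : RatFunc ℝ) (k : ℕ) :
    impulse (f + g) k = impulse f k + impulse g k := by
  simp [impulse, substInv_add]

theorem impulse_C_mul (c : ℝ) (f : RatFunc ℝ) (k : ℕ) :
    impulse (RatFunc.C c * f) k = c * impulse f k := by
  have : ((RatFunc.C c : RatFunc ℝ) : LaurentSeries ℝ) = HahnSeries.C c := by
    rw [← RatFunc.algebraMap_C]
    have := RatFunc.coe_coe (F := ℝ) (Polynomial.C c)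
    rw [RatFunc.coePolynomial_eq_algebraMap] at this
    rw [← this]
    simp
  simp [impulse, substInv_mul, substInv_C, this]

theorem impulse_zero (k : ℕ) : impulse 0 k = 0 := by
  have := impulse_C_mul 0 0 k
  simpa using this

theorem impulse_sum {ι : Type*} (s : Finset ι) (f : ι → RatFunc ℝ) (k : ℕ) :
    impulse (∑ i ∈ s, f i) k = ∑ i ∈ s, impulse (f i) k := by
  classical
  induction s using Finset.induction_on with
  | empty => simp [impulse_zero]
  | insert a s ha ih => rw [Finset.sum_insert ha, Finset.sum_insert ha, impulse_add, ih]

theorem series_X_inv : series (RatFunc.X⁻¹ : RatFunc ℝ) = PowerSeries.X := by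
  have h : ((series (RatFunc.X⁻¹ : RatFunc ℝ) : PowerSeries ℝ) : LaurentSeries ℝ) =
      ((PowerSeries.X : PowerSeries ℝ) : LaurentSeries ℝ) := by
    rw [← coe_substInv isProper_X_inv, ← substInvHom_apply, map_inv₀, substInvHom_apply,
      substInv_X, inv_inv, RatFunc.coe_X, PowerSeries.coe_X]
  exact HahnSeries.ofPowerSeries_injective h

theorem impulse_X_inv_mul_succ {f : RatFunc ℝ} (hf : IsProper f) (k : ℕ) :
    impulse (RatFunc.X⁻¹ * f) (k + 1) = impulse f k := by
  rw [impulse_eq_coeff (isProper_X_inv.mul hf), series_mul isProper_X_inv hf, series_X_inv,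
    PowerSeries.coeff_succ_X_mul, impulse_eq_coeff hf]

theorem impulse_X_inv_mul_zero {f : RatFunc ℝ} (hf : IsProper f) :
    impulse (RatFunc.X⁻¹ * f) 0 = 0 := by
  rw [impulse_eq_coeff (isProper_X_inv.mul hf), series_mul isProper_X_inv hf, series_X_inv,
    PowerSeries.coeff_zero_X_mul]

theorem impulse_C (c : ℝ) (k : ℕ) : impulse (RatFunc.C c) k = if k = 0 then c else 0 := by
  have h : ((series (RatFunc.C c : RatFunc ℝ) : PowerSeries ℝ) : LaurentSeries ℝ) =
      ((PowerSeries.C c : PowerSeries ℝ) : LaurentSeries ℝ) := by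
    rw [← coe_substInv (isProper_C c), substInv_C, ← RatFunc.algebraMap_C]
    have := RatFunc.coe_coe (F := ℝ) (Polynomial.C c)
    rw [RatFunc.coePolynomial_eq_algebraMap] at this
    rw [← this]
    simp
  rw [impulse_eq_coeff (isProper_C c), HahnSeries.ofPowerSeries_injective h, PowerSeries.coeff_C]

end

section

/-! ### Absolutely summable power series and Parseval's identity -/

/-- Power series with absolutely summable coefficients. -/
def Wiener (s : PowerSeries ℂ) : Prop := Summable fun k => ‖PowerSeries.coeff k s‖

theorem Wiener.summable_pow {s : PowerSeries ℂ} (hs : Wiener s) {ζ : ℂ} (hζ : ‖ζ‖ ≤ 1) :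
    Summable fun k => ‖PowerSeries.coeff k s * ζ ^ k‖ := by
  refine Summable.of_nonneg_of_le (fun _ => norm_nonneg _) (fun k => ?_) hs
  rw [norm_mul, norm_pow]
  exact mul_le_of_le_one_right (norm_nonneg _) (pow_le_one₀ (norm_nonneg _) hζ)

/-- The sum of an absolutely summable power series. -/
def wienerSum (s : PowerSeries ℂ) (ζ : ℂ) : ℂ := ∑' k, PowerSeries.coeff k s * ζ ^ k

theorem Wiener.mul {s t : PowerSeries ℂ} (hs : Wiener s) (ht : Wiener t) : Wiener (s * t) := by
  have := summable_norm_sum_mul_antidiagonal_of_summable_norm hs ht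
  simpa only [Wiener, PowerSeries.coeff_mul] using this

theorem wienerSum_mul {s t : PowerSeries ℂ} (hs : Wiener s) (ht : Wiener t) {ζ : ℂ}
    (hζ : ‖ζ‖ ≤ 1) : wienerSum (s * t) ζ = wienerSum s ζ * wienerSum t ζ := by
  rw [wienerSum, wienerSum, wienerSum, tsum_mul_tsum_eq_tsum_sum_antidiagonal_of_summable_norm
    (hs.summable_pow hζ) (ht.summable_pow hζ)]
  congr 1
  ext k
  rw [PowerSeries.coeff_mul, Finset.sum_mul]
  refine Finset.sum_congr rfl fun p hp => ?_
  rw [← Finset.HasAntidiagonal.mem_antidiagonal.1 hp, pow_add]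
  ring

theorem wiener_coe (p : ℂ[X]) : Wiener (p : PowerSeries ℂ) := by
  refine summable_of_ne_finset_zero (s := p.support) fun k hk => ?_
  rw [Polynomial.coeff_coe, Polynomial.notMem_support_iff.1 hk, norm_zero]

theorem wienerSum_coe (p : ℂ[X]) (ζ : ℂ) : wienerSum (p : PowerSeries ℂ) ζ = p.eval ζ := by
  rw [wienerSum, Polynomial.eval_eq_sum, Polynomial.sum_def]
  simp only [Polynomial.coeff_coe]
  refine tsum_eq_sum fun k hk => ?_
  rw [Polynomial.notMem_support_iff.1 hk, zero_mul]

theorem exists_wiener_inv_X_sub_C {a : ℂ} (ha : 1 < ‖a‖) :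
    ∃ s, Wiener s ∧ ((X - Polynomial.C a : ℂ[X]) : PowerSeries ℂ) * s = 1 := by
  have ha0 : a ≠ 0 := by rintro rfl; norm_num at ha
  refine ⟨PowerSeries.mk fun k => -(a⁻¹ ^ (k + 1)), ?_, ?_⟩
  · have : Summable fun k : ℕ => ‖a⁻¹‖ * ‖a⁻¹‖ ^ k :=
      (summable_geometric_of_lt_one (norm_nonneg _)
        (by rw [norm_inv]; exact inv_lt_one_of_one_lt₀ ha)).mul_left _
    refine this.congr fun k => ?_
    rw [PowerSeries.coeff_mk, norm_neg, norm_pow, pow_succ, mul_comm]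
  · ext k
    rw [Polynomial.coe_sub, Polynomial.coe_X, Polynomial.coe_C, sub_mul, map_sub,
      PowerSeries.coeff_C_mul, PowerSeries.coeff_mk]
    cases k with
    | zero => simp [ha0]
    | succ k =>
      rw [PowerSeries.coeff_succ_X_mul, PowerSeries.coeff_mk, PowerSeries.coeff_one,
        if_neg (by omega), pow_succ _ (k + 1)]
      field_simp
      ring

theorem exists_wiener_inv (q : ℂ[X]) (hq : ∀ w : ℂ, ‖w‖ ≤ 1 → q.eval w ≠ 0) :
    ∃ s, Wiener s ∧ (q : PowerSeries ℂ) * s = 1 := by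
  induction hn : q.natDegree generalizing q with
  | zero =>
    rw [Polynomial.natDegree_eq_zero] at hn
    obtain ⟨c, rfl⟩ := hn
    have hc : c ≠ 0 := by simpa using hq 0
    refine ⟨((Polynomial.C c⁻¹ : ℂ[X]) : PowerSeries ℂ), wiener_coe _, ?_⟩
    rw [← Polynomial.coe_mul, ← map_mul, mul_inv_cancel₀ hc]
    simp
  | succ n ih =>
    obtain ⟨a, ha⟩ := IsAlgClosed.exists_root q (by
      intro h
      rw [Polynomial.natDegree_eq_of_degree_eq_some (n := 0) (by simpa using h)] at hn
      omega)
    obtain ⟨r, hr⟩ := Polynomial.dvd_iff_isRoot.2 ha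
    have ha1 : 1 < ‖a‖ := by
      by_contra h
      exact hq a (not_lt.1 h) ha
    obtain ⟨s, hs, hs1⟩ := exists_wiener_inv_X_sub_C ha1
    have hr0 : r ≠ 0 := by
      rintro rfl
      simp [hr] at hn
    obtain ⟨t, ht, ht1⟩ := ih r (by
      intro w hw h
      apply hq w hw
      rw [hr, Polynomial.eval_mul, h, mul_zero]) (by
      rw [hr, Polynomial.natDegree_mul (Polynomial.X_sub_C_ne_zero a) hr0,
        Polynomial.natDegree_X_sub_C] at hn
      omega)
    refine ⟨s * t, hs.mul ht, ?_⟩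
    rw [hr, Polynomial.coe_mul, mul_mul_mul_comm, hs1, ht1, one_mul]

theorem wiener_series {f : RatFunc ℝ} (hf : RHInf f) :
    Wiener ((series f).map (algebraMap ℝ ℂ)) ∧ ∀ ζ : ℂ, ‖ζ‖ ≤ 1 → ζ ≠ 0 →
      wienerSum ((series f).map (algebraMap ℝ ℂ)) ζ = evalC ζ⁻¹ f := by
  set q := (f.denom.reverse).map (algebraMap ℝ ℂ) with hq
  set p := (f.num.reflect f.denom.natDegree).map (algebraMap ℝ ℂ) with hp
  have hnp : ∀ w : ℂ, ‖w‖ ≤ 1 → w ≠ 0 → NoPole f w⁻¹ := by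
    intro w hw hw0
    apply hf.2
    rw [norm_inv]
    exact (one_le_inv₀ (norm_pos_iff.2 hw0)).2 hw
  have hq0 : ∀ w : ℂ, ‖w‖ ≤ 1 → q.eval w ≠ 0 := by
    intro w hw
    rw [hq, Polynomial.eval_map, ← aeval_def]
    exact aeval_reverse_denom_ne_zero (hnp w hw)
  obtain ⟨s, hs, hs1⟩ := exists_wiener_inv q hq0
  have hps : (q : PowerSeries ℂ) * (series f).map (algebraMap ℝ ℂ) = (p : PowerSeries ℂ) := by
    rw [hq, hp, Polynomial.polynomial_map_coe, Polynomial.polynomial_map_coe, ← map_mul,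
      denom_reverse_mul_series]
  have h1 : (series f).map (algebraMap ℝ ℂ) = s * (p : PowerSeries ℂ) := by
    rw [← hps, ← mul_assoc, mul_comm s, hs1, one_mul]
  have h2 : Wiener ((series f).map (algebraMap ℝ ℂ)) := h1 ▸ hs.mul (wiener_coe p)
  refine ⟨h2, fun ζ hζ hζ0 => ?_⟩
  have h3 := wienerSum_mul (wiener_coe q) h2 hζ
  rw [hps, wienerSum_coe, wienerSum_coe] at h3
  rw [← evalC_substInv hf.1 hζ0 (hnp ζ hζ hζ0), substInv_eq hf.1,
    evalC_div (aeval_reverse_denom_ne_zero (hnp ζ hζ)), eq_div_iff, mul_comm]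
  · rw [hq, hp, Polynomial.eval_map, Polynomial.eval_map] at h3
    exact h3.symm
  · exact aeval_reverse_denom_ne_zero (hnp ζ hζ)

theorem summable_abs_impulse {f : RatFunc ℝ} (hf : RHInf f) :
    Summable fun k => |impulse f k| := by
  refine (wiener_series hf).1.congr fun k => ?_
  rw [impulse_eq_coeff hf.1, PowerSeries.coeff_map]
  simp

theorem norm_exp_mul_I (θ : ℝ) : ‖Complex.exp ((θ : ℂ) * Complex.I)‖ = 1 :=
  Complex.norm_exp_ofReal_mul_I θ

theorem hasSum_impulse {f : RatFunc ℝ} (hf : RHInf f) (θ : ℝ) :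
    HasSum (fun k : ℕ => (impulse f k : ℂ) * Complex.exp (-(k * θ : ℂ) * Complex.I))
      (evalC (Complex.exp ((θ : ℂ) * Complex.I)) f) := by
  obtain ⟨h1, h2⟩ := wiener_series hf
  have hn : ‖Complex.exp (-(θ : ℂ) * Complex.I)‖ ≤ 1 := by
    have := norm_exp_mul_I (-θ)
    push_cast at this
    exact this.le
  have h3 := h2 _ hn (Complex.exp_ne_zero _)
  rw [← Complex.exp_neg, neg_mul, neg_neg] at h3
  rw [← h3]
  have h4 := (h1.summable_pow hn).of_norm.hasSum
  rw [neg_mul] at h4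
  convert! h4 using 2 with k
  rw [impulse_eq_coeff hf.1, PowerSeries.coeff_map, ← Complex.exp_nat_mul]
  congr 2
  ring

theorem integral_exp_int (n : ℤ) :
    ∫ θ in (-Real.pi)..Real.pi, Complex.exp ((n * θ : ℂ) * Complex.I) =
      if n = 0 then (2 * Real.pi : ℂ) else 0 := by
  split_ifs with h
  · simp [h]; ring
  · have hn : (n * Complex.I : ℂ) ≠ 0 := by simp [h]
    have h1 := integral_exp_mul_complex (a := -Real.pi) (b := Real.pi) hn
    have : (fun θ : ℝ => Complex.exp ((n * θ : ℂ) * Complex.I)) =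
        fun θ : ℝ => Complex.exp ((n * Complex.I : ℂ) * θ) := by
      ext θ; ring_nf
    rw [this, h1, div_eq_zero_iff]
    left
    rw [sub_eq_zero, Complex.exp_eq_exp_iff_exists_int]
    refine ⟨n, ?_⟩
    push_cast
    ring

theorem continuous_evalC_circle {f : RatFunc ℝ} (hf : ∀ w : ℂ, ‖w‖ = 1 → NoPole f w) :
    Continuous fun θ : ℝ => evalC (Complex.exp ((θ : ℂ) * Complex.I)) f := by
  have he : Continuous fun θ : ℝ => Complex.exp ((θ : ℂ) * Complex.I) := by fun_prop
  have h : ∀ p : ℝ[X], Continuous fun θ : ℝ => aeval (Complex.exp ((θ : ℂ) * Complex.I)) p :=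
    fun p => (Polynomial.continuous_aeval p).comp he
  exact (h f.num).div (h f.denom) fun θ => hf _ (norm_exp_mul_I θ)

theorem integral_norm_sq_of_hasSum {c : ℕ → ℂ} (hc : Summable fun k => ‖c k‖) {F : ℝ → ℂ}
    (hF : Continuous F)
    (h : ∀ θ : ℝ, HasSum (fun k : ℕ => c k * Complex.exp (-(k * θ : ℂ) * Complex.I)) (F θ)) :
    HasSum (fun k => ‖c k‖ ^ 2)
      ((2 * Real.pi)⁻¹ * ∫ θ in (-Real.pi)..Real.pi, ‖F θ‖ ^ 2) := by
  have hexp : ∀ n : ℤ, ∀ θ : ℝ, ‖Complex.exp ((n * θ : ℂ) * Complex.I)‖ = 1 := by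
    intro n θ
    have := norm_exp_mul_I (n * θ)
    push_cast at this
    exact this
  have hneg : ∀ (k : ℕ) (θ : ℝ), Complex.exp (-(k * θ : ℂ) * Complex.I) =
      Complex.exp (((-(k : ℤ) : ℤ) * θ : ℂ) * Complex.I) := by
    intro k θ; push_cast; ring_nf
  have h1 : ∀ k : ℕ, ∫ θ in (-Real.pi)..Real.pi, F θ * Complex.exp (((k : ℤ) * θ : ℂ) * Complex.I) =
      2 * Real.pi * c k := by
    intro k
    have hs := intervalIntegral.hasSum_integral_of_dominated_convergence (μ := volume)
      (a := -Real.pi) (b := Real.pi)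
      (F := fun (l : ℕ) (θ : ℝ) => c l * Complex.exp (-(l * θ : ℂ) * Complex.I) *
        Complex.exp (((k : ℤ) * θ : ℂ) * Complex.I))
      (f := fun θ => F θ * Complex.exp (((k : ℤ) * θ : ℂ) * Complex.I))
      (bound := fun l _ => ‖c l‖)
      (fun l => Continuous.aestronglyMeasurable (by fun_prop))
      (fun l => Filter.Eventually.of_forall fun θ _ => by
        rw [norm_mul, norm_mul, hneg, hexp, hexp, mul_one, mul_one])
      (Filter.Eventually.of_forall fun θ _ => hc)
      (by simp)
      (Filter.Eventually.of_forall fun θ _ => (h θ).mul_right _)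
    rw [← hs.tsum_eq, tsum_eq_single k]
    · have : ∀ θ : ℝ, c k * Complex.exp (-(k * θ : ℂ) * Complex.I) *
          Complex.exp (((k : ℤ) * θ : ℂ) * Complex.I) = c k := by
        intro θ
        rw [mul_assoc, ← Complex.exp_add]
        push_cast
        simp
      simp only [this]
      rw [intervalIntegral.integral_const, sub_neg_eq_add, ← two_mul, Complex.real_smul]
      push_cast
      ring
    · intro l hl
      have : ∀ θ : ℝ, c l * Complex.exp (-(l * θ : ℂ) * Complex.I) *
          Complex.exp (((k : ℤ) * θ : ℂ) * Complex.I) =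
          c l * Complex.exp ((((k : ℤ) - (l : ℤ) : ℤ) * θ : ℂ) * Complex.I) := by
        intro θ
        rw [mul_assoc, ← Complex.exp_add]
        push_cast
        ring_nf
      simp only [this]
      rw [intervalIntegral.integral_const_mul, integral_exp_int, if_neg (by omega), mul_zero]
  have hs := intervalIntegral.hasSum_integral_of_dominated_convergence (μ := volume)
      (a := -Real.pi) (b := Real.pi)
      (F := fun (k : ℕ) (θ : ℝ) => starRingEnd ℂ (c k) *
        (F θ * Complex.exp (((k : ℤ) * θ : ℂ) * Complex.I)))
      (f := fun θ => ((‖F θ‖ ^ 2 : ℝ) : ℂ))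
      (bound := fun k θ => ‖c k‖ * ‖F θ‖)
      (fun l => Continuous.aestronglyMeasurable (by fun_prop))
      (fun l => Filter.Eventually.of_forall fun θ _ => by
        rw [norm_mul, norm_mul, hexp, mul_one, RCLike.norm_conj])
      (Filter.Eventually.of_forall fun θ _ => hc.mul_right _)
      (by
        simp only [tsum_mul_right]
        exact Continuous.intervalIntegrable (by fun_prop) _ _)
      (Filter.Eventually.of_forall fun θ _ => by
        have h2 := (Complex.hasSum_conj'.2 (h θ)).mul_left (F θ)
        rw [Complex.mul_conj, Complex.normSq_eq_norm_sq] at h2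
        convert! h2 using 2 with k
        rw [map_mul, ← Complex.exp_conj]
        simp
        ring)
  simp only [intervalIntegral.integral_const_mul, h1] at hs
  rw [intervalIntegral.integral_ofReal] at hs
  have h3 := hs.mul_left ((2 * Real.pi : ℂ)⁻¹)
  rw [← Complex.hasSum_ofReal]
  have hpi : (Real.pi : ℂ) ≠ 0 := by simp [Real.pi_ne_zero]
  convert! h3 using 2 with k
  · rw [mul_left_comm, mul_left_comm, mul_left_comm _ (2 * Real.pi : ℂ), ← mul_assoc,
      inv_mul_cancel₀ (by simp [hpi]), one_mul, mul_comm, Complex.mul_conj,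
      Complex.normSq_eq_norm_sq]
  · push_cast
    ring

/-- Parseval's identity for `RH_∞`. -/
theorem hasSum_sq_impulse {f : RatFunc ℝ} (hf : RHInf f) :
    HasSum (fun k => impulse f k ^ 2) (h2sq f) := by
  have h := integral_norm_sq_of_hasSum (c := fun k => (impulse f k : ℂ))
    ((summable_abs_impulse hf).congr fun k => by simp)
    (continuous_evalC_circle fun w hw => hf.2 w hw.ge) (hasSum_impulse hf)
  simp only [Complex.norm_real, Real.norm_eq_abs, sq_abs] at h
  exact h

theorem h2sq_nonneg (f : RatFunc ℝ) : 0 ≤ h2sq f :=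
  mul_nonneg (by positivity)
    (intervalIntegral.integral_nonneg (by linarith [Real.pi_pos]) fun _ _ => by positivity)

theorem h2sq_congr {f g : RatFunc ℝ}
    (h : ∀ w : ℂ, ‖w‖ = 1 → ‖evalC w f‖ = ‖evalC w g‖) : h2sq f = h2sq g := by
  rw [h2sq, h2sq]
  simp only [fun θ : ℝ => h _ (norm_exp_mul_I θ)]

end

section

/-! ### Eigenvalues, powers and nonnegative matrices -/

theorem summable_norm_pow_of_spectralRadius_lt_one {R : Type*} [NormedRing R] [NormedAlgebra ℂ R]
    [CompleteSpace R] {a : R} (h : spectralRadius ℂ a < 1) : Summable fun k => ‖a ^ k‖ := by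
  obtain ⟨r, hr1, hr2⟩ := ENNReal.lt_iff_exists_nnreal_btwn.1 h
  have hr3 : r < 1 := by exact_mod_cast hr2
  have h1 := (spectrum.pow_nnnorm_pow_one_div_tendsto_nhds_spectralRadius a).eventually
    (gt_mem_nhds hr1)
  refine Summable.of_norm_bounded_eventually (g := fun k => (r : ℝ) ^ k)
    (summable_geometric_of_lt_one r.2 hr3) ?_
  rw [Nat.cofinite_eq_atTop]
  filter_upwards [h1, Filter.eventually_gt_atTop 0] with k hk hk0
  rw [norm_norm]
  have hk' : (0 : ℝ) < k := by exact_mod_cast hk0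
  have h2 : ((‖a ^ k‖₊ : ℝ≥0∞) ^ (1 / (k : ℝ))) ^ (k : ℝ) ≤ (r : ℝ≥0∞) ^ (k : ℝ) :=
    ENNReal.rpow_le_rpow hk.le hk'.le
  rw [← ENNReal.rpow_mul, one_div, inv_mul_cancel₀ hk'.ne', ENNReal.rpow_one,
    ENNReal.rpow_natCast] at h2
  exact_mod_cast h2

section

attribute [local instance] Matrix.linftyOpNormedRing Matrix.linftyOpNormedAlgebra
  Matrix.linfty_opNormOneClass

theorem summable_pow_apply_of_spectralRadius_lt_one {n : ℕ} {A : Matrix (Fin n) (Fin n) ℂ}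
    (h : spectralRadius ℂ A < 1) (i j : Fin n) : Summable fun k => ‖(A ^ k) i j‖ := by
  refine Summable.of_nonneg_of_le (fun _ => norm_nonneg _) (fun k => ?_)
    (summable_norm_pow_of_spectralRadius_lt_one h)
  have h1 : ‖(A ^ k) i j‖₊ ≤ ‖A ^ k‖₊ := by
    rw [Matrix.linfty_opNNNorm_def]
    refine le_trans ?_ (Finset.le_sup (f := fun i => ∑ j, ‖(A ^ k) i j‖₊) (Finset.mem_univ i))
    exact Finset.single_le_sum (f := fun j => ‖(A ^ k) i j‖₊) (fun _ _ => zero_le)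
      (Finset.mem_univ j)
  exact_mod_cast h1

theorem spectralRadius_matrix_ne_top {n : ℕ} (A : Matrix (Fin n) (Fin n) ℂ) :
    spectralRadius ℂ A ≠ ∞ := by
  rcases Nat.eq_zero_or_pos n with rfl | hn
  · have : spectralRadius ℂ A = 0 := by
      rw [Subsingleton.elim A 0, spectrum.SpectralRadius.of_subsingleton]
    simp
  · have : Nonempty (Fin n) := ⟨⟨0, hn⟩⟩
    exact ne_top_of_le_ne_top ENNReal.coe_ne_top (spectrum.spectralRadius_le_nnnorm (𝕜 := ℂ) A)

theorem spectralRadius_lt_one_of_spectrum {n : ℕ} {A : Matrix (Fin n) (Fin n) ℂ}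
    (h : ∀ w ∈ spectrum ℂ A, ‖w‖ < 1) : spectralRadius ℂ A < 1 := by
  rcases Nat.eq_zero_or_pos n with rfl | hn
  · have : spectralRadius ℂ A = 0 := by
      rw [Subsingleton.elim A 0, spectrum.SpectralRadius.of_subsingleton]
    simp
  · have : Nonempty (Fin n) := ⟨⟨0, hn⟩⟩
    exact_mod_cast spectrum.spectralRadius_lt_of_forall_lt A (r := 1) fun z hz => h z hz

end

theorem aeval_charpoly_eq_det {n : ℕ} (A : Matrix (Fin n) (Fin n) ℝ) (w : ℂ) :
    aeval w A.charpoly = (algebraMap ℂ (Matrix (Fin n) (Fin n) ℂ) w - A.map (algebraMap ℝ ℂ)).det := by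
  rw [aeval_def, ← Polynomial.eval_map, ← Matrix.charpoly_map, Matrix.eval_charpoly]
  rfl

theorem mem_spectrum_iff_charpoly {n : ℕ} {A : Matrix (Fin n) (Fin n) ℝ} {w : ℂ} :
    w ∈ spectrum ℂ (A.map (algebraMap ℝ ℂ)) ↔ aeval w A.charpoly = 0 := by
  rw [spectrum.mem_iff, aeval_charpoly_eq_det, Matrix.isUnit_iff_isUnit_det, isUnit_iff_ne_zero,
    not_not]

theorem map_pow_algebraMap {n : ℕ} (A : Matrix (Fin n) (Fin n) ℝ) (k : ℕ) :
    (A.map (algebraMap ℝ ℂ)) ^ k = (A ^ k).map (algebraMap ℝ ℂ) :=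
  (map_pow (algebraMap ℝ ℂ).mapMatrix A k).symm

theorem summable_pow_of_charpoly {n : ℕ} {A : Matrix (Fin n) (Fin n) ℝ}
    (h : ∀ w : ℂ, 1 ≤ ‖w‖ → aeval w A.charpoly ≠ 0) (i j : Fin n) :
    Summable fun k => |(A ^ k) i j| := by
  have h1 : spectralRadius ℂ (A.map (algebraMap ℝ ℂ)) < 1 :=
    spectralRadius_lt_one_of_spectrum fun w hw => by
      by_contra h2
      exact h w (not_lt.1 h2) (mem_spectrum_iff_charpoly.1 hw)
  refine (summable_pow_apply_of_spectralRadius_lt_one h1 i j).congr fun k => ?_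
  rw [map_pow_algebraMap]
  simp

theorem tendsto_pow_of_charpoly {n : ℕ} {A : Matrix (Fin n) (Fin n) ℝ}
    (h : ∀ w : ℂ, 1 ≤ ‖w‖ → aeval w A.charpoly ≠ 0) :
    Filter.Tendsto (fun k => A ^ k) Filter.atTop (nhds 0) := by
  refine tendsto_pi_nhds.2 fun i => tendsto_pi_nhds.2 fun j => ?_
  exact (summable_pow_of_charpoly h i j).of_abs.tendsto_atTop_zero

/-- A square matrix without eigenvalues in the closed unit disc is invertible and its inverse has
its eigenvalues in the open unit disc. -/
theorem isUnit_and_inv_charpoly {n : ℕ} {A : Matrix (Fin n) (Fin n) ℝ}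
    (h : ∀ w : ℂ, ‖w‖ ≤ 1 → aeval w A.charpoly ≠ 0) :
    IsUnit A ∧ ∀ w : ℂ, 1 ≤ ‖w‖ → aeval w A⁻¹.charpoly ≠ 0 := by
  have hA : IsUnit A := by
    rw [Matrix.isUnit_iff_isUnit_det, isUnit_iff_ne_zero]
    intro h0
    apply h 0 (by simp)
    rw [aeval_charpoly_eq_det, map_zero, zero_sub, Matrix.det_neg]
    have : (A.map (algebraMap ℝ ℂ)).det = algebraMap ℝ ℂ A.det :=
      (RingHom.map_det (algebraMap ℝ ℂ) A).symm
    rw [this, h0]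
    simp
  refine ⟨hA, fun w hw => ?_⟩
  have hw0 : w ≠ 0 := by rintro rfl; norm_num at hw
  have h1 := h w⁻¹ (by rw [norm_inv]; exact inv_le_one_of_one_le₀ hw)
  rw [aeval_charpoly_eq_det] at h1 ⊢
  have hAi : A.map (algebraMap ℝ ℂ) * A⁻¹.map (algebraMap ℝ ℂ) = 1 := by
    rw [← Matrix.map_mul, Matrix.mul_nonsing_inv _ ((Matrix.isUnit_iff_isUnit_det A).1 hA)]
    simp
  intro h0
  have h2 : A.map (algebraMap ℝ ℂ) *
      (algebraMap ℂ (Matrix (Fin n) (Fin n) ℂ) w - A⁻¹.map (algebraMap ℝ ℂ)) =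
      (-w) • (algebraMap ℂ (Matrix (Fin n) (Fin n) ℂ) w⁻¹ - A.map (algebraMap ℝ ℂ)) := by
    rw [mul_sub, hAi, Algebra.algebraMap_eq_smul_one, Algebra.algebraMap_eq_smul_one, smul_sub,
      smul_smul, neg_mul, mul_inv_cancel₀ hw0]
    simp
    abel
  have h3 := congrArg Matrix.det h2
  rw [Matrix.det_mul, h0, mul_zero, Matrix.det_smul] at h3
  exact mul_ne_zero (pow_ne_zero _ (neg_ne_zero.2 hw0)) h1 h3.symm

theorem isUnit_aeval_of_coprime {n : ℕ} {A : Matrix (Fin n) (Fin n) ℝ} {p : ℝ[X]}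
    (h : ∀ w : ℂ, aeval w A.charpoly = 0 → aeval w p ≠ 0) : IsUnit (aeval A p) := by
  have h1 : IsCoprime p A.charpoly := by
    rw [Polynomial.isCoprime_iff_aeval_ne_zero_of_isAlgClosed ℝ ℂ]
    intro w
    by_cases hw : aeval w A.charpoly = 0
    · exact Or.inl (h w hw)
    · exact Or.inr hw
  obtain ⟨a, b, hab⟩ := h1
  have h2 := congrArg (aeval A) hab
  rw [map_add, map_mul, map_mul, Matrix.aeval_self_charpoly, mul_zero, add_zero, map_one] at h2
  exact (isUnit_iff_exists_inv').2 ⟨_, h2⟩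

theorem specRad_transpose {m : ℕ} (J : Matrix (Fin m) (Fin m) ℝ) : specRad Jᵀ = specRad J := by
  have : spectrum ℂ (Jᵀ.map (algebraMap ℝ ℂ)) = spectrum ℂ (J.map (algebraMap ℝ ℂ)) := by
    ext w
    rw [mem_spectrum_iff_charpoly, mem_spectrum_iff_charpoly, Matrix.charpoly_transpose]
  rw [specRad, specRad, spectralRadius, spectralRadius, this]

theorem specRad_nonneg {m : ℕ} (J : Matrix (Fin m) (Fin m) ℝ) : 0 ≤ specRad J :=
  ENNReal.toReal_nonneg

theorem specRad_le_of_mulVec_le {m : ℕ} {J : Matrix (Fin m) (Fin m) ℝ} (hJ : ∀ i j, 0 ≤ J i j)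
    {w : Fin m → ℝ} (hw : ∀ i, 0 < w i) {r : ℝ} (hr : 0 ≤ r) (h : ∀ i, (J *ᵥ w) i ≤ r * w i) :
    specRad J ≤ r := by
  rw [specRad]
  refine ENNReal.toReal_le_of_le_ofReal hr ?_
  rw [spectralRadius]
  refine iSup₂_le fun k hk => ?_
  have hk' : ¬ IsUnit (algebraMap ℂ (Matrix (Fin m) (Fin m) ℂ) k - J.map (algebraMap ℝ ℂ)).det := by
    rwa [← Matrix.isUnit_iff_isUnit_det]
  rw [isUnit_iff_ne_zero, not_not] at hk'
  obtain ⟨x, hx0, hx⟩ := Matrix.exists_mulVec_eq_zero_iff.2 hk'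
  rw [Matrix.sub_mulVec, sub_eq_zero, Algebra.algebraMap_eq_smul_one, Matrix.smul_mulVec,
    Matrix.one_mulVec] at hx
  obtain ⟨i0, hi0⟩ : ∃ i, x i ≠ 0 := Function.ne_iff.1 hx0
  obtain ⟨i, -, hi⟩ := Finset.exists_max_image Finset.univ (fun i => ‖x i‖ / w i)
    ⟨i0, Finset.mem_univ _⟩
  set c := ‖x i‖ / w i with hc
  have hcpos : 0 < c := lt_of_lt_of_le (div_pos (norm_pos_iff.2 hi0) (hw i0)) (hi i0 (Finset.mem_univ _))
  have hxi : ‖x i‖ = c * w i := by rw [hc, div_mul_cancel₀ _ (hw i).ne']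
  have h1 : ‖k‖ * ‖x i‖ ≤ r * ‖x i‖ := by
    have h2 := congrFun hx i
    rw [Pi.smul_apply, smul_eq_mul, Matrix.mulVec, dotProduct] at h2
    calc ‖k‖ * ‖x i‖ = ‖∑ j, (J.map (algebraMap ℝ ℂ)) i j * x j‖ := by rw [← norm_mul, h2]
      _ ≤ ∑ j, ‖(J.map (algebraMap ℝ ℂ)) i j * x j‖ := norm_sum_le _ _
      _ ≤ ∑ j, J i j * (c * w j) := by
        refine Finset.sum_le_sum fun j _ => ?_
        rw [norm_mul, Matrix.map_apply]
        simp only [Complex.coe_algebraMap, Complex.norm_real, Real.norm_eq_abs]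
        rw [abs_of_nonneg (hJ i j)]
        refine mul_le_mul_of_nonneg_left ?_ (hJ i j)
        have := hi j (Finset.mem_univ _)
        rwa [div_le_iff₀ (hw j)] at this
      _ = c * (J *ᵥ w) i := by
        rw [Matrix.mulVec, dotProduct, Finset.mul_sum]
        refine Finset.sum_congr rfl fun j _ => by ring
      _ ≤ c * (r * w i) := mul_le_mul_of_nonneg_left (h i) hcpos.le
      _ = r * ‖x i‖ := by rw [hxi]; ring
  have h2 : ‖k‖ ≤ r := le_of_mul_le_mul_right h1 (by rw [hxi]; exact mul_pos hcpos (hw i))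
  rw [← enorm_eq_nnnorm, ← ofReal_norm]
  exact ENNReal.ofReal_le_ofReal h2

theorem exists_pos_mulVec_le {m : ℕ} {J : Matrix (Fin m) (Fin m) ℝ} (hJ : ∀ i j, 0 ≤ J i j)
    {r : ℝ} (h : specRad J < r) :
    ∃ w : Fin m → ℝ, (∀ i, 0 < w i) ∧ ∀ i, (J *ᵥ w) i < r * w i := by
  have hr : 0 < r := (specRad_nonneg J).trans_lt h
  set K := r⁻¹ • J with hK
  have hK0 : ∀ k i j, 0 ≤ (K ^ k) i j := by
    intro k
    induction k with
    | zero => intro i j; rw [pow_zero, Matrix.one_apply]; split_ifs <;> norm_num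
    | succ k ih =>
      intro i j
      rw [pow_succ, Matrix.mul_apply]
      exact Finset.sum_nonneg fun l _ => mul_nonneg (ih i l) (mul_nonneg (by positivity) (hJ l j))
  have hsp : ∀ w : ℂ, 1 ≤ ‖w‖ → aeval w K.charpoly ≠ 0 := by
    intro w hw h0
    rw [aeval_charpoly_eq_det] at h0
    have h1 : (r * w : ℂ) ∈ spectrum ℂ (J.map (algebraMap ℝ ℂ)) := by
      rw [mem_spectrum_iff_charpoly, aeval_charpoly_eq_det]
      have : algebraMap ℂ (Matrix (Fin m) (Fin m) ℂ) (r * w) - J.map (algebraMap ℝ ℂ) =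
          (r : ℂ) • (algebraMap ℂ (Matrix (Fin m) (Fin m) ℂ) w - K.map (algebraMap ℝ ℂ)) := by
        have hrc : (r : ℂ) ≠ 0 := by exact_mod_cast hr.ne'
        ext i j
        simp only [hK, Matrix.sub_apply, Matrix.smul_apply, Matrix.map_apply,
          Matrix.algebraMap_matrix_apply, smul_eq_mul, mul_sub]
        simp [hrc]
      rw [this, Matrix.det_smul, h0, mul_zero]
    have h2 : (‖(r * w : ℂ)‖₊ : ℝ≥0∞) ≤ spectralRadius ℂ (J.map (algebraMap ℝ ℂ)) :=
      le_iSup₂ (f := fun (k : ℂ) (_ : k ∈ spectrum ℂ (J.map (algebraMap ℝ ℂ))) => (‖k‖₊ : ℝ≥0∞)) _ h1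
    have h3 := ENNReal.toReal_mono (spectralRadius_matrix_ne_top _) h2
    have h4 : r ≤ specRad J := by
      refine le_trans ?_ h3
      simp only [ENNReal.coe_toReal, coe_nnnorm, norm_mul, Complex.norm_real, Real.norm_eq_abs]
      rw [abs_of_pos hr]
      exact le_mul_of_one_le_right hr.le hw
    exact absurd h (not_lt.2 h4)
  have hsum := fun i j => (summable_pow_of_charpoly hsp i j).of_abs
  refine ⟨fun i => ∑ j, ∑' k, (K ^ k) i j, fun i => ?_, fun i => ?_⟩
  · refine Finset.sum_pos' (fun j _ => tsum_nonneg fun k => hK0 k i j) ⟨i, Finset.mem_univ _, ?_⟩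
    refine (hsum i i).tsum_pos (fun k => hK0 k i i) 0 ?_
    simp
  · have h1 : ∀ i j, ∑' k, (K ^ k) i j = (1 : Matrix (Fin m) (Fin m) ℝ) i j +
        ∑ l, K i l * ∑' k, (K ^ k) l j := by
      intro i j
      rw [(hsum i j).tsum_eq_zero_add, pow_zero]
      congr 1
      simp_rw [← tsum_mul_left, pow_succ', Matrix.mul_apply]
      exact Summable.tsum_finsetSum fun l _ => (hsum l j).mul_left _
    have h2 : ∑ j, ∑' k, (K ^ k) i j = 1 + r⁻¹ * (J *ᵥ fun i => ∑ j, ∑' k, (K ^ k) i j) i := by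
      rw [Finset.sum_congr rfl fun j _ => h1 i j, Finset.sum_add_distrib]
      congr 1
      · simp [Matrix.one_apply]
      · rw [Finset.sum_comm, Matrix.mulVec, dotProduct, Finset.mul_sum]
        refine Finset.sum_congr rfl fun l _ => ?_
        rw [← Finset.mul_sum, hK, Matrix.smul_apply, smul_eq_mul, mul_assoc]
    simp only [h2, mul_add, mul_one, ← mul_assoc, mul_inv_cancel₀ hr.ne', one_mul]
    linarith

theorem specRad_lt_one_of_mulVec_lt {m : ℕ} {J : Matrix (Fin m) (Fin m) ℝ}
    (hJ : ∀ i j, 0 ≤ J i j) {w : Fin m → ℝ} (hw : ∀ i, 0 < w i) (h : ∀ i, (J *ᵥ w) i < w i) :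
    specRad J < 1 := by
  obtain ⟨r, hr0, hr1, hr⟩ : ∃ r : ℝ, 0 ≤ r ∧ r < 1 ∧ ∀ i, (J *ᵥ w) i ≤ r * w i := by
    rcases isEmpty_or_nonempty (Fin m) with he | hne
    · exact ⟨0, le_rfl, one_pos, fun i => he.elim i⟩
    obtain ⟨i, -, hi⟩ := Finset.exists_max_image Finset.univ (fun i => (J *ᵥ w) i / w i)
      Finset.univ_nonempty
    refine ⟨(J *ᵥ w) i / w i, div_nonneg ?_ (hw i).le, (div_lt_one (hw i)).2 (h i), fun j => ?_⟩
    · rw [Matrix.mulVec, dotProduct]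
      exact Finset.sum_nonneg fun j _ => mul_nonneg (hJ i j) (hw j).le
    · rw [← div_le_iff₀ (hw j)]
      exact hi j (Finset.mem_univ _)
  exact (specRad_le_of_mulVec_le hJ hw hr0 hr).trans_lt hr1

end

section

/-! ### Lyapunov and Riccati equations -/

section Lyapunov

variable {m n : ℕ} {F : Matrix (Fin n) (Fin n) ℝ}

theorem quad_nonneg {Y : Matrix (Fin n) (Fin n) ℝ} (h : Y.PosSemidef) (x : Fin n → ℝ) :
    0 ≤ x ⬝ᵥ (Y *ᵥ x) := by
  simpa using h.dotProduct_mulVec_nonneg x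

theorem quad_pos {Y : Matrix (Fin n) (Fin n) ℝ} (h : Y.PosDef) {x : Fin n → ℝ} (hx : x ≠ 0) :
    0 < x ⬝ᵥ (Y *ᵥ x) := by
  simpa using h.dotProduct_mulVec_pos hx

theorem lyap_iterate (hF : IsUnit F) {Y S : Matrix (Fin n) (Fin n) ℝ} (h : Y = F * Y * Fᵀ - S) :
    Y = F⁻¹ * (Y + S) * F⁻¹ᵀ := by
  have hd := (Matrix.isUnit_iff_isUnit_det F).1 hF
  have h1 : Y + S = F * Y * Fᵀ := by rw [eq_sub_iff_add_eq] at h; exact h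
  rw [h1, Matrix.transpose_nonsing_inv, Matrix.mul_assoc, Matrix.mul_assoc, Matrix.mul_assoc,
    Matrix.mul_nonsing_inv _ (by simpa using hd), Matrix.mul_one, ← Matrix.mul_assoc,
    Matrix.nonsing_inv_mul _ hd, Matrix.one_mul]

theorem tendsto_conj_pow (hF : ∀ w : ℂ, ‖w‖ ≤ 1 → aeval w F.charpoly ≠ 0)
    (Y : Matrix (Fin n) (Fin n) ℝ) :
    Filter.Tendsto (fun k => F⁻¹ ^ k * Y * (F⁻¹ ^ k)ᵀ) Filter.atTop (nhds 0) := by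
  have h1 := tendsto_pow_of_charpoly (isUnit_and_inv_charpoly hF).2
  have hc : Continuous fun Z : Matrix (Fin n) (Fin n) ℝ => Z * Y * Zᵀ := by fun_prop
  have h2 := (hc.tendsto 0).comp h1
  rw [Matrix.zero_mul, Matrix.zero_mul] at h2
  exact h2

theorem lyap_unique (hF : ∀ w : ℂ, ‖w‖ ≤ 1 → aeval w F.charpoly ≠ 0)
    {Y : Matrix (Fin n) (Fin n) ℝ} (h : Y = F * Y * Fᵀ) : Y = 0 := by
  have h1 : Y = F⁻¹ * Y * F⁻¹ᵀ := by
    simpa using lyap_iterate (isUnit_and_inv_charpoly hF).1 (S := 0) (by simpa using h)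
  have h2 : ∀ k, F⁻¹ ^ k * Y * (F⁻¹ ^ k)ᵀ = Y := by
    intro k
    induction k with
    | zero => simp
    | succ k ih =>
      rw [pow_succ', Matrix.transpose_mul]
      calc F⁻¹ * F⁻¹ ^ k * Y * ((F⁻¹ ^ k)ᵀ * F⁻¹ᵀ) = F⁻¹ * (F⁻¹ ^ k * Y * (F⁻¹ ^ k)ᵀ) * F⁻¹ᵀ := by
            simp only [Matrix.mul_assoc]
        _ = Y := by rw [ih, ← h1]
  have h3 := tendsto_conj_pow hF Y
  simp only [h2] at h3
  exact tendsto_nhds_unique tendsto_const_nhds h3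

theorem lyap_exists (hF : ∀ w : ℂ, ‖w‖ ≤ 1 → aeval w F.charpoly ≠ 0)
    (S : Matrix (Fin n) (Fin n) ℝ) : ∃ Y : Matrix (Fin n) (Fin n) ℝ, Y = F * Y * Fᵀ - S := by
  let L : Matrix (Fin n) (Fin n) ℝ →ₗ[ℝ] Matrix (Fin n) (Fin n) ℝ :=
    { toFun := fun Y => F * Y * Fᵀ - Y
      map_add' := fun Y Z => by simp [Matrix.mul_add, Matrix.add_mul]; abel
      map_smul' := fun c Y => by simp [smul_sub] }
  have hL : Function.Injective L := by
    rw [← LinearMap.ker_eq_bot, LinearMap.ker_eq_bot']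
    intro Y hY
    exact lyap_unique hF (sub_eq_zero.1 hY).symm
  obtain ⟨Y, hY⟩ := (LinearMap.injective_iff_surjective.1 hL) S
  refine ⟨Y, ?_⟩
  rw [← hY]
  simp [L]

theorem lyap_eq (hF : ∀ w : ℂ, ‖w‖ ≤ 1 → aeval w F.charpoly ≠ 0)
    {Y Z S : Matrix (Fin n) (Fin n) ℝ} (hY : Y = F * Y * Fᵀ - S) (hZ : Z = F * Z * Fᵀ - S) :
    Y = Z := by
  rw [← sub_eq_zero]
  apply lyap_unique hF
  rw [Matrix.mul_sub, Matrix.sub_mul]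
  nth_rewrite 1 [hY]
  nth_rewrite 1 [hZ]
  abel

theorem lyap_posSemidef (hF : ∀ w : ℂ, ‖w‖ ≤ 1 → aeval w F.charpoly ≠ 0)
    {Y S : Matrix (Fin n) (Fin n) ℝ} (hS : S.PosSemidef) (hY : Y = F * Y * Fᵀ - S) :
    Y.PosSemidef := by
  have hsymm : Yᵀ = Y := by
    have hST : Sᵀ = S := by simpa [Matrix.IsHermitian] using hS.isHermitian
    refine lyap_eq hF ?_ hY
    nth_rewrite 1 [hY]
    rw [Matrix.transpose_sub, hST, Matrix.transpose_mul, Matrix.transpose_mul,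
      Matrix.transpose_transpose, Matrix.mul_assoc]
  refine Matrix.PosSemidef.of_dotProduct_mulVec_nonneg (by simpa [Matrix.IsHermitian] using hsymm)
    fun x => ?_
  rw [star_trivial]
  have h1 := lyap_iterate (isUnit_and_inv_charpoly hF).1 hY
  let f : ℕ → ℝ := fun k => x ⬝ᵥ ((F⁻¹ ^ k * Y * (F⁻¹ ^ k)ᵀ) *ᵥ x)
  have hanti : Antitone f := by
    refine antitone_nat_of_succ_le fun k => ?_
    have h2 : F⁻¹ ^ k * Y * (F⁻¹ ^ k)ᵀ = F⁻¹ ^ (k + 1) * Y * (F⁻¹ ^ (k + 1))ᵀ +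
        F⁻¹ ^ (k + 1) * S * (F⁻¹ ^ (k + 1))ᵀ := by
      nth_rewrite 1 [h1]
      rw [pow_succ, Matrix.transpose_mul]
      simp only [Matrix.mul_assoc, Matrix.mul_add, Matrix.add_mul]
    have h3 : (F⁻¹ ^ (k + 1) * S * (F⁻¹ ^ (k + 1))ᵀ).PosSemidef := by
      simpa using hS.mul_mul_conjTranspose_same (F⁻¹ ^ (k + 1))
    simp only [f]
    rw [h2, Matrix.add_mulVec, dotProduct_add]
    linarith [quad_nonneg h3 x]
  have hlim : Filter.Tendsto f Filter.atTop (nhds 0) := by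
    have hc : Continuous fun Z : Matrix (Fin n) (Fin n) ℝ => x ⬝ᵥ (Z *ᵥ x) := by
      fun_prop
    have := (hc.tendsto 0).comp (tendsto_conj_pow hF Y)
    rw [Matrix.zero_mulVec, dotProduct_zero] at this
    exact this
  have := hanti.le_of_tendsto hlim 0
  simpa [f] using this

theorem lyap_posDef (hF : ∀ w : ℂ, ‖w‖ ≤ 1 → aeval w F.charpoly ≠ 0)
    {G : Matrix (Fin n) (Fin m) ℝ} (hc : Controllable F G) {γ : Fin m → ℝ} (hγ : ∀ i, 0 < γ i)
    {Y : Matrix (Fin n) (Fin n) ℝ} (hY : Y = F * Y * Fᵀ - G * Matrix.diagonal γ * Gᵀ) :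
    Y.PosDef := by
  have hF1 := (isUnit_and_inv_charpoly hF).1
  have hd := (Matrix.isUnit_iff_isUnit_det F).1 hF1
  have hD : (Matrix.diagonal γ).PosDef := Matrix.PosDef.diagonal hγ
  have hS : (G * Matrix.diagonal γ * Gᵀ).PosSemidef := by
    simpa using hD.posSemidef.mul_mul_conjTranspose_same G
  have hpsd := lyap_posSemidef hF hS hY
  have h1 := lyap_iterate hF1 hY
  let K : Submodule ℝ (Fin n → ℝ) := LinearMap.ker (Matrix.mulVecLin Y)
  have hK : ∀ x, x ∈ K ↔ x ⬝ᵥ (Y *ᵥ x) = 0 := by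
    intro x
    rw [LinearMap.mem_ker, Matrix.mulVecLin_apply]
    simpa using (hpsd.dotProduct_mulVec_zero_iff x).symm
  have hstep : ∀ x ∈ K, F⁻¹ᵀ *ᵥ x ∈ K ∧ Gᵀ *ᵥ (F⁻¹ᵀ *ᵥ x) = 0 := by
    intro x hx
    rw [hK] at hx ⊢
    set y := F⁻¹ᵀ *ᵥ x with hy
    have h2 : x ⬝ᵥ (Y *ᵥ x) = y ⬝ᵥ (Y *ᵥ y) + y ⬝ᵥ ((G * Matrix.diagonal γ * Gᵀ) *ᵥ y) := by
      nth_rewrite 1 [h1]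
      rw [← dotProduct_add, ← Matrix.add_mulVec, ← Matrix.mulVec_mulVec, ← Matrix.mulVec_mulVec,
        ← hy, Matrix.dotProduct_mulVec, ← Matrix.mulVec_transpose, ← hy]
    have h3 := quad_nonneg hpsd y
    have h4 := quad_nonneg hS y
    refine ⟨by linarith, ?_⟩
    have h5 : y ⬝ᵥ ((G * Matrix.diagonal γ * Gᵀ) *ᵥ y) = 0 := by linarith
    rw [← Matrix.mulVec_mulVec, ← Matrix.mulVec_mulVec, Matrix.dotProduct_mulVec,
      ← Matrix.mulVec_transpose] at h5
    by_contra hne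
    exact (quad_pos hD hne).ne' h5
  have hsurj : ∀ x ∈ K, ∃ y ∈ K, F⁻¹ᵀ *ᵥ y = x := by
    let φ : K →ₗ[ℝ] K := (Matrix.mulVecLin F⁻¹ᵀ).restrict fun x hx => (hstep x hx).1
    have hφ : Function.Injective φ := by
      intro x y hxy
      have h2 : F⁻¹ᵀ *ᵥ (x : Fin n → ℝ) = F⁻¹ᵀ *ᵥ (y : Fin n → ℝ) := congrArg Subtype.val hxy
      have h3 := congrArg (fun v => Fᵀ *ᵥ v) h2
      simp only [Matrix.mulVec_mulVec, ← Matrix.transpose_mul, Matrix.nonsing_inv_mul _ hd,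
        Matrix.transpose_one, Matrix.one_mulVec] at h3
      exact Subtype.ext h3
    intro x hx
    obtain ⟨y, hy⟩ := LinearMap.injective_iff_surjective.1 hφ ⟨x, hx⟩
    exact ⟨y, y.2, congrArg Subtype.val hy⟩
  have hG : ∀ x ∈ K, Gᵀ *ᵥ x = 0 := by
    intro x hx
    obtain ⟨y, hy, rfl⟩ := hsurj x hx
    exact (hstep y hy).2
  have hFK : ∀ x ∈ K, Fᵀ *ᵥ x ∈ K := by
    intro x hx
    obtain ⟨y, hy, rfl⟩ := hsurj x hx
    rwa [Matrix.mulVec_mulVec, ← Matrix.transpose_mul, Matrix.nonsing_inv_mul _ hd,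
      Matrix.transpose_one, Matrix.one_mulVec]
  have hpow : ∀ k : ℕ, ∀ x ∈ K, (F ^ k)ᵀ *ᵥ x ∈ K := by
    intro k
    induction k with
    | zero => intro x hx; simpa using hx
    | succ k ih =>
      intro x hx
      rw [pow_succ, Matrix.transpose_mul, ← Matrix.mulVec_mulVec]
      exact hFK _ (ih x hx)
  refine Matrix.PosDef.of_dotProduct_mulVec_pos hpsd.isHermitian fun x hx => ?_
  rw [star_trivial]
  refine lt_of_le_of_ne (quad_nonneg hpsd x) fun h0 => hx ?_
  refine hc x fun k => ?_
  rw [← Matrix.mulVec_transpose, Matrix.transpose_mul, ← Matrix.mulVec_mulVec]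
  exact hG _ (hpow k x ((hK x).2 h0.symm))

end Lyapunov

section Riccati

variable {m n : ℕ} {A : Matrix (Fin n) (Fin n) ℝ} {B : Matrix (Fin n) (Fin m) ℝ}
  {C : Matrix (Fin m) (Fin n) ℝ} {D : Matrix (Fin m) (Fin m) ℝ}

/-- `R = Γ + B̂ᵀ X B̂`. -/
def ricR (Bh : Matrix (Fin n) (Fin m) ℝ) (γ : Fin m → ℝ) (X : Matrix (Fin n) (Fin n) ℝ) :
    Matrix (Fin m) (Fin m) ℝ := Matrix.diagonal γ + Bhᵀ * X * Bh

/-- The optimal feedback gain `R⁻¹ B̂ᵀ X Â`. -/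
def ricGain (Ah : Matrix (Fin n) (Fin n) ℝ) (Bh : Matrix (Fin n) (Fin m) ℝ) (γ : Fin m → ℝ)
    (X : Matrix (Fin n) (Fin n) ℝ) : Matrix (Fin m) (Fin n) ℝ := (ricR Bh γ X)⁻¹ * (Bhᵀ * X * Ah)

theorem ricR_posDef {Bh : Matrix (Fin n) (Fin m) ℝ} {γ : Fin m → ℝ} (hγ : ∀ i, 0 < γ i)
    {X : Matrix (Fin n) (Fin n) ℝ} (hX : X.PosDef) : (ricR Bh γ X).PosDef := by
  refine (Matrix.PosDef.diagonal hγ).add_posSemidef ?_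
  simpa using hX.posSemidef.conjTranspose_mul_mul_same Bh

/-- The Riccati equation after the feedback transformation that removes `C`. -/
theorem isDARE_iff_reduced (hD : IsUnit D) {γ : Fin m → ℝ} (hγ : ∀ i, 0 < γ i)
    {X : Matrix (Fin n) (Fin n) ℝ} (hX : X.PosDef) :
    IsDARE A B C D γ X ↔ X = (Ahat A B C D)ᵀ *
      (X - X * (B * D⁻¹) * (ricR (B * D⁻¹) γ X)⁻¹ * (B * D⁻¹)ᵀ * X) * Ahat A B C D := by
  have hDd := (Matrix.isUnit_iff_isUnit_det D).1 hD
  set Ah := Ahat A B C D with hAh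
  set Bh := B * D⁻¹ with hBh
  set R := ricR Bh γ X with hR
  have hRd := (Matrix.isUnit_iff_isUnit_det R).1 (ricR_posDef hγ hX).isUnit
  have hA : A = Ah + Bh * C := by rw [hAh, Ahat]; abel
  have hB : B = Bh * D := by rw [hBh, Matrix.mul_assoc, Matrix.nonsing_inv_mul _ hDd, Matrix.mul_one]
  have h1 : Dᵀ * Matrix.diagonal γ * D + Bᵀ * X * B = Dᵀ * R * D := by
    rw [hR, ricR, hB, Matrix.transpose_mul]
    simp only [Matrix.mul_assoc, Matrix.mul_add, Matrix.add_mul]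
  have h2 : Aᵀ * X * B + Cᵀ * Matrix.diagonal γ * D = (Ahᵀ * X * Bh + Cᵀ * R) * D := by
    rw [hR, ricR, hB, hA, Matrix.transpose_add, Matrix.transpose_mul]
    simp only [Matrix.mul_assoc, Matrix.mul_add, Matrix.add_mul]
    abel
  have h3 : Bᵀ * X * A + Dᵀ * Matrix.diagonal γ * C = Dᵀ * (Bhᵀ * X * Ah + R * C) := by
    rw [hR, ricR, hB, hA, Matrix.transpose_mul]
    simp only [Matrix.mul_assoc, Matrix.mul_add, Matrix.add_mul]
    abel
  have h4 : D * (Dᵀ * R * D)⁻¹ * Dᵀ = R⁻¹ := by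
    rw [Matrix.mul_inv_rev, Matrix.mul_inv_rev]
    calc D * (D⁻¹ * (R⁻¹ * Dᵀ⁻¹)) * Dᵀ = (D * D⁻¹) * R⁻¹ * (Dᵀ⁻¹ * Dᵀ) := by
          simp only [Matrix.mul_assoc]
      _ = R⁻¹ := by
          rw [Matrix.mul_nonsing_inv _ hDd, Matrix.nonsing_inv_mul _ (by simpa using hDd),
            Matrix.one_mul, Matrix.mul_one]
  have h5 : (Ahᵀ * X * Bh + Cᵀ * R) * D * (Dᵀ * R * D)⁻¹ * (Dᵀ * (Bhᵀ * X * Ah + R * C)) =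
      Ahᵀ * X * Bh * R⁻¹ * Bhᵀ * X * Ah + Ahᵀ * X * Bh * C + Cᵀ * Bhᵀ * X * Ah + Cᵀ * R * C := by
    calc _ = (Ahᵀ * X * Bh + Cᵀ * R) * (D * (Dᵀ * R * D)⁻¹ * Dᵀ) * (Bhᵀ * X * Ah + R * C) := by
          simp only [Matrix.mul_assoc]
      _ = Ahᵀ * X * Bh * R⁻¹ * Bhᵀ * X * Ah + Ahᵀ * X * Bh * (R⁻¹ * R) * C +
          Cᵀ * (R * R⁻¹) * Bhᵀ * X * Ah + Cᵀ * (R * R⁻¹) * R * C := by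
          rw [h4]
          simp only [Matrix.mul_assoc, Matrix.mul_add, Matrix.add_mul]
          abel
      _ = _ := by
          rw [Matrix.mul_nonsing_inv _ hRd, Matrix.nonsing_inv_mul _ hRd]
          simp only [Matrix.mul_one]
  have h6 : Aᵀ * X * A + Cᵀ * Matrix.diagonal γ * C =
      Ahᵀ * X * Ah + Ahᵀ * X * Bh * C + Cᵀ * Bhᵀ * X * Ah + Cᵀ * R * C := by
    rw [hR, ricR, hA, Matrix.transpose_add, Matrix.transpose_mul]
    simp only [Matrix.mul_assoc, Matrix.mul_add, Matrix.add_mul]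
    abel
  rw [IsDARE, h1, h2, h3, h5, h6]
  have h7 : Ahᵀ * X * Ah + Ahᵀ * X * Bh * C + Cᵀ * Bhᵀ * X * Ah + Cᵀ * R * C -
      (Ahᵀ * X * Bh * R⁻¹ * Bhᵀ * X * Ah + Ahᵀ * X * Bh * C + Cᵀ * Bhᵀ * X * Ah + Cᵀ * R * C) =
      Ahᵀ * (X - X * Bh * R⁻¹ * Bhᵀ * X) * Ah := by
    simp only [Matrix.mul_assoc, Matrix.mul_sub, Matrix.sub_mul]
    abel
  rw [h7]

theorem woodbury {Bh : Matrix (Fin n) (Fin m) ℝ} {γ : Fin m → ℝ} (hγ : ∀ i, 0 < γ i)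
    {X : Matrix (Fin n) (Fin n) ℝ} (hX : X.PosDef) :
    (X⁻¹ + Bh * Matrix.diagonal (fun i => (γ i)⁻¹) * Bhᵀ)⁻¹ =
      X - X * Bh * (ricR Bh γ X)⁻¹ * Bhᵀ * X := by
  have hXd := (Matrix.isUnit_iff_isUnit_det X).1 hX.isUnit
  have hγi : ∀ i, 0 < (γ i)⁻¹ := fun i => inv_pos.2 (hγ i)
  have hinv : (Matrix.diagonal fun i => (γ i)⁻¹)⁻¹ = Matrix.diagonal γ := by
    apply Matrix.inv_eq_left_inv
    rw [Matrix.diagonal_mul_diagonal]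
    simp [fun i => mul_inv_cancel₀ (hγ i).ne']
  have h := Matrix.add_mul_mul_inv_eq_sub X⁻¹ Bh (Matrix.diagonal fun i => (γ i)⁻¹) Bhᵀ
    hX.inv.isUnit (Matrix.PosDef.diagonal hγi).isUnit (by
      rw [hinv, Matrix.nonsing_inv_nonsing_inv _ hXd]
      exact (ricR_posDef hγ hX).isUnit)
  rw [hinv, Matrix.nonsing_inv_nonsing_inv _ hXd] at h
  exact h

theorem isDARE_iff (hD : IsUnit D) (hA : IsUnit (Ahat A B C D)) {γ : Fin m → ℝ}
    (hγ : ∀ i, 0 < γ i) {X : Matrix (Fin n) (Fin n) ℝ} (hX : X.PosDef) :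
    IsDARE A B C D γ X ↔ X⁻¹ = Ahat A B C D * X⁻¹ * (Ahat A B C D)ᵀ -
      (B * D⁻¹) * Matrix.diagonal (fun i => (γ i)⁻¹) * (B * D⁻¹)ᵀ := by
  rw [isDARE_iff_reduced hD hγ hX, ← woodbury hγ hX]
  set Ah := Ahat A B C D with hAh
  set Bh := B * D⁻¹ with hBh
  set S := Bh * Matrix.diagonal (fun i => (γ i)⁻¹) * Bhᵀ with hS
  have hAd := (Matrix.isUnit_iff_isUnit_det Ah).1 hA
  have hXd := (Matrix.isUnit_iff_isUnit_det X).1 hX.isUnit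
  have hγi : ∀ i, 0 < (γ i)⁻¹ := fun i => inv_pos.2 (hγ i)
  have hSp : S.PosSemidef := by
    simpa using (Matrix.PosDef.diagonal hγi).posSemidef.mul_mul_conjTranspose_same Bh
  have hPd := (Matrix.isUnit_iff_isUnit_det _).1 (hX.inv.add_posSemidef hSp).isUnit
  constructor
  · intro h
    have h1 : X⁻¹ = Ah⁻¹ * (X⁻¹ + S) * Ahᵀ⁻¹ := by
      nth_rewrite 1 [h]
      rw [Matrix.mul_inv_rev, Matrix.mul_inv_rev, Matrix.nonsing_inv_nonsing_inv _ hPd,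
        Matrix.mul_assoc]
    have h2 : Ah * X⁻¹ * Ahᵀ = X⁻¹ + S := by
      nth_rewrite 1 [h1]
      calc _ = (Ah * Ah⁻¹) * (X⁻¹ + S) * (Ahᵀ⁻¹ * Ahᵀ) := by simp only [Matrix.mul_assoc]
        _ = _ := by
          rw [Matrix.mul_nonsing_inv _ hAd, Matrix.nonsing_inv_mul _ (by simpa using hAd),
            Matrix.one_mul, Matrix.mul_one]
    rw [h2]; abel
  · intro h
    have h2 : X⁻¹ + S = Ah * X⁻¹ * Ahᵀ := by rw [eq_sub_iff_add_eq] at h; exact h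
    rw [h2, Matrix.mul_inv_rev, Matrix.mul_inv_rev, Matrix.nonsing_inv_nonsing_inv _ hXd]
    calc X = (Ahᵀ * Ahᵀ⁻¹) * X * (Ah⁻¹ * Ah) := by
          rw [Matrix.nonsing_inv_mul _ hAd, Matrix.mul_nonsing_inv _ (by simpa using hAd),
            Matrix.one_mul, Matrix.mul_one]
      _ = _ := by simp only [Matrix.mul_assoc]

theorem dotProduct_mulVec_comm {X : Matrix (Fin n) (Fin n) ℝ} (hX : Xᵀ = X) (x y : Fin n → ℝ) :
    x ⬝ᵥ (X *ᵥ y) = y ⬝ᵥ (X *ᵥ x) := by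
  rw [Matrix.dotProduct_mulVec, ← Matrix.mulVec_transpose, hX, dotProduct_comm]

/-- Completion of squares for the reduced Riccati equation. -/
theorem complete_square {Ah : Matrix (Fin n) (Fin n) ℝ} {Bh : Matrix (Fin n) (Fin m) ℝ}
    {γ : Fin m → ℝ} (hγ : ∀ i, 0 < γ i) {X : Matrix (Fin n) (Fin n) ℝ} (hX : X.PosDef)
    (h : X = Ahᵀ * (X - X * Bh * (ricR Bh γ X)⁻¹ * Bhᵀ * X) * Ah) (x : Fin n → ℝ) (g : Fin m → ℝ) :
    (∑ i, γ i * g i ^ 2) + (Ah *ᵥ x - Bh *ᵥ g) ⬝ᵥ (X *ᵥ (Ah *ᵥ x - Bh *ᵥ g)) =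
      x ⬝ᵥ (X *ᵥ x) + (g - ricGain Ah Bh γ X *ᵥ x) ⬝ᵥ
        (ricR Bh γ X *ᵥ (g - ricGain Ah Bh γ X *ᵥ x)) := by
  have hXs : Xᵀ = X := by simpa [Matrix.IsHermitian] using hX.isHermitian
  have hRp := ricR_posDef (Bh := Bh) hγ hX
  have hRs : (ricR Bh γ X)ᵀ = ricR Bh γ X := by simpa [Matrix.IsHermitian] using hRp.isHermitian
  have hRd := (Matrix.isUnit_iff_isUnit_det _).1 hRp.isUnit
  set R := ricR Bh γ X with hR
  set u := Ah *ᵥ x with hu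
  set p := Bhᵀ *ᵥ (X *ᵥ u) with hp
  set f := R⁻¹ *ᵥ p with hf
  have hfx : ricGain Ah Bh γ X *ᵥ x = f := by
    rw [ricGain, hf, hp, hu]
    simp only [Matrix.mulVec_mulVec, Matrix.mul_assoc, ← hR]
  have hRf : R *ᵥ f = p := by
    rw [hf, Matrix.mulVec_mulVec, Matrix.mul_nonsing_inv _ hRd, Matrix.one_mulVec]
  have h1 : x ⬝ᵥ (X *ᵥ x) = u ⬝ᵥ (X *ᵥ u) - p ⬝ᵥ f := by
    nth_rewrite 1 [h]
    rw [← Matrix.mulVec_mulVec, ← hu, ← Matrix.mulVec_mulVec, Matrix.dotProduct_mulVec,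
      ← Matrix.mulVec_transpose, Matrix.transpose_transpose, ← hu, Matrix.sub_mulVec,
      dotProduct_sub]
    congr 1
    have : (X * Bh * R⁻¹ * Bhᵀ * X) *ᵥ u = (X * Bh) *ᵥ f := by
      rw [hf, hp]
      simp only [Matrix.mulVec_mulVec, Matrix.mul_assoc]
    rw [this, Matrix.dotProduct_mulVec, ← Matrix.mulVec_transpose, Matrix.transpose_mul, hXs,
      ← Matrix.mulVec_mulVec]
  have h2 : g ⬝ᵥ (R *ᵥ g) = (∑ i, γ i * g i ^ 2) + (Bh *ᵥ g) ⬝ᵥ (X *ᵥ (Bh *ᵥ g)) := by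
    rw [hR, ricR, Matrix.add_mulVec, dotProduct_add]
    congr 1
    · rw [dotProduct]
      refine Finset.sum_congr rfl fun i _ => ?_
      rw [Matrix.mulVec_diagonal]
      ring
    · rw [← Matrix.mulVec_mulVec, ← Matrix.mulVec_mulVec, Matrix.dotProduct_mulVec,
        ← Matrix.mulVec_transpose, Matrix.transpose_transpose]
  have h3 : (Bh *ᵥ g) ⬝ᵥ (X *ᵥ u) = g ⬝ᵥ p := by
    rw [hp, Matrix.dotProduct_mulVec g, ← Matrix.mulVec_transpose, Matrix.transpose_transpose]
  rw [hfx, h1]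
  simp only [Matrix.mulVec_sub, dotProduct_sub, sub_dotProduct, hRf]
  rw [h2, dotProduct_mulVec_comm hXs u (Bh *ᵥ g), h3, dotProduct_mulVec_comm hRs f g, hRf,
    dotProduct_comm f p]
  ring

/-- The closed-loop matrix is similar to `Â⁻ᵀ`. -/
theorem closedLoop_charpoly {Ah : Matrix (Fin n) (Fin n) ℝ} {Bh : Matrix (Fin n) (Fin m) ℝ}
    (hA : IsUnit Ah) {γ : Fin m → ℝ} {X : Matrix (Fin n) (Fin n) ℝ}
    (hX : X.PosDef) (h : X = Ahᵀ * (X - X * Bh * (ricR Bh γ X)⁻¹ * Bhᵀ * X) * Ah) :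
    (Ah - Bh * ricGain Ah Bh γ X).charpoly = Ah⁻¹.charpoly := by
  have hAd := (Matrix.isUnit_iff_isUnit_det Ah).1 hA
  have hXd := (Matrix.isUnit_iff_isUnit_det X).1 hX.isUnit
  have h1 : X * (Ah - Bh * ricGain Ah Bh γ X) = Ah⁻¹ᵀ * X := by
    rw [ricGain]
    calc _ = (Ahᵀ⁻¹ * Ahᵀ) * ((X - X * Bh * (ricR Bh γ X)⁻¹ * Bhᵀ * X) * Ah) := by
          rw [Matrix.nonsing_inv_mul _ (by simpa using hAd), Matrix.one_mul]
          simp only [Matrix.mul_assoc, Matrix.mul_sub, Matrix.sub_mul]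
      _ = Ahᵀ⁻¹ * (Ahᵀ * (X - X * Bh * (ricR Bh γ X)⁻¹ * Bhᵀ * X) * Ah) := by
          simp only [Matrix.mul_assoc]
      _ = _ := by rw [← h, Matrix.transpose_nonsing_inv]
  have h2 : Ah - Bh * ricGain Ah Bh γ X = X⁻¹ * Ah⁻¹ᵀ * X := by
    rw [Matrix.mul_assoc, ← h1, ← Matrix.mul_assoc, Matrix.nonsing_inv_mul _ hXd, Matrix.one_mul]
  obtain ⟨u, hu⟩ := hX.isUnit
  rw [h2, ← hu, Matrix.charpoly_units_conj', Matrix.charpoly_transpose]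

end Riccati

end

section

/-! ### Matrices over a subring of the rational functions -/

/-- All entries of `F` lie in the subring `S`. -/
def MatIn {ι κ : Type*} (S : Subring (RatFunc ℝ)) (F : Matrix ι κ (RatFunc ℝ)) : Prop :=
  ∀ i j, F i j ∈ S

namespace MatIn

variable {ι κ τ : Type*} {S : Subring (RatFunc ℝ)}

theorem mul [Fintype κ] {F : Matrix ι κ (RatFunc ℝ)} {G : Matrix κ τ (RatFunc ℝ)}
    (hF : MatIn S F) (hG : MatIn S G) : MatIn S (F * G) := fun i j => by
  rw [Matrix.mul_apply]
  exact S.sum_mem fun k _ => S.mul_mem (hF i k) (hG k j)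

theorem add {F G : Matrix ι κ (RatFunc ℝ)} (hF : MatIn S F) (hG : MatIn S G) :
    MatIn S (F + G) := fun i j => S.add_mem (hF i j) (hG i j)

theorem sub {F G : Matrix ι κ (RatFunc ℝ)} (hF : MatIn S F) (hG : MatIn S G) :
    MatIn S (F - G) := fun i j => S.sub_mem (hF i j) (hG i j)

theorem smul {F : Matrix ι κ (RatFunc ℝ)} {c : RatFunc ℝ} (hc : c ∈ S) (hF : MatIn S F) :
    MatIn S (c • F) := fun i j => S.mul_mem hc (hF i j)

theorem transpose {F : Matrix ι κ (RatFunc ℝ)} (hF : MatIn S F) : MatIn S Fᵀ :=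
  fun i j => hF j i

theorem one [DecidableEq ι] : MatIn S (1 : Matrix ι ι (RatFunc ℝ)) := fun i j => by
  rw [Matrix.one_apply]
  split_ifs
  exacts [S.one_mem, S.zero_mem]

theorem diagonal [DecidableEq ι] {d : ι → RatFunc ℝ} (hd : ∀ i, d i ∈ S) :
    MatIn S (Matrix.diagonal d) := fun i j => by
  rw [Matrix.diagonal_apply]
  split_ifs
  exacts [hd i, S.zero_mem]

theorem const (hS : ∀ c : ℝ, RatFunc.C c ∈ S) (A : Matrix ι κ ℝ) : MatIn S (A.map RatFunc.C) :=
  fun i j => hS (A i j)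

theorem mono {S' : Subring (RatFunc ℝ)} (h : S ≤ S') {F : Matrix ι κ (RatFunc ℝ)}
    (hF : MatIn S F) : MatIn S' F := fun i j => h (hF i j)

theorem det [Fintype ι] [DecidableEq ι] {F : Matrix ι ι (RatFunc ℝ)} (hF : MatIn S F) :
    F.det ∈ S := by
  rw [Matrix.det_apply]
  refine S.sum_mem fun σ _ => ?_
  rw [Units.smul_def, zsmul_eq_mul]
  exact S.mul_mem (intCast_mem S _) (S.prod_mem fun i _ => hF _ _)

theorem adjugate [Fintype ι] [DecidableEq ι] {F : Matrix ι ι (RatFunc ℝ)} (hF : MatIn S F) :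
    MatIn S F.adjugate := fun i j => by
  rw [Matrix.adjugate_apply]
  refine det fun k l => ?_
  by_cases h : k = j
  · subst h
    rw [Matrix.updateRow_self, Pi.single_apply]
    split_ifs
    exacts [S.one_mem, S.zero_mem]
  · rw [Matrix.updateRow_ne h]
    exact hF k l

theorem inv [Fintype ι] [DecidableEq ι] {F : Matrix ι ι (RatFunc ℝ)} (hF : MatIn S F)
    (h : F.det⁻¹ ∈ S) : MatIn S F⁻¹ := by
  rw [Matrix.inv_def, Ring.inverse_eq_inv']
  exact smul h hF.adjugate

end MatIn

theorem rhSubring_le_proper : rhSubring ≤ properSubring := inf_le_left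

theorem rhSubring_le_stable : rhSubring ≤ stableSubring := inf_le_right

theorem stable_le_noPole {w : ℂ} (hw : 1 ≤ ‖w‖) : stableSubring ≤ noPoleSubring w :=
  fun _ hf => mem_stableSubring.1 hf w hw

theorem rhSubring_le_noPole {w : ℂ} (hw : 1 ≤ ‖w‖) : rhSubring ≤ noPoleSubring w :=
  rhSubring_le_stable.trans (stable_le_noPole hw)

theorem rhInfM_iff {m : ℕ} {F : TM m} : RHInfM F ↔ MatIn rhSubring F :=
  forall₂_congr fun _ _ => mem_rhSubring.symm

theorem matIn_stable_iff {ι κ : Type*} {F : Matrix ι κ (RatFunc ℝ)} :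
    MatIn stableSubring F ↔ ∀ w : ℂ, 1 ≤ ‖w‖ → MatIn (noPoleSubring w) F := by
  simp only [MatIn, mem_stableSubring, mem_noPoleSubring]
  exact ⟨fun h w hw i j => h i j w hw, fun h i j w hw => h w hw i j⟩

theorem matIn_rh_iff {ι κ : Type*} {F : Matrix ι κ (RatFunc ℝ)} :
    MatIn rhSubring F ↔ MatIn properSubring F ∧ ∀ w : ℂ, 1 ≤ ‖w‖ → MatIn (noPoleSubring w) F := by
  rw [← matIn_stable_iff]
  exact ⟨fun h => ⟨h.mono inf_le_left, h.mono inf_le_right⟩, fun h i j => ⟨h.1 i j, h.2 i j⟩⟩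

/-! ### Values at infinity -/

theorem impulse_zero_mul {f g : RatFunc ℝ} (hf : IsProper f) (hg : IsProper g) :
    impulse (f * g) 0 = impulse f 0 * impulse g 0 := by
  rw [impulse_mul hf hg]
  simp

/-- The value at `z = ∞` of a proper transfer matrix. -/
def atInf {ι κ : Type*} (F : Matrix ι κ (RatFunc ℝ)) : Matrix ι κ ℝ := F.map fun f => impulse f 0

theorem atInf_mul {ι κ τ : Type*} [Fintype κ] {F : Matrix ι κ (RatFunc ℝ)}
    {G : Matrix κ τ (RatFunc ℝ)} (hF : MatIn properSubring F) (hG : MatIn properSubring G) :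
    atInf (F * G) = atInf F * atInf G := by
  ext i j
  simp only [atInf, Matrix.map_apply, Matrix.mul_apply, impulse_sum]
  exact Finset.sum_congr rfl fun k _ => impulse_zero_mul (hF i k) (hG k j)

theorem atInf_add {ι κ : Type*} (F G : Matrix ι κ (RatFunc ℝ)) :
    atInf (F + G) = atInf F + atInf G := by
  ext i j
  simp [atInf, impulse_add]

theorem atInf_const {ι κ : Type*} (A : Matrix ι κ ℝ) : atInf (A.map RatFunc.C) = A := by
  ext i j
  simp [atInf, impulse_C]

theorem map_C_one {n : ℕ} : (1 : Matrix (Fin n) (Fin n) ℝ).map RatFunc.C = 1 :=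
  Matrix.map_one _ (map_zero _) (map_one _)

theorem atInf_one {n : ℕ} : atInf (1 : Matrix (Fin n) (Fin n) (RatFunc ℝ)) = 1 := by
  rw [← map_C_one, atInf_const]

theorem atInf_eq_zero {ι κ : Type*} {F : Matrix ι κ (RatFunc ℝ)}
    (h : MatIn properSubring ((RatFunc.X : RatFunc ℝ) • F)) : atInf F = 0 := by
  ext i j
  have h1 := impulse_X_inv_mul_zero (h i j)
  rw [Matrix.smul_apply, smul_eq_mul, inv_mul_cancel_left₀ RatFunc.X_ne_zero] at h1
  exact h1

theorem proper_of_X_smul {ι κ : Type*} {F : Matrix ι κ (RatFunc ℝ)}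
    (h : MatIn properSubring ((RatFunc.X : RatFunc ℝ) • F)) : MatIn properSubring F := by
  intro i j
  have h1 := isProper_X_inv.mul (h i j)
  rw [Matrix.smul_apply, smul_eq_mul, inv_mul_cancel_left₀ RatFunc.X_ne_zero] at h1
  exact h1

/-- A function with a nonzero value at infinity has a proper inverse. -/
theorem isProper_inv_of_impulse {f : RatFunc ℝ} (hf : IsProper f) (h : impulse f 0 ≠ 0) :
    IsProper f⁻¹ := by
  have hf0 : f ≠ 0 := by rintro rfl; exact h (impulse_zero 0)
  rw [isProper_iff_intDegree] at *
  rw [RatFunc.intDegree_inv]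
  by_contra hc
  apply h
  have h1 : IsProper (RatFunc.X * f) := by
    rw [isProper_iff_intDegree, RatFunc.intDegree_mul RatFunc.X_ne_zero hf0, RatFunc.intDegree_X]
    omega
  have h2 := impulse_X_inv_mul_zero h1
  rwa [inv_mul_cancel_left₀ RatFunc.X_ne_zero] at h2

theorem impulse_zero_det {n : ℕ} {F : Matrix (Fin n) (Fin n) (RatFunc ℝ)}
    (hF : MatIn properSubring F) : impulse F.det 0 = (atInf F).det := by
  let φ : properSubring →+* ℝ :=
    { toFun := fun f => impulse f.1 0
      map_one' := by
        have := impulse_C 1 0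
        simpa using this
      map_mul' := fun f g => impulse_zero_mul f.2 g.2
      map_zero' := impulse_zero 0
      map_add' := fun f g => impulse_add _ _ _ }
  let F' : Matrix (Fin n) (Fin n) properSubring := Matrix.of fun i j => ⟨F i j, hF i j⟩
  have h1 : F = properSubring.subtype.mapMatrix F' := by ext i j; rfl
  have h2 : atInf F = φ.mapMatrix F' := by ext i j; rfl
  rw [h2, ← RingHom.map_det]
  conv_lhs => rw [h1, ← RingHom.map_det]
  rfl

theorem inv_proper_of_atInf {n : ℕ} {F : Matrix (Fin n) (Fin n) (RatFunc ℝ)}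
    (hF : MatIn properSubring F) (h : (atInf F).det ≠ 0) :
    F.det ≠ 0 ∧ MatIn properSubring F⁻¹ := by
  rw [← impulse_zero_det hF] at h
  refine ⟨fun h0 => h (by rw [h0, impulse_zero]), hF.inv ?_⟩
  exact isProper_inv_of_impulse hF.det h

/-! ### Resolvents -/

/-- The resolvent `(zI - A)⁻¹`. -/
def res {n : ℕ} (A : Matrix (Fin n) (Fin n) ℝ) : Matrix (Fin n) (Fin n) (RatFunc ℝ) :=
  ((RatFunc.X : RatFunc ℝ) • (1 : Matrix (Fin n) (Fin n) (RatFunc ℝ)) - A.map RatFunc.C)⁻¹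

section Resolvent

variable {m n : ℕ} (A : Matrix (Fin n) (Fin n) ℝ)

theorem X_sub_eq_charmatrix :
    (RatFunc.X : RatFunc ℝ) • (1 : Matrix (Fin n) (Fin n) (RatFunc ℝ)) - A.map RatFunc.C =
      A.charmatrix.map (algebraMap ℝ[X] (RatFunc ℝ)) := by
  ext i j
  by_cases h : i = j
  · subst h; simp
  · simp [h, Matrix.charmatrix_apply_ne]

theorem det_X_sub :
    ((RatFunc.X : RatFunc ℝ) • (1 : Matrix (Fin n) (Fin n) (RatFunc ℝ)) - A.map RatFunc.C).det =
      algebraMap ℝ[X] (RatFunc ℝ) A.charpoly := by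
  rw [X_sub_eq_charmatrix, Matrix.charpoly, RingHom.map_det]
  rfl

theorem isUnit_det_X_sub : IsUnit ((RatFunc.X : RatFunc ℝ) •
    (1 : Matrix (Fin n) (Fin n) (RatFunc ℝ)) - A.map RatFunc.C).det := by
  rw [det_X_sub, isUnit_iff_ne_zero]
  exact RatFunc.algebraMap_ne_zero A.charpoly_monic.ne_zero

theorem mul_res : ((RatFunc.X : RatFunc ℝ) • (1 : Matrix (Fin n) (Fin n) (RatFunc ℝ)) -
    A.map RatFunc.C) * res A = 1 := Matrix.mul_nonsing_inv _ (isUnit_det_X_sub A)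

theorem res_mul : res A * ((RatFunc.X : RatFunc ℝ) • (1 : Matrix (Fin n) (Fin n) (RatFunc ℝ)) -
    A.map RatFunc.C) = 1 := Matrix.nonsing_inv_mul _ (isUnit_det_X_sub A)

theorem const_mul_res : A.map RatFunc.C * res A = (RatFunc.X : RatFunc ℝ) • res A - 1 := by
  have h := mul_res A
  rw [Matrix.sub_mul, Matrix.smul_mul, Matrix.one_mul] at h
  rw [← h]
  abel

theorem res_transpose : (res A)ᵀ = res Aᵀ := by
  rw [res, res, Matrix.transpose_nonsing_inv, Matrix.transpose_sub, Matrix.transpose_smul,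
    Matrix.transpose_one, Matrix.transpose_map]

theorem noPole_charmatrix (w : ℂ) : MatIn (noPoleSubring w) ((RatFunc.X : RatFunc ℝ) •
    (1 : Matrix (Fin n) (Fin n) (RatFunc ℝ)) - A.map RatFunc.C) := by
  rw [X_sub_eq_charmatrix]
  exact fun i j => noPole_algebraMap _ w

variable {A}

theorem noPole_res {w : ℂ} (h : aeval w A.charpoly ≠ 0) : MatIn (noPoleSubring w) (res A) := by
  refine (noPole_charmatrix A w).inv ?_
  rw [det_X_sub, ← one_div, ← map_one (algebraMap ℝ[X] (RatFunc ℝ))]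
  exact noPole_iff.2 ⟨_, _, h, rfl⟩

theorem charpoly_ne_zero_of_noPole_res {w : ℂ} (h : MatIn (noPoleSubring w) (res A)) :
    aeval w A.charpoly ≠ 0 := by
  have h1 := congrArg Matrix.det (res_mul A)
  rw [Matrix.det_mul, det_X_sub, Matrix.det_one] at h1
  have h2 := evalC_mul (w := w) h.det (noPole_algebraMap A.charpoly w)
  rw [h1, evalC_algebraMap] at h2
  intro h0
  rw [h0, mul_zero] at h2
  simp [evalC] at h2

variable (A) in
theorem proper_X_res : MatIn properSubring ((RatFunc.X : RatFunc ℝ) • res A) := by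
  have hF : MatIn properSubring ((1 : Matrix (Fin n) (Fin n) (RatFunc ℝ)) -
      (RatFunc.X⁻¹ : RatFunc ℝ) • A.map RatFunc.C) :=
    MatIn.one.sub (MatIn.smul isProper_X_inv (MatIn.const C_mem_proper A))
  have h1 : atInf ((1 : Matrix (Fin n) (Fin n) (RatFunc ℝ)) -
      (RatFunc.X⁻¹ : RatFunc ℝ) • A.map RatFunc.C) = 1 := by
    have h2 : atInf ((RatFunc.X⁻¹ : RatFunc ℝ) • (-A).map RatFunc.C) = 0 := by
      apply atInf_eq_zero
      rw [smul_smul, mul_inv_cancel₀ RatFunc.X_ne_zero, one_smul]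
      exact MatIn.const C_mem_proper _
    have h3 : (1 : Matrix (Fin n) (Fin n) (RatFunc ℝ)) - (RatFunc.X⁻¹ : RatFunc ℝ) • A.map RatFunc.C =
        1 + (RatFunc.X⁻¹ : RatFunc ℝ) • (-A).map RatFunc.C := by
      ext i j; simp [sub_eq_add_neg]
    rw [h3, atInf_add, h2, atInf_one, add_zero]
  have h2 := inv_proper_of_atInf hF (by rw [h1]; simp)
  have h3 : (RatFunc.X : RatFunc ℝ) • res A = ((1 : Matrix (Fin n) (Fin n) (RatFunc ℝ)) -
      (RatFunc.X⁻¹ : RatFunc ℝ) • A.map RatFunc.C)⁻¹ := by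
    symm
    apply Matrix.inv_eq_left_inv
    have : (RatFunc.X : RatFunc ℝ) • ((1 : Matrix (Fin n) (Fin n) (RatFunc ℝ)) -
        (RatFunc.X⁻¹ : RatFunc ℝ) • A.map RatFunc.C) =
        (RatFunc.X : RatFunc ℝ) • (1 : Matrix (Fin n) (Fin n) (RatFunc ℝ)) - A.map RatFunc.C := by
      rw [smul_sub, smul_smul, mul_inv_cancel₀ RatFunc.X_ne_zero, one_smul]
    rw [Matrix.smul_mul, ← Matrix.mul_smul, this, res_mul]
  rw [h3]
  exact h2.2

variable (A) in
theorem proper_res : MatIn properSubring (res A) := proper_of_X_smul (proper_X_res A)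

/-- `(zI - A)⁻¹ (p(z) - p(A))` is polynomial. -/
theorem noPole_res_mul_sub (p : ℝ[X]) (w : ℂ) : MatIn (noPoleSubring w)
    (res A * (algebraMap ℝ[X] (RatFunc ℝ) p • 1 - (aeval A p).map RatFunc.C)) := by
  induction p using Polynomial.induction_on' with
  | add p q hp hq =>
    have : algebraMap ℝ[X] (RatFunc ℝ) (p + q) • (1 : Matrix (Fin n) (Fin n) (RatFunc ℝ)) -
        (aeval A (p + q)).map RatFunc.C =
        (algebraMap ℝ[X] (RatFunc ℝ) p • 1 - (aeval A p).map RatFunc.C) +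
        (algebraMap ℝ[X] (RatFunc ℝ) q • 1 - (aeval A q).map RatFunc.C) := by
      rw [map_add, map_add, Matrix.map_add _ (map_add _), add_smul]
      abel
    rw [this, Matrix.mul_add]
    exact hp.add hq
  | monomial k a =>
    have hpow : ∀ k : ℕ, MatIn (noPoleSubring w)
        (res A * ((RatFunc.X : RatFunc ℝ) ^ k • 1 - (A ^ k).map RatFunc.C)) := by
      intro k
      induction k with
      | zero =>
        rw [pow_zero, pow_zero, one_smul, map_C_one, sub_self, Matrix.mul_zero]
        exact fun i j => noPole_zero w
      | succ k ih =>
        have : res A * ((RatFunc.X : RatFunc ℝ) ^ (k + 1) • 1 - (A ^ (k + 1)).map RatFunc.C) =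
            (RatFunc.X : RatFunc ℝ) ^ k • 1 +
              res A * ((RatFunc.X : RatFunc ℝ) ^ k • 1 - (A ^ k).map RatFunc.C) *
                A.map RatFunc.C := by
          rw [pow_succ A, Matrix.map_mul]
          calc _ = (RatFunc.X : RatFunc ℝ) ^ k • (res A *
                ((RatFunc.X : RatFunc ℝ) • 1 - A.map RatFunc.C)) +
                  res A * ((RatFunc.X : RatFunc ℝ) ^ k • 1 - (A ^ k).map RatFunc.C) *
                    A.map RatFunc.C := by
                rw [Matrix.mul_assoc, Matrix.sub_mul, Matrix.smul_mul, Matrix.one_mul,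
                  ← Matrix.mul_smul, ← Matrix.mul_add, smul_sub, smul_smul, ← pow_succ]
                congr 1
                abel
            _ = _ := by rw [res_mul]
        rw [this]
        refine MatIn.add (MatIn.smul ?_ MatIn.one) (ih.mul (MatIn.const (C_mem_noPole w) A))
        exact (noPoleSubring w).pow_mem (noPole_X w) k
    have h1 : res A * (algebraMap ℝ[X] (RatFunc ℝ) (Polynomial.monomial k a) • 1 -
        (aeval A (Polynomial.monomial k a)).map RatFunc.C) =
        RatFunc.C a • (res A * ((RatFunc.X : RatFunc ℝ) ^ k • 1 - (A ^ k).map RatFunc.C)) := by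
      rw [← Matrix.mul_smul, smul_sub, smul_smul, RatFunc.algebraMap_monomial, aeval_monomial,
        Matrix.map_mul]
      congr 2
      ext i j
      simp [Matrix.algebraMap_eq_diagonal]
    rw [h1]
    exact MatIn.smul (noPole_C a w) (hpow k)

/-! ### Minimal realizations -/

theorem matIn_res_mul_of_observable {ι : Type*} {S : Subring (RatFunc ℝ)}
    (hX : RatFunc.X ∈ S) (hC : ∀ c : ℝ, RatFunc.C c ∈ S) {C : Matrix (Fin m) (Fin n) ℝ}
    (hobs : Observable A C) {f : Matrix (Fin n) ι (RatFunc ℝ)} (hf : MatIn S f)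
    (h : MatIn S (C.map RatFunc.C * res A * f)) : MatIn S (res A * f) := by
  have hk : ∀ k : ℕ, MatIn S ((C * A ^ k).map RatFunc.C * res A * f) := by
    intro k
    induction k with
    | zero => simpa using h
    | succ k ih =>
      have : (C * A ^ (k + 1)).map RatFunc.C * res A * f =
          (RatFunc.X : RatFunc ℝ) • ((C * A ^ k).map RatFunc.C * res A * f) -
            (C * A ^ k).map RatFunc.C * f := by
        rw [pow_succ, ← Matrix.mul_assoc, Matrix.map_mul, Matrix.mul_assoc _ (A.map RatFunc.C),
          const_mul_res, Matrix.mul_sub, Matrix.sub_mul, Matrix.mul_smul, Matrix.smul_mul,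
          Matrix.mul_one]
      rw [this]
      exact (MatIn.smul hX ih).sub ((MatIn.const hC _).mul hf)
  let V : Submodule ℝ (Fin n → ℝ) :=
    { carrier := {x | ∀ l, ∑ i, RatFunc.C (x i) * (res A * f) i l ∈ S}
      add_mem' := fun {x y} hx hy l => by
        have := S.add_mem (hx l) (hy l)
        rw [← Finset.sum_add_distrib] at this
        simpa [add_mul] using this
      zero_mem' := fun l => by simp [S.zero_mem]
      smul_mem' := fun c x hx l => by
        have := S.mul_mem (hC c) (hx l)
        rw [Finset.mul_sum] at this
        simpa [mul_assoc] using this }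
  have hrow : ∀ (k : ℕ) (i : Fin m), (fun j => (C * A ^ k) i j) ∈ V := by
    intro k i l
    have := hk k i l
    rw [Matrix.mul_assoc, Matrix.mul_apply] at this
    exact this
  have hV : V = ⊤ := by
    by_contra hne
    obtain ⟨φ, hφ0, hφ⟩ := Submodule.exists_le_ker_of_lt_top V (lt_top_iff_ne_top.2 hne)
    apply hφ0
    have hx : (fun i => φ (Pi.single i 1)) = 0 := by
      apply hobs
      intro k
      ext i
      have h1 := hφ (hrow k i)
      rw [LinearMap.mem_ker, LinearMap.pi_apply_eq_sum_univ] at h1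
      rw [Matrix.mulVec, dotProduct, Pi.zero_apply, ← h1]
      refine Finset.sum_congr rfl fun j _ => ?_
      rw [smul_eq_mul]
      congr 2
      ext t
      simp [Pi.single_apply, eq_comm]
    ext i
    exact congrFun hx i
  intro i l
  have h1 : (Pi.single i 1 : Fin n → ℝ) ∈ V := hV ▸ Submodule.mem_top
  have h2 := h1 l
  rw [Finset.sum_eq_single i] at h2
  · simpa using h2
  · intro b _ hb
    simp [hb]
  · simp

theorem observable_transpose {B : Matrix (Fin n) (Fin m) ℝ} (h : Controllable A B) :
    Observable Aᵀ Bᵀ := by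
  intro x hx
  refine h x fun k => ?_
  rw [← Matrix.mulVec_transpose, Matrix.transpose_mul, Matrix.transpose_pow]
  exact hx k

/-- The eigenvalues of a minimal realization are poles of the transfer matrix. -/
theorem charpoly_ne_zero_of_minimal {F : TM m} {B : Matrix (Fin n) (Fin m) ℝ}
    {C : Matrix (Fin m) (Fin n) ℝ} {D : Matrix (Fin m) (Fin m) ℝ} (hF : IsRealization F A B C D)
    (hc : Controllable A B) (ho : Observable A C) {w : ℂ} (hw : MatIn (noPoleSubring w) F) :
    aeval w A.charpoly ≠ 0 := by
  have h1 : MatIn (noPoleSubring w) (C.map RatFunc.C * res A * B.map RatFunc.C) := by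
    have h2 := hw.sub (MatIn.const (C_mem_noPole w) D)
    rw [IsRealization] at hF
    rw [hF, add_sub_cancel_right] at h2
    exact h2
  have h2 := matIn_res_mul_of_observable (noPole_X w) (C_mem_noPole w) ho
    (MatIn.const (C_mem_noPole w) B) h1
  have h3 : MatIn (noPoleSubring w) (Bᵀ.map RatFunc.C * res Aᵀ *
      (1 : Matrix (Fin n) (Fin n) (RatFunc ℝ))) := by
    have := h2.transpose
    rw [Matrix.transpose_mul, res_transpose, ← Matrix.transpose_map] at this
    rwa [Matrix.mul_one]
  have h4 := matIn_res_mul_of_observable (noPole_X w) (C_mem_noPole w) (observable_transpose hc)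
    MatIn.one h3
  rw [Matrix.mul_one] at h4
  rw [← Matrix.charpoly_transpose]
  exact charpoly_ne_zero_of_noPole_res h4

variable {B : Matrix (Fin n) (Fin m) ℝ} {C : Matrix (Fin m) (Fin n) ℝ}
  {D : Matrix (Fin m) (Fin m) ℝ}

theorem isRealization_inv {F : TM m} (hF : IsRealization F A B C D) (hD : IsUnit D) :
    F.det ≠ 0 ∧ IsRealization F⁻¹ (Ahat A B C D) (B * D⁻¹) (-(D⁻¹ * C)) D⁻¹ := by
  have hDd := (Matrix.isUnit_iff_isUnit_det D).1 hD
  set Ah := Ahat A B C D with hAh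
  have hF' : F = C.map RatFunc.C * res A * B.map RatFunc.C + D.map RatFunc.C := hF
  have hDD : D.map RatFunc.C * D⁻¹.map RatFunc.C = 1 := by
    rw [← Matrix.map_mul, Matrix.mul_nonsing_inv _ hDd, map_C_one]
  have hA : A.map RatFunc.C = Ah.map RatFunc.C +
      B.map RatFunc.C * D⁻¹.map RatFunc.C * C.map RatFunc.C := by
    rw [← Matrix.map_mul, ← Matrix.map_mul, ← Matrix.map_add _ (map_add _)]
    congr 1
    rw [hAh, Ahat]
    abel
  have hres : res A - res Ah -
      res A * (B.map RatFunc.C * D⁻¹.map RatFunc.C * C.map RatFunc.C) * res Ah = 0 := by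
    have h1 : B.map RatFunc.C * D⁻¹.map RatFunc.C * C.map RatFunc.C =
        ((RatFunc.X : RatFunc ℝ) • 1 - Ah.map RatFunc.C) -
          ((RatFunc.X : RatFunc ℝ) • 1 - A.map RatFunc.C) := by rw [hA]; abel
    rw [h1, Matrix.mul_sub, Matrix.sub_mul, res_mul, Matrix.mul_assoc, mul_res, Matrix.mul_one,
      Matrix.one_mul]
    abel
  have key : F * ((-(D⁻¹ * C)).map RatFunc.C * res Ah * (B * D⁻¹).map RatFunc.C +
      D⁻¹.map RatFunc.C) = 1 := by
    have hneg : (-(D⁻¹ * C)).map RatFunc.C = -(D⁻¹.map RatFunc.C * C.map RatFunc.C) := by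
      rw [← Matrix.map_mul]; ext i j; simp only [Matrix.map_apply, Matrix.neg_apply, map_neg]
    rw [hF', hneg, Matrix.map_mul]
    calc _ = C.map RatFunc.C * (res A -
          res A * (B.map RatFunc.C * D⁻¹.map RatFunc.C * C.map RatFunc.C) * res Ah) *
            (B.map RatFunc.C * D⁻¹.map RatFunc.C) -
          (D.map RatFunc.C * D⁻¹.map RatFunc.C) * C.map RatFunc.C * res Ah *
            (B.map RatFunc.C * D⁻¹.map RatFunc.C) + D.map RatFunc.C * D⁻¹.map RatFunc.C := by
          simp only [Matrix.mul_add, Matrix.add_mul, Matrix.mul_sub, Matrix.sub_mul,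
            Matrix.mul_neg, Matrix.neg_mul, Matrix.mul_assoc]
          abel
      _ = C.map RatFunc.C * (res A - res Ah -
          res A * (B.map RatFunc.C * D⁻¹.map RatFunc.C * C.map RatFunc.C) * res Ah) *
            (B.map RatFunc.C * D⁻¹.map RatFunc.C) + 1 := by
          rw [hDD, Matrix.one_mul]
          simp only [Matrix.mul_sub, Matrix.sub_mul, Matrix.mul_assoc]
          abel
      _ = 1 := by rw [hres, Matrix.mul_zero, Matrix.zero_mul, zero_add]
  constructor
  · intro h0
    have := congrArg Matrix.det key
    rw [Matrix.det_mul, h0, zero_mul, Matrix.det_one] at this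
    exact zero_ne_one this
  · exact Matrix.inv_eq_right_inv key

theorem controllable_Ahat (hD : IsUnit D) (h : Controllable A B) :
    Controllable (Ahat A B C D) (B * D⁻¹) := by
  have hDd := (Matrix.isUnit_iff_isUnit_det D).1 hD
  intro x hx
  apply h
  have h1 : ∀ k : ℕ, x ᵥ* A ^ k = x ᵥ* (Ahat A B C D) ^ k := by
    intro k
    induction k with
    | zero => simp
    | succ k ih =>
      rw [pow_succ, ← Matrix.vecMul_vecMul, ih, pow_succ, ← Matrix.vecMul_vecMul]
      have hA : A = Ahat A B C D + B * D⁻¹ * C := by rw [Ahat]; abel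
      conv_lhs => rw [hA]
      have h2 := hx k
      rw [Matrix.vecMul_add, ← Matrix.vecMul_vecMul _ (B * D⁻¹), Matrix.vecMul_vecMul _ _ (B * D⁻¹)]
      rw [← hA, h2, Matrix.zero_vecMul, add_zero]
  intro k
  have h2 := hx k
  rw [← Matrix.vecMul_vecMul, ← h1 k] at h2
  have h3 : B = B * D⁻¹ * D := by
    rw [Matrix.mul_assoc, Matrix.nonsing_inv_mul _ hDd, Matrix.mul_one]
  rw [← Matrix.vecMul_vecMul, h3, ← Matrix.vecMul_vecMul, h2, Matrix.zero_vecMul]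

theorem observable_Ahat (hD : IsUnit D) (h : Observable A C) :
    Observable (Ahat A B C D) (-(D⁻¹ * C)) := by
  have hDd := (Matrix.isUnit_iff_isUnit_det D).1 hD
  intro x hx
  have hx' : ∀ k, C *ᵥ ((Ahat A B C D) ^ k *ᵥ x) = 0 := by
    intro k
    have h1 := congrArg (fun v => -(D *ᵥ v)) (hx k)
    simp only [Matrix.neg_mul, Matrix.neg_mulVec, Matrix.mulVec_neg, neg_neg, Matrix.mulVec_zero,
      neg_zero, Matrix.mulVec_mulVec, ← Matrix.mul_assoc, Matrix.mul_nonsing_inv _ hDd,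
      Matrix.one_mul] at h1
    rwa [Matrix.mulVec_mulVec]
  apply h
  have h1 : ∀ k : ℕ, A ^ k *ᵥ x = (Ahat A B C D) ^ k *ᵥ x := by
    intro k
    induction k with
    | zero => simp
    | succ k ih =>
      rw [pow_succ', ← Matrix.mulVec_mulVec, ih, pow_succ', ← Matrix.mulVec_mulVec]
      have hA : A = Ahat A B C D + B * D⁻¹ * C := by rw [Ahat]; abel
      conv_lhs => rw [hA]
      rw [Matrix.add_mulVec, ← Matrix.mulVec_mulVec _ (B * D⁻¹), ← hA, hx' k, Matrix.mulVec_zero,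
        add_zero]
  intro k
  rw [← Matrix.mulVec_mulVec, h1, hx']

end Resolvent

/-! ### Inner functions -/

theorem circle_infinite : {w : ℂ | ‖w‖ = 1}.Infinite := by
  refine Set.infinite_of_injOn_mapsTo (f := fun θ : ℝ => Complex.exp ((θ : ℂ) * Complex.I))
    (s := Set.Ioc 0 1) ?_ (fun θ _ => norm_exp_mul_I θ) (Set.Ioc_infinite one_pos)
  have harg : ∀ θ ∈ Set.Ioc (0 : ℝ) 1, (Complex.exp ((θ : ℂ) * Complex.I)).arg = θ := by
    intro θ hθ
    rw [Complex.exp_mul_I]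
    exact Complex.arg_cos_add_sin_mul_I ⟨by linarith [hθ.1, Real.pi_pos],
      by linarith [hθ.2, Real.pi_gt_three]⟩
  intro x hx y hy hxy
  rw [← harg x hx, ← harg y hy]
  exact congrArg Complex.arg hxy

theorem inner_inv {m : ℕ} {F : TM m} (hF : IsInner F) :
    (F.map substInv)ᵀ * F = 1 := by
  have hRH := rhInfM_iff.1 hF.1
  have hs : ∀ w : ℂ, ‖w‖ = 1 → MatIn (noPoleSubring w) (F.map substInv)ᵀ := by
    intro w hw i j
    refine NoPole.substInv (hF.1 j i).1 fun hw0 => (hF.1 j i).2 _ ?_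
    rw [norm_inv, hw, inv_one]
  ext i j
  rw [← sub_eq_zero]
  refine eq_zero_of_evalC circle_infinite (fun w hw => ?_) fun w hw => ?_
  · exact (noPoleSubring w).sub_mem ((hs w hw).mul (hRH.mono (rhSubring_le_noPole (by
      rw [Set.mem_ofPred_eq] at hw; exact hw.ge))) i j) (MatIn.one i j)
  · have hw1 : ‖w‖ = 1 := hw
    have hw0 : w ≠ 0 := by rintro rfl; norm_num at hw1
    have h1 : ∀ i j, NoPole (F i j) w := fun i j => (hF.1 i j).2 w hw1.ge
    have h2 := congrFun (congrFun (hF.2 w hw1) i) j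
    have h3 : ∀ i j, evalC w (substInv (F i j)) = star (evalC w (F i j)) := by
      intro i j
      rw [evalC_substInv (hF.1 i j).1 hw0 ((hF.1 i j).2 _ (by rw [norm_inv, hw1, inv_one])),
        Complex.inv_eq_conj hw1, evalC_conj]
      rfl
    have hone : evalC w ((1 : TM m) i j) = (1 : Matrix (Fin m) (Fin m) ℂ) i j := by
      rw [Matrix.one_apply, Matrix.one_apply]
      split_ifs <;> simp [evalC]
    rw [sub_eq_add_neg, evalC_add ((hs w hw).mul (hRH.mono (rhSubring_le_noPole hw1.ge)) i j)
      (NoPole.neg (MatIn.one (S := noPoleSubring w) i j))]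
    have hneg : evalC w (-((1 : TM m) i j)) = -evalC w ((1 : TM m) i j) := by
      have := evalC_mul (noPole_C (-1) w) (MatIn.one (S := noPoleSubring w) (ι := Fin m) i j)
      rw [evalC_C] at this
      simpa using this
    rw [hneg, hone, ← h2, Matrix.mul_apply, Matrix.mul_apply, evalC_sum _ _ fun k _ =>
      (noPoleSubring w).mul_mem (hs w hw i k) (h1 k j), ← sub_eq_add_neg, sub_eq_zero]
    refine Finset.sum_congr rfl fun k _ => ?_
    rw [evalC_mul (hs w hw i k) (h1 k j), Matrix.conjTranspose_apply, Matrix.map_apply,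
      Matrix.map_apply, ← h3]
    rfl

end

section

/-! ### Minimum-phase polynomials in `z⁻¹` -/

theorem inZInv_mem_rh (q : ℝ[X]) : inZInv q ∈ rhSubring := by
  rw [inZInv, aeval_def, Polynomial.eval₂_eq_sum, Polynomial.sum_def]
  exact rhSubring.sum_mem fun k _ => rhSubring.mul_mem (C_mem_rh _) (rhSubring.pow_mem X_inv_mem_rh k)

theorem evalC_X_inv {w : ℂ} (hw : w ≠ 0) : evalC w (RatFunc.X⁻¹ : RatFunc ℝ) = w⁻¹ := by
  rw [evalC_inv (noPole_X w) (NoPole.inv (by rwa [evalC_X])), evalC_X]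

theorem evalC_pow {f : RatFunc ℝ} {w : ℂ} (hf : NoPole f w) (k : ℕ) :
    evalC w (f ^ k) = evalC w f ^ k := by
  induction k with
  | zero => simp [evalC]
  | succ k ih => rw [pow_succ, pow_succ, evalC_mul ((noPoleSubring w).pow_mem hf k) hf, ih]

theorem evalC_inZInv (q : ℝ[X]) {w : ℂ} (hw : w ≠ 0) : evalC w (inZInv q) = aeval w⁻¹ q := by
  have hX : NoPole (RatFunc.X⁻¹ : RatFunc ℝ) w := NoPole.inv (by rwa [evalC_X])
  rw [inZInv, aeval_def, Polynomial.eval₂_eq_sum, Polynomial.sum_def, aeval_def,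
    Polynomial.eval₂_eq_sum, Polynomial.sum_def]
  rw [evalC_sum]
  · refine Finset.sum_congr rfl fun k _ => ?_
    rw [RatFunc.algebraMap_eq_C, evalC_mul (noPole_C _ w) ((noPoleSubring w).pow_mem hX k), evalC_pow hX, evalC_X_inv hw]
    congr 1
    exact evalC_C _ w
  · exact fun k _ => (noPole_C _ w).mul ((noPoleSubring w).pow_mem hX k)

theorem impulse_inZInv (q : ℝ[X]) (k : ℕ) : impulse (inZInv q) k = q.coeff k := by
  rw [impulse, substInv_inZInv, ← RatFunc.coePolynomial_eq_algebraMap, ← RatFunc.coe_coe,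
    LaurentSeries.coeff_coe_powerSeries, Polynomial.coeff_coe]

theorem inZInv_ne_zero {q : ℝ[X]} (hq : q ≠ 0) : inZInv q ≠ 0 := by
  intro h
  apply hq
  ext k
  rw [← impulse_inZInv, h, impulse_zero, coeff_zero]

theorem MinPhasePoly.ne_zero {q : ℝ[X]} (hq : MinPhasePoly q) : q ≠ 0 := by
  rintro rfl
  exact hq 0 (by simp) (by simp)

theorem MinPhasePoly.inv_mem_rh {q : ℝ[X]} (hq : MinPhasePoly q) : (inZInv q)⁻¹ ∈ rhSubring := by
  refine ⟨isProper_inv_of_impulse (inZInv_mem_rh q).1 ?_, mem_stableSubring.2 fun w hw => ?_⟩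
  · rw [impulse_inZInv]
    have := hq 0 (by simp)
    rw [aeval_def, eval₂_at_zero] at this
    intro h
    rw [h] at this
    simp at this
  · have hw0 : w ≠ 0 := by rintro rfl; norm_num at hw
    refine NoPole.inv ?_
    rw [evalC_inZInv q hw0]
    exact hq _ (by rw [norm_inv]; exact inv_le_one_of_one_le₀ hw)

/-! ### Consequences of the standing hypotheses -/

/-- The standing hypotheses on the plant, the channel and the factorizations. -/
structure Setup {m n : ℕ} (P P0 : TM m) (s : Fin m → ℝ) (ch : Channel m) (Φ : Fin m → ℝ[X])
    (N M Nt Mt U V Ut Vt Min Mout : TM m) (A : Matrix (Fin n) (Fin n) ℝ)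
    (B : Matrix (Fin n) (Fin m) ℝ) (C : Matrix (Fin m) (Fin n) ℝ)
    (D : Matrix (Fin m) (Fin m) ℝ) : Prop where
  plant : P = P0 * zeroFactor s
  minPhase : MinPhasePlant P0
  relDeg : RelDegOne P0
  one_lt : ∀ i, 1 < |s i|
  noPole_zero : ∀ i j l, NoPole (P0 j l) (s i : ℂ)
  mean : ∀ i, MinPhasePoly (ch.meanPoly i)
  spec : ch.IsSpectralFactor Φ
  cop : DoublyCoprime (P * ch.H) N M Nt Mt U V Ut Vt
  inner : IsInner Min
  outer : IsOuter Mout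
  fact : M = Min * Mout
  real : IsRealization Min A B C D
  ctr : Controllable A B
  obs : Observable A C

theorem fromBlocks_bezout {m : ℕ} {N M Nt Mt U V Ut Vt : TM m}
    (h : Matrix.fromBlocks Vt Ut (-Nt) Mt * Matrix.fromBlocks M (-U) N V = 1) :
    Vt * M + Ut * N = 1 ∧ Ut * V = Vt * U ∧ Mt * N = Nt * M ∧ Nt * U + Mt * V = 1 := by
  rw [Matrix.fromBlocks_multiply, ← Matrix.fromBlocks_one, Matrix.fromBlocks_inj] at h
  obtain ⟨h1, h2, h3, h4⟩ := h
  refine ⟨h1, ?_, ?_, ?_⟩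
  · rw [Matrix.mul_neg, neg_add_eq_zero] at h2
    exact h2.symm
  · rw [Matrix.neg_mul, neg_add_eq_zero] at h3
    exact h3.symm
  · rwa [Matrix.neg_mul, Matrix.mul_neg, neg_neg] at h4

theorem fromBlocks_bezout' {m : ℕ} {N M Nt Mt U V Ut Vt : TM m}
    (h : Matrix.fromBlocks M (-U) N V * Matrix.fromBlocks Vt Ut (-Nt) Mt = 1) :
    M * Vt + U * Nt = 1 ∧ M * Ut = U * Mt ∧ N * Vt = V * Nt ∧ N * Ut + V * Mt = 1 := by
  rw [Matrix.fromBlocks_multiply, ← Matrix.fromBlocks_one, Matrix.fromBlocks_inj] at h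
  obtain ⟨h1, h2, h3, h4⟩ := h
  refine ⟨?_, ?_, ?_, h4⟩
  · rwa [Matrix.neg_mul, Matrix.mul_neg, neg_neg] at h1
  · rw [Matrix.neg_mul, ← sub_eq_add_neg, sub_eq_zero] at h2
    exact h2
  · rw [Matrix.mul_neg, ← sub_eq_add_neg, sub_eq_zero] at h3
    exact h3

namespace DoublyCoprime

variable {m : ℕ} {G N M Nt Mt U V Ut Vt : TM m}

theorem mul_M (h : DoublyCoprime G N M Nt Mt U V Ut Vt) : G * M = N := by
  rw [h.right, Matrix.mul_assoc, Matrix.nonsing_inv_mul _ (isUnit_iff_ne_zero.2 h.det_M),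
    Matrix.mul_one]

theorem Mt_mul (h : DoublyCoprime G N M Nt Mt U V Ut Vt) : Mt * G = Nt := by
  rw [h.left, ← Matrix.mul_assoc, Matrix.mul_nonsing_inv _ (isUnit_iff_ne_zero.2 h.det_Mt),
    Matrix.one_mul]

theorem M_inv (h : DoublyCoprime G N M Nt Mt U V Ut Vt) : M⁻¹ = Vt + Ut * G := by
  apply Matrix.inv_eq_left_inv
  rw [Matrix.add_mul, Matrix.mul_assoc, h.mul_M, (fromBlocks_bezout h.bezout).1]

theorem Mt_inv (h : DoublyCoprime G N M Nt Mt U V Ut Vt) : Mt⁻¹ = V + G * U := by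
  apply Matrix.inv_eq_right_inv
  rw [Matrix.mul_add, ← Matrix.mul_assoc, h.Mt_mul, add_comm, (fromBlocks_bezout h.bezout).2.2.2]

end DoublyCoprime

theorem zeroFactor_noPole {m : ℕ} (s : Fin m → ℝ) {w : ℂ} (hw : w ≠ 0) :
    MatIn (noPoleSubring w) (zeroFactor s) := by
  refine MatIn.diagonal fun i => ?_
  rw [div_eq_mul_inv]
  refine (noPoleSubring w).mul_mem ((noPoleSubring w).sub_mem (noPole_X w) (noPole_C _ w)) ?_
  exact NoPole.inv (by rwa [evalC_X])

theorem zeroFactor_eq (c : ℝ) : (RatFunc.X - RatFunc.C c) / RatFunc.X =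
    (1 : RatFunc ℝ) - RatFunc.C c * RatFunc.X⁻¹ := by
  rw [sub_div, div_self RatFunc.X_ne_zero, div_eq_mul_inv]

theorem zeroFactor_rh {m : ℕ} (s : Fin m → ℝ) : MatIn rhSubring (zeroFactor s) := by
  refine MatIn.diagonal fun i => ?_
  rw [zeroFactor_eq]
  exact rhSubring.sub_mem rhSubring.one_mem (rhSubring.mul_mem (C_mem_rh _) X_inv_mem_rh)

theorem X_sub_C_ne_zero (c : ℝ) : (RatFunc.X - RatFunc.C c : RatFunc ℝ) ≠ 0 := by
  have := RatFunc.algebraMap_ne_zero (Polynomial.X_sub_C_ne_zero c)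
  simpa using this

theorem H_rh {m : ℕ} (ch : Channel m) : MatIn rhSubring ch.H :=
  MatIn.diagonal fun _ => inZInv_mem_rh _

namespace Setup

variable {m n : ℕ} {P P0 : TM m} {s : Fin m → ℝ} {ch : Channel m} {Φ : Fin m → ℝ[X]}
  {N M Nt Mt U V Ut Vt Min Mout : TM m} {A : Matrix (Fin n) (Fin n) ℝ}
  {B : Matrix (Fin n) (Fin m) ℝ} {C : Matrix (Fin m) (Fin n) ℝ} {D : Matrix (Fin m) (Fin m) ℝ}

theorem X_G_proper (h : Setup P P0 s ch Φ N M Nt Mt U V Ut Vt Min Mout A B C D) :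
    MatIn properSubring ((RatFunc.X : RatFunc ℝ) • (P * ch.H)) := by
  rw [h.plant, ← Matrix.smul_mul, ← Matrix.smul_mul]
  exact (MatIn.mul (S := properSubring) h.relDeg.2.1 ((zeroFactor_rh s).mono rhSubring_le_proper)).mul
    ((H_rh ch).mono rhSubring_le_proper)

theorem G_proper (h : Setup P P0 s ch Φ N M Nt Mt U V Ut Vt Min Mout A B C D) :
    MatIn properSubring (P * ch.H) := proper_of_X_smul h.X_G_proper

theorem stable_all (h : Setup P P0 s ch Φ N M Nt Mt U V Ut Vt Min Mout A B C D) :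
    MatIn rhSubring N ∧ MatIn rhSubring M ∧ MatIn rhSubring Nt ∧ MatIn rhSubring Mt ∧
    MatIn rhSubring U ∧ MatIn rhSubring V ∧ MatIn rhSubring Ut ∧ MatIn rhSubring Vt := by
  simpa only [rhInfM_iff] using h.cop.stable

theorem X_Nt_proper (h : Setup P P0 s ch Φ N M Nt Mt U V Ut Vt Min Mout A B C D) :
    MatIn properSubring ((RatFunc.X : RatFunc ℝ) • Nt) := by
  rw [← h.cop.Mt_mul, ← Matrix.mul_smul]
  exact (h.stable_all.2.2.2.1.mono rhSubring_le_proper).mul h.X_G_proper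

theorem M_inv_proper (h : Setup P P0 s ch Φ N M Nt Mt U V Ut Vt Min Mout A B C D) :
    MatIn properSubring M⁻¹ := by
  obtain ⟨-, -, -, -, -, -, hUt, hVt⟩ := h.stable_all
  rw [h.cop.M_inv]
  exact (hVt.mono rhSubring_le_proper).add ((hUt.mono rhSubring_le_proper).mul h.G_proper)

theorem atInf_real {F : TM m} (hF : IsRealization F A B C D) : atInf F = D := by
  have hF' : F = C.map RatFunc.C * res A * B.map RatFunc.C + D.map RatFunc.C := hF
  rw [hF', atInf_add, atInf_const, atInf_eq_zero, zero_add]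
  rw [← Matrix.smul_mul, ← Matrix.mul_smul]
  exact ((MatIn.const C_mem_proper C).mul (proper_X_res A)).mul (MatIn.const C_mem_proper B)

theorem isUnit_D (h : Setup P P0 s ch Φ N M Nt Mt U V Ut Vt Min Mout A B C D) : IsUnit D := by
  obtain ⟨hN, hM, hNt, hMt, hU, hV, hUt, hVt⟩ := h.stable_all
  have hMin := (rhInfM_iff.1 h.inner.1).mono rhSubring_le_proper
  have hMout := (rhInfM_iff.1 h.outer.1).mono rhSubring_le_proper
  have hVt' := hVt.mono rhSubring_le_proper
  have h1 := congrArg atInf (fromBlocks_bezout' h.cop.bezout').1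
  rw [atInf_add, atInf_mul (hU.mono rhSubring_le_proper) (hNt.mono rhSubring_le_proper),
    atInf_eq_zero h.X_Nt_proper, Matrix.mul_zero, add_zero, atInf_one, h.fact, Matrix.mul_assoc,
    atInf_mul hMin (hMout.mul hVt'), atInf_real h.real] at h1
  exact (isUnit_iff_exists_inv).2 ⟨_, h1⟩

theorem charpoly_Ahat (h : Setup P P0 s ch Φ N M Nt Mt U V Ut Vt Min Mout A B C D) {w : ℂ}
    (hw : MatIn (noPoleSubring w) Min⁻¹) : aeval w (Ahat A B C D).charpoly ≠ 0 :=
  charpoly_ne_zero_of_minimal (isRealization_inv h.real h.isUnit_D).2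
    (controllable_Ahat h.isUnit_D h.ctr) (observable_Ahat h.isUnit_D h.obs) hw

theorem antistable (h : Setup P P0 s ch Φ N M Nt Mt U V Ut Vt Min Mout A B C D) (w : ℂ)
    (hw : ‖w‖ ≤ 1) : aeval w (Ahat A B C D).charpoly ≠ 0 := by
  refine h.charpoly_Ahat ?_
  rw [Matrix.inv_eq_left_inv (inner_inv h.inner)]
  intro i j
  refine NoPole.substInv (h.inner.1 j i).1 fun hw0 => (h.inner.1 j i).2 _ ?_
  rw [norm_inv]
  exact (one_le_inv₀ (norm_pos_iff.2 hw0)).2 hw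

theorem s_ne_zero (h : Setup P P0 s ch Φ N M Nt Mt U V Ut Vt Min Mout A B C D) (i : Fin m) :
    (s i : ℂ) ≠ 0 := by
  have := h.one_lt i
  intro h0
  rw [Complex.ofReal_eq_zero] at h0
  rw [h0] at this
  norm_num at this

theorem one_le_norm_s (h : Setup P P0 s ch Φ N M Nt Mt U V Ut Vt Min Mout A B C D) (i : Fin m) :
    1 < ‖(s i : ℂ)‖ := by
  simpa using h.one_lt i

theorem P0_noPole_s (h : Setup P P0 s ch Φ N M Nt Mt U V Ut Vt Min Mout A B C D) (i : Fin m) :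
    MatIn (noPoleSubring (s i : ℂ)) P0 := fun j l => h.noPole_zero i j l

theorem M_inv_noPole_s (h : Setup P P0 s ch Φ N M Nt Mt U V Ut Vt Min Mout A B C D) (i : Fin m) :
    MatIn (noPoleSubring (s i : ℂ)) M⁻¹ := by
  have hs := rhSubring_le_noPole (h.one_le_norm_s i).le
  rw [h.cop.M_inv, h.plant]
  exact (h.stable_all.2.2.2.2.2.2.2.mono hs).add ((h.stable_all.2.2.2.2.2.2.1.mono hs).mul
    (((h.P0_noPole_s i).mul (zeroFactor_noPole s (h.s_ne_zero i))).mul ((H_rh ch).mono hs)))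

theorem Min_det (h : Setup P P0 s ch Φ N M Nt Mt U V Ut Vt Min Mout A B C D) : Min.det ≠ 0 :=
  (isRealization_inv h.real h.isUnit_D).1

theorem Min_inv_eq (h : Setup P P0 s ch Φ N M Nt Mt U V Ut Vt Min Mout A B C D) :
    Min⁻¹ = Mout * M⁻¹ := by
  rw [h.fact, Matrix.mul_inv_rev, ← Matrix.mul_assoc,
    Matrix.mul_nonsing_inv _ (isUnit_iff_ne_zero.2 h.outer.2.1), Matrix.one_mul]

theorem M_inv_eq (h : Setup P P0 s ch Φ N M Nt Mt U V Ut Vt Min Mout A B C D) :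
    M⁻¹ = Mout⁻¹ * Min⁻¹ := by
  rw [h.fact, Matrix.mul_inv_rev]

theorem charpoly_s (h : Setup P P0 s ch Φ N M Nt Mt U V Ut Vt Min Mout A B C D) (i : Fin m) :
    aeval (s i : ℂ) (Ahat A B C D).charpoly ≠ 0 := by
  refine h.charpoly_Ahat ?_
  rw [h.Min_inv_eq]
  exact ((rhInfM_iff.1 h.outer.1).mono (rhSubring_le_noPole (h.one_le_norm_s i).le)).mul
    (h.M_inv_noPole_s i)

theorem isUnit_aeval_X_sub (h : Setup P P0 s ch Φ N M Nt Mt U V Ut Vt Min Mout A B C D)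
    (i : Fin m) : IsUnit (aeval (Ahat A B C D) (Polynomial.X - Polynomial.C (s i))) := by
  refine isUnit_aeval_of_coprime fun w hw h0 => ?_
  rw [map_sub, aeval_X, aeval_C, sub_eq_zero] at h0
  subst h0
  exact h.charpoly_s i hw

theorem W_mem (h : Setup P P0 s ch Φ N M Nt Mt U V Ut Vt Min Mout A B C D) (i : Fin m) :
    ch.W Φ i ∈ rhSubring :=
  rhSubring.mul_mem (h.mean i).inv_mem_rh (inZInv_mem_rh _)

theorem W_inv_mem (h : Setup P P0 s ch Φ N M Nt Mt U V Ut Vt Min Mout A B C D) (i : Fin m) :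
    (ch.W Φ i)⁻¹ ∈ rhSubring := by
  rw [Channel.W, mul_inv, inv_inv]
  exact rhSubring.mul_mem (inZInv_mem_rh _) (h.spec i).1.inv_mem_rh

theorem H_ne_zero (h : Setup P P0 s ch Φ N M Nt Mt U V Ut Vt Min Mout A B C D) (i : Fin m) :
    inZInv (ch.meanPoly i) ≠ 0 := inZInv_ne_zero (h.mean i).ne_zero

theorem W_ne_zero (h : Setup P P0 s ch Φ N M Nt Mt U V Ut Vt Min Mout A B C D) (i : Fin m) :
    ch.W Φ i ≠ 0 :=
  mul_ne_zero (inv_ne_zero (h.H_ne_zero i)) (inZInv_ne_zero (h.spec i).1.ne_zero)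

theorem isUnit_denom_W (h : Setup P P0 s ch Φ N M Nt Mt U V Ut Vt Min Mout A B C D) (i : Fin m) :
    IsUnit (aeval (Ahat A B C D) (ch.W Φ i).denom) := by
  refine isUnit_aeval_of_coprime fun w hw => ?_
  refine (mem_rhSubring.1 (h.W_mem i)).2 w ?_
  by_contra hlt
  exact h.antistable w (not_le.1 hlt).le hw

/-- `η_j = z⁻¹ ((z - s_j)/z) H_j`. -/
def eta (s : Fin m → ℝ) (ch : Channel m) (j : Fin m) : RatFunc ℝ :=
  RatFunc.X⁻¹ * ((RatFunc.X - RatFunc.C (s j)) / RatFunc.X * inZInv (ch.meanPoly j))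

/-- The outer part `z M̃ P₀` of `Ñ`. -/
def ntOut (Mt P0 : TM m) : TM m := Mt * ((RatFunc.X : RatFunc ℝ) • P0)

theorem Nt_eq (h : Setup P P0 s ch Φ N M Nt Mt U V Ut Vt Min Mout A B C D) :
    Nt = ntOut Mt P0 * Matrix.diagonal (eta s ch) := by
  have h1 : Matrix.diagonal (eta s ch) = (RatFunc.X⁻¹ : RatFunc ℝ) • (zeroFactor s * ch.H) := by
    rw [zeroFactor, Channel.H, Matrix.diagonal_mul_diagonal, ← Matrix.diagonal_smul]
    rfl
  rw [← h.cop.Mt_mul, ntOut, h1, h.plant, Matrix.mul_smul, Matrix.mul_smul, Matrix.smul_mul,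
    smul_smul, inv_mul_cancel₀ RatFunc.X_ne_zero, one_smul]
  simp only [Matrix.mul_assoc]

theorem eta_ne_zero (h : Setup P P0 s ch Φ N M Nt Mt U V Ut Vt Min Mout A B C D) (j : Fin m) :
    eta s ch j ≠ 0 :=
  mul_ne_zero (inv_ne_zero RatFunc.X_ne_zero)
    (mul_ne_zero (div_ne_zero (X_sub_C_ne_zero _) RatFunc.X_ne_zero) (h.H_ne_zero j))

theorem eta_inv_noPole (h : Setup P P0 s ch Φ N M Nt Mt U V Ut Vt Min Mout A B C D) (j : Fin m)
    {w : ℂ} (hw : 1 ≤ ‖w‖) (hwj : w ≠ s j) : NoPole (eta s ch j)⁻¹ w := by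
  rw [eta, mul_inv, mul_inv, inv_inv, inv_div, div_eq_mul_inv]
  exact (noPole_X w).mul (((noPole_X w).mul (noPole_inv_X_sub_C hwj)).mul
    (rhSubring_le_noPole hw (h.mean j).inv_mem_rh))

theorem ntOut_rh (h : Setup P P0 s ch Φ N M Nt Mt U V Ut Vt Min Mout A B C D) :
    MatIn rhSubring (ntOut Mt P0) := by
  obtain ⟨hN, hM, hNt, hMt, hU, hV, hUt, hVt⟩ := h.stable_all
  refine matIn_rh_iff.2 ⟨(hMt.mono rhSubring_le_proper).mul h.relDeg.2.1, fun w hw => ?_⟩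
  by_cases hws : ∃ i, w = s i
  · obtain ⟨i, rfl⟩ := hws
    exact (hMt.mono (rhSubring_le_noPole hw)).mul (MatIn.smul (noPole_X _) (h.P0_noPole_s i))
  · push Not at hws
    have h1 : ntOut Mt P0 = Nt * Matrix.diagonal fun j => (eta s ch j)⁻¹ := by
      rw [h.Nt_eq, Matrix.mul_assoc, Matrix.diagonal_mul_diagonal]
      simp [fun j => mul_inv_cancel₀ (h.eta_ne_zero j)]
    rw [h1]
    exact (hNt.mono (rhSubring_le_noPole hw)).mul
      (MatIn.diagonal fun j => h.eta_inv_noPole j hw (hws j))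

theorem ntOut_inv (h : Setup P P0 s ch Φ N M Nt Mt U V Ut Vt Min Mout A B C D) :
    ntOut Mt P0 * (ntOut Mt P0)⁻¹ = 1 ∧ MatIn rhSubring (ntOut Mt P0)⁻¹ := by
  obtain ⟨hN, hM, hNt, hMt, hU, hV, hUt, hVt⟩ := h.stable_all
  have hXP0 : ((RatFunc.X : RatFunc ℝ) • P0).det ≠ 0 := by
    rw [Matrix.det_smul]
    exact mul_ne_zero (pow_ne_zero _ RatFunc.X_ne_zero) h.relDeg.1
  have hXinv : ((RatFunc.X : RatFunc ℝ) • P0)⁻¹ = (RatFunc.X⁻¹ : RatFunc ℝ) • P0⁻¹ := by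
    apply Matrix.inv_eq_left_inv
    rw [Matrix.smul_mul, Matrix.mul_smul, smul_smul, inv_mul_cancel₀ RatFunc.X_ne_zero, one_smul,
      Matrix.nonsing_inv_mul _ (isUnit_iff_ne_zero.2 h.relDeg.1)]
  refine ⟨Matrix.mul_nonsing_inv _ ?_, ?_⟩
  · rw [ntOut, Matrix.det_mul, isUnit_iff_ne_zero]
    exact mul_ne_zero h.cop.det_Mt hXP0
  · have h1 : (ntOut Mt P0)⁻¹ = ((RatFunc.X : RatFunc ℝ) • P0)⁻¹ * (V + P * ch.H * U) := by
      rw [ntOut, Matrix.mul_inv_rev, h.cop.Mt_inv]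
    refine matIn_rh_iff.2 ⟨?_, fun w hw => ?_⟩
    · rw [h1]
      exact MatIn.mul h.relDeg.2.2 ((hV.mono rhSubring_le_proper).add
        (h.G_proper.mul (hU.mono rhSubring_le_proper)))
    · have h2 : (ntOut Mt P0)⁻¹ = (RatFunc.X⁻¹ : RatFunc ℝ) •
          (P0⁻¹ * V + zeroFactor s * ch.H * U) := by
        rw [h1, hXinv, Matrix.smul_mul, Matrix.mul_add, h.plant]
        congr 2
        calc _ = P0⁻¹ * P0 * (zeroFactor s * ch.H * U) := by simp only [Matrix.mul_assoc]
          _ = _ := by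
            rw [Matrix.nonsing_inv_mul _ (isUnit_iff_ne_zero.2 h.relDeg.1), Matrix.one_mul]
      have hle := rhSubring_le_noPole hw
      have hP0 : MatIn (noPoleSubring w) P0⁻¹ := fun i j => h.minPhase.2 i j w hw
      rw [h2]
      exact MatIn.smul (hle X_inv_mem_rh) ((hP0.mul (hV.mono hle)).add
        ((((zeroFactor_rh s).mono hle).mul ((H_rh ch).mono hle)).mul (hU.mono hle)))

end Setup

end

section

/-! ### Energy of state-space trajectories -/

section Energy

variable {m n : ℕ} {Ah : Matrix (Fin n) (Fin n) ℝ} {Bh : Matrix (Fin n) (Fin m) ℝ}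
  {bm : Matrix (Fin n) (Fin m) ℝ} {Gm : Matrix (Fin m) (Fin m) (RatFunc ℝ)}
  {ξ : Matrix (Fin n) (Fin m) (RatFunc ℝ)}

/-- The `k`-th coefficient of column `j`. -/
def colImpulse {ι : Type*} (F : Matrix ι (Fin m) (RatFunc ℝ)) (j : Fin m) (k : ℕ) : ι → ℝ :=
  fun i => impulse (F i j) k

theorem state_eq (h : ((RatFunc.X : RatFunc ℝ) • 1 - Ah.map RatFunc.C) * ξ =
    (RatFunc.X : RatFunc ℝ) • bm.map RatFunc.C - Bh.map RatFunc.C * Gm) :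
    ξ = bm.map RatFunc.C + (RatFunc.X⁻¹ : RatFunc ℝ) •
      (Ah.map RatFunc.C * ξ - Bh.map RatFunc.C * Gm) := by
  rw [Matrix.sub_mul, Matrix.smul_mul, Matrix.one_mul] at h
  have h1 : (RatFunc.X : RatFunc ℝ) • ξ = (RatFunc.X : RatFunc ℝ) • bm.map RatFunc.C +
      (Ah.map RatFunc.C * ξ - Bh.map RatFunc.C * Gm) := by
    rw [sub_eq_iff_eq_add] at h
    rw [h]; abel
  have h2 := congrArg (fun F => (RatFunc.X⁻¹ : RatFunc ℝ) • F) h1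
  simp only [smul_add, smul_smul, inv_mul_cancel₀ (RatFunc.X_ne_zero (K := ℝ)), one_smul] at h2
  exact h2

theorem colImpulse_const_mul {ι κ : Type*} [Fintype κ] (L : Matrix ι κ ℝ)
    (F : Matrix κ (Fin m) (RatFunc ℝ)) (j : Fin m) (k : ℕ) :
    colImpulse (L.map RatFunc.C * F) j k = L *ᵥ colImpulse F j k := by
  ext i
  simp only [colImpulse, Matrix.mul_apply, Matrix.map_apply, impulse_sum, impulse_C_mul,
    Matrix.mulVec, dotProduct]

theorem colImpulse_sub {ι : Type*} (F G : Matrix ι (Fin m) (RatFunc ℝ)) (j : Fin m) (k : ℕ) :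
    colImpulse (F - G) j k = colImpulse F j k - colImpulse G j k := by
  ext i
  have h := impulse_add ((F - G) i j) (G i j) k
  rw [Matrix.sub_apply, sub_add_cancel] at h
  simp only [colImpulse, Pi.sub_apply, Matrix.sub_apply, h]
  ring

theorem colImpulse_zero (hξ : MatIn properSubring ξ) (hG : MatIn properSubring Gm)
    (h : ξ = bm.map RatFunc.C + (RatFunc.X⁻¹ : RatFunc ℝ) •
      (Ah.map RatFunc.C * ξ - Bh.map RatFunc.C * Gm)) (j : Fin m) :
    colImpulse ξ j 0 = fun i => bm i j := by
  have hp : MatIn properSubring (Ah.map RatFunc.C * ξ - Bh.map RatFunc.C * Gm) :=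
    ((MatIn.const C_mem_proper _).mul hξ).sub ((MatIn.const C_mem_proper _).mul hG)
  ext i
  conv_lhs => rw [h]
  rw [colImpulse, Matrix.add_apply, impulse_add, Matrix.smul_apply, smul_eq_mul,
    impulse_X_inv_mul_zero (hp i j), Matrix.map_apply, impulse_C]
  simp

theorem colImpulse_succ (hξ : MatIn properSubring ξ) (hG : MatIn properSubring Gm)
    (h : ξ = bm.map RatFunc.C + (RatFunc.X⁻¹ : RatFunc ℝ) •
      (Ah.map RatFunc.C * ξ - Bh.map RatFunc.C * Gm)) (j : Fin m) (k : ℕ) :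
    colImpulse ξ j (k + 1) = Ah *ᵥ colImpulse ξ j k - Bh *ᵥ colImpulse Gm j k := by
  have hp : MatIn properSubring (Ah.map RatFunc.C * ξ - Bh.map RatFunc.C * Gm) :=
    ((MatIn.const C_mem_proper _).mul hξ).sub ((MatIn.const C_mem_proper _).mul hG)
  rw [← colImpulse_const_mul, ← colImpulse_const_mul, ← colImpulse_sub]
  ext i
  conv_lhs => rw [h]
  rw [colImpulse, Matrix.add_apply, impulse_add, Matrix.smul_apply, smul_eq_mul,
    impulse_X_inv_mul_succ (hp i j), Matrix.map_apply, impulse_C]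
  simp [colImpulse]

theorem tendsto_colImpulse (hξ : MatIn rhSubring ξ) (j : Fin m) :
    Filter.Tendsto (colImpulse ξ j) Filter.atTop (nhds 0) :=
  tendsto_pi_nhds.2 fun i =>
    (summable_abs_impulse (mem_rhSubring.1 (hξ i j))).of_abs.tendsto_atTop_zero

theorem hasSum_energy (hG : MatIn rhSubring Gm) (γ : Fin m → ℝ) (j : Fin m) :
    HasSum (fun k => ∑ i, γ i * colImpulse Gm j k i ^ 2) (∑ i, γ i * h2sq (Gm i j)) :=
  hasSum_sum fun i _ => (hasSum_sq_impulse (mem_rhSubring.1 (hG i j))).mul_left (γ i)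

variable {γ : Fin m → ℝ} {X : Matrix (Fin n) (Fin n) ℝ}

theorem tendsto_energy (hG : MatIn rhSubring Gm) (hξ : MatIn rhSubring ξ) (j : Fin m) :
    Filter.Tendsto (fun K => (∑ k ∈ Finset.range K, ∑ i, γ i * colImpulse Gm j k i ^ 2) +
      colImpulse ξ j K ⬝ᵥ (X *ᵥ colImpulse ξ j K)) Filter.atTop
      (nhds (∑ i, γ i * h2sq (Gm i j))) := by
  have h1 := (hasSum_energy hG γ j).tendsto_sum_nat
  have hc : Continuous fun x : Fin n → ℝ => x ⬝ᵥ (X *ᵥ x) := by fun_prop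
  have h2 := (hc.tendsto 0).comp (tendsto_colImpulse hξ j)
  rw [zero_dotProduct] at h2
  simpa using h1.add h2

/-- The Riccati solution bounds the energy needed to steer the state to the origin. -/
theorem le_energy (hγ : ∀ i, 0 < γ i) (hX : X.PosDef)
    (hric : X = Ahᵀ * (X - X * Bh * (ricR Bh γ X)⁻¹ * Bhᵀ * X) * Ah)
    (hG : MatIn rhSubring Gm) (hξ : MatIn rhSubring ξ)
    (h : ((RatFunc.X : RatFunc ℝ) • 1 - Ah.map RatFunc.C) * ξ =
      (RatFunc.X : RatFunc ℝ) • bm.map RatFunc.C - Bh.map RatFunc.C * Gm) (j : Fin m) :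
    (fun i => bm i j) ⬝ᵥ (X *ᵥ fun i => bm i j) ≤ ∑ i, γ i * h2sq (Gm i j) := by
  have hξp := hξ.mono rhSubring_le_proper
  have hGp := hG.mono rhSubring_le_proper
  refine ge_of_tendsto' (tendsto_energy (γ := γ) (X := X) hG hξ j) fun K => ?_
  induction K with
  | zero => rw [colImpulse_zero hξp hGp (state_eq h)]; simp
  | succ K ih =>
    refine ih.trans ?_
    rw [Finset.sum_range_succ, colImpulse_succ hξp hGp (state_eq h), add_assoc,
      complete_square hγ hX hric]
    have := quad_nonneg (ricR_posDef (Bh := Bh) hγ hX).posSemidef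
      (colImpulse Gm j K - ricGain Ah Bh γ X *ᵥ colImpulse ξ j K)
    linarith

/-- The optimal feedback attains the bound. -/
theorem eq_energy (hγ : ∀ i, 0 < γ i) (hX : X.PosDef)
    (hric : X = Ahᵀ * (X - X * Bh * (ricR Bh γ X)⁻¹ * Bhᵀ * X) * Ah)
    (hG : MatIn rhSubring Gm) (hξ : MatIn rhSubring ξ)
    (h : ((RatFunc.X : RatFunc ℝ) • 1 - Ah.map RatFunc.C) * ξ =
      (RatFunc.X : RatFunc ℝ) • bm.map RatFunc.C - Bh.map RatFunc.C * Gm)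
    (hfb : Gm = (ricGain Ah Bh γ X).map RatFunc.C * ξ) (j : Fin m) :
    ∑ i, γ i * h2sq (Gm i j) = (fun i => bm i j) ⬝ᵥ (X *ᵥ fun i => bm i j) := by
  have hξp := hξ.mono rhSubring_le_proper
  have hGp := hG.mono rhSubring_le_proper
  refine tendsto_nhds_unique (tendsto_energy (γ := γ) (X := X) hG hξ j) ?_
  refine tendsto_const_nhds.congr fun K => ?_
  induction K with
  | zero => rw [colImpulse_zero hξp hGp (state_eq h)]; simp
  | succ K ih =>
    rw [ih, Finset.sum_range_succ, colImpulse_succ hξp hGp (state_eq h), add_assoc,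
      complete_square hγ hX hric]
    have : colImpulse Gm j K = ricGain Ah Bh γ X *ᵥ colImpulse ξ j K := by
      conv_lhs => rw [hfb]
      rw [colImpulse_const_mul]
    rw [← this, sub_self, zero_dotProduct, add_zero]

end Energy

/-! ### Rational functions of a matrix -/

theorem noPole_res_mul_frac {n : ℕ} {A : Matrix (Fin n) (Fin n) ℝ} {p q : ℝ[X]}
    (hq : IsUnit (aeval A q)) {w : ℂ} (hw : aeval w q ≠ 0) : MatIn (noPoleSubring w)
    (res A * ((algebraMap ℝ[X] (RatFunc ℝ) p / algebraMap ℝ[X] (RatFunc ℝ) q) • 1 -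
      (aeval A p * (aeval A q)⁻¹).map RatFunc.C)) := by
  have hq0 : algebraMap ℝ[X] (RatFunc ℝ) q ≠ 0 := by
    apply RatFunc.algebraMap_ne_zero
    rintro rfl
    simp at hw
  have hcomm : aeval A q * (aeval A p * (aeval A q)⁻¹) = aeval A p := by
    rw [← Matrix.mul_assoc, ← map_mul, mul_comm q, map_mul, Matrix.mul_assoc,
      Matrix.mul_nonsing_inv _ ((Matrix.isUnit_iff_isUnit_det _).1 hq), Matrix.mul_one]
  have h1 : res A * ((algebraMap ℝ[X] (RatFunc ℝ) p / algebraMap ℝ[X] (RatFunc ℝ) q) • 1 -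
      (aeval A p * (aeval A q)⁻¹).map RatFunc.C) = (algebraMap ℝ[X] (RatFunc ℝ) q)⁻¹ •
      (res A * (algebraMap ℝ[X] (RatFunc ℝ) p • 1 - (aeval A p).map RatFunc.C) -
        res A * (algebraMap ℝ[X] (RatFunc ℝ) q • 1 - (aeval A q).map RatFunc.C) *
          (aeval A p * (aeval A q)⁻¹).map RatFunc.C) := by
    rw [Matrix.mul_assoc, ← Matrix.mul_sub, Matrix.sub_mul, ← Matrix.map_mul, hcomm,
      Matrix.smul_mul, Matrix.one_mul, ← Matrix.mul_smul]
    congr 1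
    rw [sub_sub_sub_cancel_right, smul_sub, smul_smul, smul_smul, inv_mul_cancel₀ hq0, one_smul,
      div_eq_inv_mul]
  rw [h1]
  refine MatIn.smul ?_ ((noPole_res_mul_sub p w).sub
    ((noPole_res_mul_sub q w).mul (MatIn.const (C_mem_noPole w) _)))
  rw [← one_div, ← map_one (algebraMap ℝ[X] (RatFunc ℝ))]
  exact noPole_iff.2 ⟨_, _, hw, rfl⟩

theorem mul_nonsing_inv_mul_comm {n : ℕ} {R S T E : Matrix (Fin n) (Fin n) ℝ} (hS : IsUnit S)
    (hE : IsUnit E) (hST : S * T = T * S) (hSE : S * E = E * S) :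
    R * S⁻¹ * (T * E⁻¹) = R * T * (S * E)⁻¹ := by
  have hSd := (Matrix.isUnit_iff_isUnit_det _).1 hS
  have hEd := (Matrix.isUnit_iff_isUnit_det _).1 hE
  have h1 : S⁻¹ * T = T * S⁻¹ := by
    calc S⁻¹ * T = S⁻¹ * (T * S) * S⁻¹ := by
          rw [Matrix.mul_assoc, Matrix.mul_assoc, Matrix.mul_nonsing_inv _ hSd, Matrix.mul_one]
      _ = T * S⁻¹ := by
          rw [← hST, ← Matrix.mul_assoc, Matrix.nonsing_inv_mul _ hSd, Matrix.one_mul]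
  rw [hSE, Matrix.mul_inv_rev, Matrix.mul_assoc, ← Matrix.mul_assoc S⁻¹, h1]
  simp only [Matrix.mul_assoc]

/-- `β = ((1 - s z)/(z - s)) W`. -/
def beta {m : ℕ} (s : Fin m → ℝ) (W : Fin m → RatFunc ℝ) (j : Fin m) : RatFunc ℝ :=
  (1 - RatFunc.C (s j) * RatFunc.X) / (RatFunc.X - RatFunc.C (s j)) * W j

/-- `φ = z β`. -/
def phi {m : ℕ} (s : Fin m → ℝ) (W : Fin m → RatFunc ℝ) (j : Fin m) : RatFunc ℝ :=
  RatFunc.X * beta s W j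

/-- The matrix with columns `b_j`. -/
def bMat {m n : ℕ} (A : Matrix (Fin n) (Fin n) ℝ) (B : Matrix (Fin n) (Fin m) ℝ)
    (C : Matrix (Fin m) (Fin n) ℝ) (D : Matrix (Fin m) (Fin m) ℝ) (s : Fin m → ℝ)
    (W : Fin m → RatFunc ℝ) : Matrix (Fin n) (Fin m) ℝ :=
  Matrix.of fun i j => bvec A B C D s W j i

theorem one_sub_C_mul_X_ne_zero (c : ℝ) : (1 - RatFunc.C c * RatFunc.X : RatFunc ℝ) ≠ 0 := by
  have h : (1 - RatFunc.C c * RatFunc.X : RatFunc ℝ) =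
      algebraMap ℝ[X] (RatFunc ℝ) (1 - Polynomial.C c * Polynomial.X) := by simp
  rw [h]
  apply RatFunc.algebraMap_ne_zero
  intro h0
  have := congrArg (Polynomial.eval 0) h0
  simp at this

namespace Setup

variable {m n : ℕ} {P P0 : TM m} {s : Fin m → ℝ} {ch : Channel m} {Φ : Fin m → ℝ[X]}
  {N M Nt Mt U V Ut Vt Min Mout : TM m} {A : Matrix (Fin n) (Fin n) ℝ}
  {B : Matrix (Fin n) (Fin m) ℝ} {C : Matrix (Fin m) (Fin n) ℝ} {D : Matrix (Fin m) (Fin m) ℝ}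

theorem isUnit_sub (h : Setup P P0 s ch Φ N M Nt Mt U V Ut Vt Min Mout A B C D) (i : Fin m) :
    IsUnit (Ahat A B C D - s i • (1 : Matrix (Fin n) (Fin n) ℝ)) := by
  have := h.isUnit_aeval_X_sub i
  rwa [map_sub, aeval_X, aeval_C, Algebra.algebraMap_eq_smul_one] at this

/-- The difference `(zI - Â)⁻¹ (β_j(z) - β_j(Â)) B̂ e_j` inherits only the poles of `β_j`. -/
theorem noPole_theta (h : Setup P P0 s ch Φ N M Nt Mt U V Ut Vt Min Mout A B C D) (j : Fin m)
    {w : ℂ} (hw : 1 ≤ ‖w‖) (hwj : w ≠ s j) (i : Fin n) :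
    NoPole ((res (Ahat A B C D) * ((B * D⁻¹).map RatFunc.C * Matrix.diagonal (beta s (ch.W Φ)) -
      (bMat A B C D s (ch.W Φ)).map RatFunc.C)) i j) w := by
  set Ah := Ahat A B C D with hAh
  set W := ch.W Φ j with hW
  set p : ℝ[X] := (1 - Polynomial.C (s j) * Polynomial.X) * W.num with hp
  set q : ℝ[X] := (Polynomial.X - Polynomial.C (s j)) * W.denom with hq
  have hu1 := h.isUnit_aeval_X_sub j
  have hu2 := h.isUnit_denom_W j
  have hqu : IsUnit (aeval Ah q) := by rw [hq, map_mul]; exact hu1.mul hu2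
  have hqw : aeval w q ≠ 0 := by
    rw [hq, map_mul]
    refine mul_ne_zero ?_ ((mem_rhSubring.1 (h.W_mem j)).2 w hw)
    simpa [sub_eq_zero] using hwj
  have hbeta : beta s (ch.W Φ) j =
      algebraMap ℝ[X] (RatFunc ℝ) p / algebraMap ℝ[X] (RatFunc ℝ) q := by
    rw [beta, hp, hq, map_mul, map_mul, mul_div_mul_comm, RatFunc.num_div_denom]
    simp [hW]
  have hb : bvec A B C D s (ch.W Φ) j =
      (aeval Ah p * (aeval Ah q)⁻¹) *ᵥ inCol B D j := by
    rw [bvec, Nbar, matEval]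
    congr 1
    have e1 : (1 : Matrix (Fin n) (Fin n) ℝ) - s j • Ah =
        aeval Ah (1 - Polynomial.C (s j) * Polynomial.X) := by
      rw [map_sub, map_one, map_mul, aeval_C, aeval_X, Algebra.algebraMap_eq_smul_one,
        smul_mul_assoc, one_mul]
    have e2 : Ah - s j • (1 : Matrix (Fin n) (Fin n) ℝ) =
        aeval Ah (Polynomial.X - Polynomial.C (s j)) := by
      rw [map_sub, aeval_X, aeval_C, Algebra.algebraMap_eq_smul_one]
    rw [← hAh, e1, e2, hp, hq, map_mul, map_mul]
    refine mul_nonsing_inv_mul_comm hu1 hu2 ?_ ?_ <;>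
      rw [← map_mul, mul_comm, map_mul]
  have h1 := ((noPole_res_mul_frac (p := p) hqu hqw).mul
    (MatIn.const (C_mem_noPole w) (B * D⁻¹))) i j
  have h2 : (res Ah * ((B * D⁻¹).map RatFunc.C * Matrix.diagonal (beta s (ch.W Φ)) -
      (bMat A B C D s (ch.W Φ)).map RatFunc.C)) i j =
      (res Ah * ((algebraMap ℝ[X] (RatFunc ℝ) p / algebraMap ℝ[X] (RatFunc ℝ) q) •
      (1 : Matrix (Fin n) (Fin n) (RatFunc ℝ)) -
      (aeval Ah p * (aeval Ah q)⁻¹).map RatFunc.C) * (B * D⁻¹).map RatFunc.C) i j := by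
    rw [Matrix.mul_assoc, Matrix.mul_apply, Matrix.mul_apply]
    refine Finset.sum_congr rfl fun k _ => ?_
    congr 1
    rw [Matrix.sub_mul, Matrix.smul_mul, Matrix.one_mul, ← Matrix.map_mul, Matrix.sub_apply,
      Matrix.sub_apply, Matrix.mul_diagonal, Matrix.smul_apply, smul_eq_mul, ← hbeta,
      mul_comm (beta s (ch.W Φ) j)]
    congr 1
    rw [Matrix.map_apply, Matrix.map_apply, bMat, Matrix.of_apply, hb]
    rfl
  rw [h2]
  exact h1

theorem xi_identity (Ah : Matrix (Fin n) (Fin n) ℝ) (Bh bm : Matrix (Fin n) (Fin m) ℝ) (T : TM m)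
    (s : Fin m → ℝ) (W : Fin m → RatFunc ℝ) :
    res Ah * ((RatFunc.X : RatFunc ℝ) • bm.map RatFunc.C -
      Bh.map RatFunc.C * (T * Matrix.diagonal (phi s W))) =
    res Ah * (Bh.map RatFunc.C * (1 - T)) * Matrix.diagonal (phi s W) -
      (RatFunc.X : RatFunc ℝ) • (res Ah * (Bh.map RatFunc.C * Matrix.diagonal (beta s W) -
        bm.map RatFunc.C)) := by
  have h1 : Matrix.diagonal (phi s W) = (RatFunc.X : RatFunc ℝ) • Matrix.diagonal (beta s W) := by
    rw [← Matrix.diagonal_smul]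
    rfl
  rw [← Matrix.mul_smul, Matrix.mul_assoc, ← Matrix.mul_sub]
  congr 1
  rw [smul_sub, ← Matrix.mul_smul, ← h1, Matrix.mul_sub, Matrix.sub_mul, Matrix.mul_one]
  simp only [Matrix.mul_assoc]
  abel

theorem X_sub_mul_eq {Ah : Matrix (Fin n) (Fin n) ℝ} {F : Matrix (Fin n) (Fin m) (RatFunc ℝ)} :
    ((RatFunc.X : RatFunc ℝ) • 1 - Ah.map RatFunc.C) * (res Ah * F) = F := by
  rw [← Matrix.mul_assoc, mul_res, Matrix.one_mul]

theorem beta_noPole (h : Setup P P0 s ch Φ N M Nt Mt U V Ut Vt Min Mout A B C D) (j : Fin m)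
    {w : ℂ} (hw : 1 ≤ ‖w‖) (hwj : w ≠ s j) : NoPole (beta s (ch.W Φ) j) w := by
  rw [beta, div_eq_mul_inv]
  refine NoPole.mul (NoPole.mul ?_ (noPole_inv_X_sub_C hwj)) (rhSubring_le_noPole hw (h.W_mem j))
  exact (noPoleSubring w).sub_mem (noPole_one w) ((noPole_C _ w).mul (noPole_X w))

theorem beta_ne_zero (h : Setup P P0 s ch Φ N M Nt Mt U V Ut Vt Min Mout A B C D) (j : Fin m) :
    beta s (ch.W Φ) j ≠ 0 :=
  mul_ne_zero (div_ne_zero (one_sub_C_mul_X_ne_zero _) (X_sub_C_ne_zero _)) (h.W_ne_zero j)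

theorem phi_ne_zero (h : Setup P P0 s ch Φ N M Nt Mt U V Ut Vt Min Mout A B C D) (j : Fin m) :
    phi s (ch.W Φ) j ≠ 0 := mul_ne_zero RatFunc.X_ne_zero (h.beta_ne_zero j)

theorem eta_mul_phi (j : Fin m) : eta s ch j * phi s (ch.W Φ) j =
    (RatFunc.X⁻¹ - RatFunc.C (s j)) * (inZInv (ch.meanPoly j) * ch.W Φ j) := by
  have h1 : (RatFunc.X⁻¹ - RatFunc.C (s j) : RatFunc ℝ) =
      RatFunc.X⁻¹ * (1 - RatFunc.C (s j) * RatFunc.X) := by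
    rw [mul_sub, mul_one, mul_left_comm, inv_mul_cancel₀ RatFunc.X_ne_zero, mul_one]
  have hX := RatFunc.X_ne_zero (K := ℝ)
  have hs := X_sub_C_ne_zero (s j)
  rw [h1, eta, phi, beta]
  field_simp

theorem X_inv_sub_C_inv_rh {c : ℝ} (hc : 1 < |c|) :
    (RatFunc.X⁻¹ - RatFunc.C c : RatFunc ℝ)⁻¹ ∈ rhSubring := by
  have h1 : (RatFunc.X⁻¹ - RatFunc.C c : RatFunc ℝ) ∈ rhSubring :=
    rhSubring.sub_mem X_inv_mem_rh (C_mem_rh c)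
  refine ⟨isProper_inv_of_impulse h1.1 ?_, mem_stableSubring.2 fun w hw => NoPole.inv ?_⟩
  · have h2 := impulse_add (RatFunc.X⁻¹ * 1) (RatFunc.C (-c)) 0
    rw [impulse_X_inv_mul_zero properSubring.one_mem, impulse_C, map_neg, ← sub_eq_add_neg,
      mul_one] at h2
    rw [h2]
    intro h0
    simp at h0
    simp [h0] at hc
    linarith
  · have hw0 : w ≠ 0 := by rintro rfl; norm_num at hw
    have h2 := evalC_add (rhSubring_le_noPole hw X_inv_mem_rh) (noPole_C (-c) w)
    rw [map_neg, ← sub_eq_add_neg] at h2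
    rw [h2, evalC_X_inv hw0, ← map_neg, evalC_C]
    intro h0
    have h3 : w⁻¹ = c := by
      rw [Complex.ofReal_neg, ← sub_eq_add_neg, sub_eq_zero] at h0
      exact h0
    have h4 := congrArg norm h3
    rw [norm_inv, Complex.norm_real, Real.norm_eq_abs] at h4
    have := inv_le_one_of_one_le₀ hw
    linarith

theorem eta_mul_phi_rh (h : Setup P P0 s ch Φ N M Nt Mt U V Ut Vt Min Mout A B C D) (j : Fin m) :
    eta s ch j * phi s (ch.W Φ) j ∈ rhSubring ∧ (eta s ch j * phi s (ch.W Φ) j)⁻¹ ∈ rhSubring := by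
  rw [eta_mul_phi]
  constructor
  · exact rhSubring.mul_mem (rhSubring.sub_mem X_inv_mem_rh (C_mem_rh _))
      (rhSubring.mul_mem (inZInv_mem_rh _) (h.W_mem j))
  · rw [mul_inv, mul_inv]
    exact rhSubring.mul_mem (X_inv_sub_C_inv_rh (h.one_lt j))
      (rhSubring.mul_mem (h.mean j).inv_mem_rh (h.W_inv_mem j))

theorem norm_phi (h : Setup P P0 s ch Φ N M Nt Mt U V Ut Vt Min Mout A B C D) (j : Fin m)
    {w : ℂ} (hw : ‖w‖ = 1) : ‖evalC w (phi s (ch.W Φ) j)‖ = ‖evalC w (ch.W Φ j)‖ := by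
  have hwj : w ≠ s j := by
    rintro rfl
    exact (h.one_le_norm_s j).ne' hw
  have hle := rhSubring_le_noPole (w := w) hw.ge
  have hn1 : NoPole (1 - RatFunc.C (s j) * RatFunc.X) w :=
    (noPoleSubring w).sub_mem (noPole_one w) ((noPole_C _ w).mul (noPole_X w))
  have hn2 : NoPole (RatFunc.X - RatFunc.C (s j)) w :=
    (noPoleSubring w).sub_mem (noPole_X w) (noPole_C _ w)
  have hn3 := noPole_inv_X_sub_C hwj
  have e1 : evalC w (1 - RatFunc.C (s j) * RatFunc.X) = 1 - s j * w := by
    have : (1 - RatFunc.C (s j) * RatFunc.X : RatFunc ℝ) =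
      algebraMap ℝ[X] (RatFunc ℝ) (1 - Polynomial.C (s j) * Polynomial.X) := by simp
    rw [this, evalC_algebraMap]; simp
  have e2 : evalC w (RatFunc.X - RatFunc.C (s j)) = w - s j := by
    have : (RatFunc.X - RatFunc.C (s j) : RatFunc ℝ) =
      algebraMap ℝ[X] (RatFunc ℝ) (Polynomial.X - Polynomial.C (s j)) := by simp
    rw [this, evalC_algebraMap]; simp
  rw [phi, beta, div_eq_mul_inv, evalC_mul (noPole_X w) ((hn1.mul hn3).mul (hle (h.W_mem j))),
    evalC_mul (hn1.mul hn3) (hle (h.W_mem j)), evalC_mul hn1 hn3, evalC_inv hn2 hn3, evalC_X, e1,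
    e2, norm_mul, norm_mul, norm_mul, norm_inv, hw, one_mul]
  have e3 : ‖1 - s j * w‖ = ‖w - s j‖ := by
    have e4 : starRingEnd ℂ (w - s j) * w = 1 - s j * w := by
      rw [map_sub, Complex.conj_ofReal, sub_mul, mul_comm (starRingEnd ℂ w), Complex.mul_conj,
        Complex.normSq_eq_norm_sq, hw]
      simp
    rw [← e4, norm_mul, hw, mul_one, RCLike.norm_conj]
  rw [e3, mul_inv_cancel₀, one_mul]
  rw [norm_ne_zero_iff, sub_ne_zero]
  exact hwj

theorem h2sq_mul_phi (h : Setup P P0 s ch Φ N M Nt Mt U V Ut Vt Min Mout A B C D) (j : Fin m)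
    {f : RatFunc ℝ} (hf : f ∈ rhSubring) : h2sq (f * phi s (ch.W Φ) j) = h2sq (f * ch.W Φ j) := by
  refine h2sq_congr fun w hw => ?_
  have hwj : w ≠ s j := by
    rintro rfl
    exact (h.one_le_norm_s j).ne' hw
  have hle := rhSubring_le_noPole (w := w) hw.ge
  have hphi : NoPole (phi s (ch.W Φ) j) w := (noPole_X w).mul (h.beta_noPole j hw.ge hwj)
  rw [evalC_mul (hle hf) hphi, evalC_mul (hle hf) (hle (h.W_mem j)), norm_mul, norm_mul, h.norm_phi j hw]

/-- Lower bound for the weighted column norms of `J(Q)`. -/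
theorem le_weighted_col (h : Setup P P0 s ch Φ N M Nt Mt U V Ut Vt Min Mout A B C D)
    {γ : Fin m → ℝ} (hγ : ∀ i, 0 < γ i) {X : Matrix (Fin n) (Fin n) ℝ} (hX : X.PosDef)
    (hdare : IsDARE A B C D γ X) {Q : TM m} (hQ : RHInfM Q) (j : Fin m) :
    bvec A B C D s (ch.W Φ) j ⬝ᵥ (X *ᵥ bvec A B C D s (ch.W Φ) j) ≤
      ∑ i, γ i * Jmat U M Nt (ch.W Φ) Q i j := by
  obtain ⟨hN, hM, hNt, hMt, hU, hV, hUt, hVt⟩ := h.stable_all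
  rw [rhInfM_iff] at hQ
  rw [isDARE_iff_reduced h.isUnit_D hγ hX] at hdare
  set Ah := Ahat A B C D with hAh
  set T := (U + M * Q) * Nt with hT
  have hTrh : MatIn rhSubring T := (hU.add (hM.mul hQ)).mul hNt
  have hT1 : 1 - T = M * (Vt - Q * Nt) := by
    rw [hT, ← (fromBlocks_bezout' h.cop.bezout').1, Matrix.mul_sub, Matrix.add_mul,
      Matrix.mul_assoc]
    abel
  have hMinT : Min⁻¹ * (1 - T) = Mout * (Vt - Q * Nt) := by
    rw [hT1, h.fact, ← Matrix.mul_assoc, ← Matrix.mul_assoc,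
      Matrix.nonsing_inv_mul _ (isUnit_iff_ne_zero.2 h.Min_det), Matrix.one_mul]
  have hMout := rhInfM_iff.1 h.outer.1
  have hstab : ∀ w : ℂ, 1 ≤ ‖w‖ →
      MatIn (noPoleSubring w) (res Ah * ((B * D⁻¹).map RatFunc.C * (1 - T))) := by
    intro w hw
    have hle := rhSubring_le_noPole hw
    have h1T : MatIn (noPoleSubring w) (1 - T) := MatIn.one.sub (hTrh.mono hle)
    refine matIn_res_mul_of_observable (noPole_X w) (C_mem_noPole w)
      (observable_Ahat h.isUnit_D h.obs) ((MatIn.const (C_mem_noPole w) _).mul h1T) ?_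
    have hr : Min⁻¹ = (-(D⁻¹ * C)).map RatFunc.C * res Ah * (B * D⁻¹).map RatFunc.C +
      D⁻¹.map RatFunc.C := (isRealization_inv h.real h.isUnit_D).2
    have h2 : (-(D⁻¹ * C)).map RatFunc.C * res Ah * ((B * D⁻¹).map RatFunc.C * (1 - T)) =
        Mout * (Vt - Q * Nt) - D⁻¹.map RatFunc.C * (1 - T) := by
      rw [← hMinT, hr, Matrix.add_mul, add_sub_cancel_right]
      simp only [Matrix.mul_assoc]
    rw [h2]
    exact ((hMout.mul (hVt.sub (hQ.mul hNt))).mono hle).sub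
      ((MatIn.const (C_mem_noPole w) _).mul h1T)
  set Gm := T * Matrix.diagonal (phi s (ch.W Φ)) with hGm
  have hG : MatIn rhSubring Gm := by
    have : Gm = (U + M * Q) * ntOut Mt P0 *
        Matrix.diagonal fun j => eta s ch j * phi s (ch.W Φ) j := by
      rw [hGm, hT, ← Matrix.diagonal_mul_diagonal]
      conv_lhs => rw [h.Nt_eq]
      simp only [Matrix.mul_assoc]
    rw [this]
    exact ((hU.add (hM.mul hQ)).mul h.ntOut_rh).mul
      (MatIn.diagonal fun j => (h.eta_mul_phi_rh j).1)
  set bm := bMat A B C D s (ch.W Φ) with hbm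
  set ξ := res Ah * ((RatFunc.X : RatFunc ℝ) • bm.map RatFunc.C -
    (B * D⁻¹).map RatFunc.C * Gm) with hξ
  have hξrh : MatIn rhSubring ξ := by
    refine matIn_rh_iff.2 ⟨?_, fun w hw i k => ?_⟩
    · rw [hξ, Matrix.mul_sub, Matrix.mul_smul, ← Matrix.smul_mul]
      exact ((proper_X_res Ah).mul (MatIn.const C_mem_proper _)).sub ((proper_res Ah).mul
        ((MatIn.const C_mem_proper _).mul (hG.mono rhSubring_le_proper)))
    · by_cases hwk : w = s k
      · subst hwk
        refine (noPole_res (h.charpoly_s k)).mul (MatIn.sub (MatIn.smul (noPole_X _)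
          (MatIn.const (C_mem_noPole _) _)) ((MatIn.const (C_mem_noPole _) _).mul
            (hG.mono (rhSubring_le_noPole hw)))) i k
      · rw [hξ, hGm, xi_identity, Matrix.sub_apply, Matrix.mul_diagonal, Matrix.smul_apply,
          smul_eq_mul]
        exact (noPoleSubring w).sub_mem
          ((hstab w hw i k).mul ((noPole_X w).mul (h.beta_noPole k hw hwk)))
          ((noPole_X w).mul (h.noPole_theta k hw hwk i))
  have := le_energy hγ hX hdare hG hξrh X_sub_mul_eq j
  refine this.trans (le_of_eq (Finset.sum_congr rfl fun i _ => ?_))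
  rw [hGm, Matrix.mul_diagonal, h.h2sq_mul_phi j (hTrh i j)]
  rfl

end Setup

end

section

/-! ### Removing poles on the unit circle -/

section Shrink

/-- `q(z)` divided by the polynomial with the roots of `q` scaled by `r`. -/
def shrink (q : ℝ[X]) (r : ℝ) : RatFunc ℝ :=
  algebraMap ℝ[X] (RatFunc ℝ) q / algebraMap ℝ[X] (RatFunc ℝ) (q.scaleRoots r)

theorem aeval_scaleRoots (q : ℝ[X]) {r : ℝ} (hr : r ≠ 0) (w : ℂ) :
    aeval w (q.scaleRoots r) = (r : ℂ) ^ q.natDegree * aeval (w / r) q := by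
  have h := scaleRoots_eval₂_mul (p := q) (algebraMap ℝ ℂ) (w / r) r
  have h2 : (algebraMap ℝ ℂ) r * (w / r) = w := by
    simp only [Complex.coe_algebraMap]
    field_simp [Complex.ofReal_ne_zero.2 hr]
  rw [h2] at h
  exact h

variable {q : ℝ[X]}

theorem aeval_scaleRoots_ne_zero (hq : ∀ w : ℂ, 1 < ‖w‖ → aeval w q ≠ 0) {r : ℝ} (hr0 : 0 < r)
    (hr1 : r < 1) {w : ℂ} (hw : 1 ≤ ‖w‖) : aeval w (q.scaleRoots r) ≠ 0 := by
  rw [aeval_scaleRoots q hr0.ne']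
  refine mul_ne_zero (pow_ne_zero _ (Complex.ofReal_ne_zero.2 hr0.ne')) (hq _ ?_)
  rw [norm_div, Complex.norm_real, Real.norm_eq_abs, abs_of_pos hr0, lt_div_iff₀ hr0]
  linarith

theorem isProper_div {p q : ℝ[X]} (hq : q ≠ 0) (h : p.natDegree ≤ q.natDegree) :
    IsProper (algebraMap ℝ[X] (RatFunc ℝ) p / algebraMap ℝ[X] (RatFunc ℝ) q) := by
  by_cases hp : p = 0
  · simp [hp, IsProper]
  rw [isProper_iff_intDegree, div_eq_mul_inv, RatFunc.intDegree_mul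
    (RatFunc.algebraMap_ne_zero hp) (inv_ne_zero (RatFunc.algebraMap_ne_zero hq)),
    RatFunc.intDegree_inv, RatFunc.intDegree_polynomial, RatFunc.intDegree_polynomial]
  omega

theorem shrink_rh (hq0 : q ≠ 0) (hq : ∀ w : ℂ, 1 < ‖w‖ → aeval w q ≠ 0) {r : ℝ} (hr0 : 0 < r)
    (hr1 : r < 1) : shrink q r ∈ rhSubring := by
  refine mem_rhSubring.2 ⟨isProper_div ?_ (natDegree_scaleRoots q r).ge, fun w hw =>
    noPole_iff.2 ⟨_, _, aeval_scaleRoots_ne_zero hq hr0 hr1 hw, rfl⟩⟩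
  exact scaleRoots_ne_zero hq0 r

/-- Multiplication by `shrink q r` removes the poles cancelled by `q`. -/
theorem shrink_mul_rh (hq0 : q ≠ 0) (hq : ∀ w : ℂ, 1 < ‖w‖ → aeval w q ≠ 0) {r : ℝ} (hr0 : 0 < r)
    (hr1 : r < 1) {f : RatFunc ℝ} (hf : IsProper f) (hd : f.denom ∣ q) :
    shrink q r * f ∈ rhSubring := by
  refine mem_rhSubring.2 ⟨(mem_rhSubring.1 (shrink_rh hq0 hq hr0 hr1)).1.mul hf, fun w hw => ?_⟩
  obtain ⟨p, hp⟩ := hd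
  have h1 : shrink q r * f = algebraMap ℝ[X] (RatFunc ℝ) (p * f.num) /
      algebraMap ℝ[X] (RatFunc ℝ) (q.scaleRoots r) := by
    conv_lhs => rw [← RatFunc.num_div_denom f]
    have := RatFunc.algebraMap_ne_zero f.denom_ne_zero
    rw [shrink]
    nth_rewrite 1 [hp]
    rw [map_mul, map_mul]
    field_simp
  rw [h1]
  exact noPole_iff.2 ⟨_, _, aeval_scaleRoots_ne_zero hq hr0 hr1 hw, rfl⟩

theorem norm_sub_le_two_mul {w a : ℂ} (hw : ‖w‖ = 1) (ha : ‖a‖ ≤ 1) {r : ℝ} (hr0 : 0 < r)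
    (hr1 : r < 1) : ‖w - a‖ ≤ 2 * r * ‖w / r - a‖ := by
  have hr : (r : ℂ) ≠ 0 := Complex.ofReal_ne_zero.2 hr0.ne'
  have hrn : ‖(r : ℂ)‖ = r := by rw [Complex.norm_real, Real.norm_eq_abs, abs_of_pos hr0]
  have h1 : r * ‖w / r - a‖ = ‖w - r * a‖ := by
    have : w - r * a = r * (w / r - a) := by field_simp
    rw [this, norm_mul, hrn]
  have h2 : ‖w - a‖ ≤ ‖w - r * a‖ + (1 - r) * ‖a‖ := by
    have e : w - a = (w - r * a) - ((1 - r : ℝ) : ℂ) * a := by push_cast; ring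
    rw [e]
    refine (norm_sub_le _ _).trans ?_
    rw [norm_mul, Complex.norm_real, Real.norm_eq_abs, abs_of_pos (by linarith)]
  have h3 : 1 - r * ‖a‖ ≤ ‖w - r * a‖ := by
    have := norm_sub_norm_le w (r * a)
    rwa [norm_mul, hrn, hw] at this
  rw [mul_assoc, h1]
  nlinarith [norm_nonneg a]

theorem norm_shrink_le (hqm : q.Monic) (hq : ∀ w : ℂ, 1 < ‖w‖ → aeval w q ≠ 0) {r : ℝ}
    (hr0 : 0 < r) (hr1 : r < 1) {w : ℂ} (hw : ‖w‖ = 1) :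
    ‖evalC w (shrink q r)‖ ≤ 2 ^ q.natDegree := by
  have hne := aeval_scaleRoots_ne_zero hq hr0 hr1 hw.ge
  have hrn : ‖(r : ℂ)‖ = r := by rw [Complex.norm_real, Real.norm_eq_abs, abs_of_pos hr0]
  have hspl : (q.map (algebraMap ℝ ℂ)).Splits := IsAlgClosed.splits _
  have hcard : (q.aroots ℂ).card = q.natDegree := by
    rw [aroots_def, ← hspl.natDegree_eq_card_roots, natDegree_map]
  rw [shrink, evalC_div hne, norm_div, div_le_iff₀ (norm_pos_iff.2 hne), aeval_scaleRoots q hr0.ne',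
    hspl.aeval_eq_prod_aroots_of_monic hqm, hspl.aeval_eq_prod_aroots_of_monic hqm, norm_mul,
    norm_pow, hrn, ← mul_assoc, ← mul_pow, ← hcard]
  have hroot : ∀ a ∈ q.aroots ℂ, ‖a‖ ≤ 1 := by
    intro a ha
    by_contra hlt
    exact hq a (not_le.1 hlt) (mem_aroots'.1 ha).2
  clear hcard hne
  generalize q.aroots ℂ = R at hroot
  induction R using Multiset.induction_on with
  | empty => simp
  | cons a R ih =>
    have ih := ih fun b hb => hroot b (Multiset.mem_cons_of_mem hb)
    have ha := norm_sub_le_two_mul hw (hroot a (Multiset.mem_cons_self a R)) hr0 hr1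
    simp only [Multiset.map_cons, Multiset.prod_cons, Multiset.card_cons, norm_mul, pow_succ]
    calc _ ≤ (2 * r * ‖w / r - a‖) * _ := mul_le_mul ha ih (norm_nonneg _) (by positivity)
      _ = _ := by ring

theorem tendsto_shrink (hq : ∀ w : ℂ, 1 < ‖w‖ → aeval w q ≠ 0) {w : ℂ} (hw : ‖w‖ = 1)
    (hqw : aeval w q ≠ 0) :
    Filter.Tendsto (fun r : ℝ => evalC w (shrink q r)) (nhdsWithin 1 (Set.Ioo 0 1)) (nhds 1) := by
  have hc : ContinuousAt (fun r : ℝ => aeval w q / ((r : ℂ) ^ q.natDegree * aeval (w / r) q)) 1 := by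
    have h1 : ContinuousAt (fun r : ℝ => w / (r : ℂ)) 1 := by
      refine ContinuousAt.div continuousAt_const Complex.continuous_ofReal.continuousAt (by simp)
    have h2 : ContinuousAt (fun r : ℝ => aeval (w / (r : ℂ)) q) 1 :=
      ContinuousAt.comp (f := fun r : ℝ => w / (r : ℂ)) (g := fun x : ℂ => aeval x q)
        (Polynomial.continuous_aeval q).continuousAt h1
    refine ContinuousAt.div continuousAt_const (ContinuousAt.mul ?_ h2) (by simpa using hqw)
    exact (Complex.continuous_ofReal.pow _).continuousAt
  have ht := hc.tendsto.mono_left (nhdsWithin_le_nhds (s := Set.Ioo 0 1))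
  simp only [Complex.ofReal_one, one_pow, div_one, one_mul, div_self hqw] at ht
  refine ht.congr' ?_
  filter_upwards [self_mem_nhdsWithin] with r hr
  rw [shrink, evalC_div (aeval_scaleRoots_ne_zero hq hr.1 hr.2 hw.ge), aeval_scaleRoots q hr.1.ne']

theorem ae_aeval_exp_ne_zero (hq0 : q ≠ 0) : ∀ᵐ θ : ℝ, θ ∈ Set.uIoc (-Real.pi) Real.pi →
    aeval (Complex.exp ((θ : ℂ) * Complex.I)) q ≠ 0 := by
  have hfin : {θ : ℝ | θ ∈ Set.Ioc (-Real.pi) Real.pi ∧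
      aeval (Complex.exp ((θ : ℂ) * Complex.I)) q = 0}.Finite := by
    refine Set.Finite.of_injOn (f := fun θ : ℝ => Complex.exp ((θ : ℂ) * Complex.I))
      (t := q.rootSet ℂ) ?_ ?_ (q.rootSet_finite ℂ)
    · exact fun θ hθ => (mem_rootSet.2 ⟨hq0, hθ.2⟩)
    · intro a ha b hb hab
      have := Complex.exp_inj_of_neg_pi_lt_of_le_pi (x := (a : ℂ) * Complex.I)
        (y := (b : ℂ) * Complex.I) (by simpa using ha.1.1) (by simpa using ha.1.2)
        (by simpa using hb.1.1) (by simpa using hb.1.2) hab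
      simpa using this
  have h0 := hfin.measure_zero volume
  rw [← compl_mem_ae_iff] at h0
  filter_upwards [h0] with θ hθ hmem h1
  rw [Set.uIoc_of_le (by linarith [Real.pi_pos])] at hmem
  exact hθ ⟨hmem, h1⟩

/-- Shrinking the poles changes the `H₂` norm continuously. -/
theorem tendsto_h2sq_shrink (hqm : q.Monic) (hq : ∀ w : ℂ, 1 < ‖w‖ → aeval w q ≠ 0)
    {f g : RatFunc ℝ} (hf : f ∈ rhSubring) (hg : g ∈ rhSubring) :
    Filter.Tendsto (fun r : ℝ => h2sq (f + shrink q r * g)) (nhdsWithin 1 (Set.Ioo 0 1))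
      (nhds (h2sq (f + g))) := by
  unfold h2sq
  refine Filter.Tendsto.const_mul _ ?_
  have hf' : ∀ w : ℂ, ‖w‖ = 1 → NoPole f w := fun w hw => rhSubring_le_noPole hw.ge hf
  have hg' : ∀ w : ℂ, ‖w‖ = 1 → NoPole g w := fun w hw => rhSubring_le_noPole hw.ge hg
  have hψ : ∀ r ∈ Set.Ioo (0 : ℝ) 1, ∀ w : ℂ, ‖w‖ = 1 → NoPole (shrink q r) w := fun r hr w hw =>
    rhSubring_le_noPole hw.ge (shrink_rh hqm.ne_zero hq hr.1 hr.2)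
  have hcf := continuous_evalC_circle hf'
  have hcg := continuous_evalC_circle hg'
  refine intervalIntegral.tendsto_integral_filter_of_dominated_convergence
    (fun θ : ℝ => (‖evalC (Complex.exp ((θ : ℂ) * Complex.I)) f‖ + 2 ^ q.natDegree *
      ‖evalC (Complex.exp ((θ : ℂ) * Complex.I)) g‖) ^ 2) ?_ ?_ ?_ ?_
  · filter_upwards [self_mem_nhdsWithin] with r hr
    have := continuous_evalC_circle (f := f + shrink q r * g)
      fun w hw => (hf' w hw).add ((hψ r hr w hw).mul (hg' w hw))
    exact (this.norm.pow 2).aestronglyMeasurable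
  · filter_upwards [self_mem_nhdsWithin] with r hr
    refine Filter.Eventually.of_forall fun θ _ => ?_
    have hw := norm_exp_mul_I θ
    rw [evalC_add (hf' _ hw) ((hψ r hr _ hw).mul (hg' _ hw)), evalC_mul (hψ r hr _ hw) (hg' _ hw),
      Real.norm_eq_abs, abs_of_nonneg (by positivity)]
    gcongr
    refine (norm_add_le _ _).trans ?_
    rw [norm_mul]
    gcongr
    exact norm_shrink_le hqm hq hr.1 hr.2 hw
  · refine Continuous.intervalIntegrable ?_ _ _
    fun_prop
  · filter_upwards [ae_aeval_exp_ne_zero hqm.ne_zero] with θ hθ hmem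
    have hw := norm_exp_mul_I θ
    have h1 := tendsto_shrink hq hw (hθ hmem)
    have h2 := ((h1.mul_const (evalC (Complex.exp ((θ : ℂ) * Complex.I)) g)).const_add
      (evalC (Complex.exp ((θ : ℂ) * Complex.I)) f)).norm.pow 2
    rw [one_mul, ← evalC_add (hf' _ hw) (hg' _ hw)] at h2
    refine h2.congr' ?_
    filter_upwards [self_mem_nhdsWithin] with r hr
    rw [evalC_add (hf' _ hw) ((hψ r hr _ hw).mul (hg' _ hw)), evalC_mul (hψ r hr _ hw) (hg' _ hw)]

end Shrink

theorem noPole_mul_col {ι κ μ : Type*} [Fintype κ] {w : ℂ} {F : Matrix ι κ (RatFunc ℝ)}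
    {G : Matrix κ μ (RatFunc ℝ)} (hF : MatIn (noPoleSubring w) F) {k : μ}
    (hG : ∀ l, NoPole (G l k) w) (i : ι) : NoPole ((F * G) i k) w := by
  rw [Matrix.mul_apply]
  exact (noPoleSubring w).sum_mem fun l _ => (noPoleSubring w).mul_mem (hF i l) (hG l)

theorem exists_common_denom {ι κ : Type*} [Fintype ι] [Fintype κ] {y : Matrix ι κ (RatFunc ℝ)}
    (hy : ∀ w : ℂ, 1 < ‖w‖ → MatIn (noPoleSubring w) y) :
    ∃ q : ℝ[X], q.Monic ∧ (∀ w : ℂ, 1 < ‖w‖ → aeval w q ≠ 0) ∧ ∀ i j, (y i j).denom ∣ q := by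
  refine ⟨∏ i, ∏ j, (y i j).denom, monic_prod_of_monic _ _ fun i _ =>
    monic_prod_of_monic _ _ fun j _ => RatFunc.monic_denom _, fun w hw => ?_, fun i j => ?_⟩
  · rw [map_prod]
    refine Finset.prod_ne_zero_iff.2 fun i _ => ?_
    rw [map_prod]
    exact Finset.prod_ne_zero_iff.2 fun j _ => hy w hw i j
  · exact (Finset.dvd_prod_of_mem (fun j => (y i j).denom) (Finset.mem_univ j)).trans
      (Finset.dvd_prod_of_mem (fun i => ∏ j, (y i j).denom) (Finset.mem_univ i))

namespace Setup

variable {m n : ℕ} {P P0 : TM m} {s : Fin m → ℝ} {ch : Channel m} {Φ : Fin m → ℝ[X]}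
  {N M Nt Mt U V Ut Vt Min Mout : TM m} {A : Matrix (Fin n) (Fin n) ℝ}
  {B : Matrix (Fin n) (Fin m) ℝ} {C : Matrix (Fin m) (Fin n) ℝ} {D : Matrix (Fin m) (Fin m) ℝ}

theorem eta_rh (s : Fin m → ℝ) (ch : Channel m) (j : Fin m) : eta s ch j ∈ rhSubring := by
  rw [eta, zeroFactor_eq]
  exact rhSubring.mul_mem X_inv_mem_rh (rhSubring.mul_mem (rhSubring.sub_mem rhSubring.one_mem
    (rhSubring.mul_mem (C_mem_rh _) X_inv_mem_rh)) (inZInv_mem_rh _))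

theorem phi_inv_rh (h : Setup P P0 s ch Φ N M Nt Mt U V Ut Vt Min Mout A B C D) (j : Fin m) :
    (phi s (ch.W Φ) j)⁻¹ ∈ rhSubring := by
  have h1 : (phi s (ch.W Φ) j)⁻¹ = eta s ch j * (eta s ch j * phi s (ch.W Φ) j)⁻¹ := by
    rw [mul_inv, ← mul_assoc, mul_inv_cancel₀ (h.eta_ne_zero j), one_mul]
  rw [h1]
  exact rhSubring.mul_mem (eta_rh s ch j) (h.eta_mul_phi_rh j).2

/-- The optimal closed loop transfer function and its defining properties. -/
theorem exists_optimal (h : Setup P P0 s ch Φ N M Nt Mt U V Ut Vt Min Mout A B C D)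
    {γ : Fin m → ℝ} (hγ : ∀ i, 0 < γ i) {X : Matrix (Fin n) (Fin n) ℝ} (hX : X.PosDef)
    (hdare : IsDARE A B C D γ X) : ∃ Gm : TM m, MatIn rhSubring Gm ∧
      MatIn rhSubring (res (Ahat A B C D) * ((RatFunc.X : RatFunc ℝ) •
        (bMat A B C D s (ch.W Φ)).map RatFunc.C - (B * D⁻¹).map RatFunc.C * Gm)) ∧
      ∀ j, ∑ i, γ i * h2sq (Gm i j) =
        bvec A B C D s (ch.W Φ) j ⬝ᵥ (X *ᵥ bvec A B C D s (ch.W Φ) j) := by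
  rw [isDARE_iff_reduced h.isUnit_D hγ hX] at hdare
  set Ah := Ahat A B C D with hAh
  set Bh := B * D⁻¹ with hBh
  set bm := bMat A B C D s (ch.W Φ) with hbm
  set F := ricGain Ah Bh γ X with hF
  have hu := isUnit_and_inv_charpoly h.antistable
  have hAc : ∀ w : ℂ, 1 ≤ ‖w‖ → aeval w (Ah - Bh * F).charpoly ≠ 0 := by
    intro w hw
    rw [closedLoop_charpoly hu.1 hX hdare]
    exact hu.2 w hw
  set ξ := (RatFunc.X : RatFunc ℝ) • (res (Ah - Bh * F) * bm.map RatFunc.C) with hξ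
  have hξrh : MatIn rhSubring ξ := by
    refine matIn_rh_iff.2 ⟨?_, fun w hw => ?_⟩
    · rw [hξ, ← Matrix.smul_mul]
      exact (proper_X_res _).mul (MatIn.const C_mem_proper _)
    · exact MatIn.smul (noPole_X w) ((noPole_res (hAc w hw)).mul (MatIn.const (C_mem_noPole w) _))
  have hG : MatIn rhSubring (F.map RatFunc.C * ξ) := (MatIn.const C_mem_rh _).mul hξrh
  have hstate : ((RatFunc.X : RatFunc ℝ) • 1 - Ah.map RatFunc.C) * ξ =
      (RatFunc.X : RatFunc ℝ) • bm.map RatFunc.C - Bh.map RatFunc.C * (F.map RatFunc.C * ξ) := by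
    have h1 : ((RatFunc.X : RatFunc ℝ) • 1 - (Ah - Bh * F).map RatFunc.C) * ξ =
        (RatFunc.X : RatFunc ℝ) • bm.map RatFunc.C := by
      rw [hξ, Matrix.mul_smul, X_sub_mul_eq]
    rw [← h1, ← Matrix.mul_assoc, ← Matrix.sub_mul, ← Matrix.map_mul, sub_sub,
      ← Matrix.map_add _ (map_add _), sub_add_cancel]
  refine ⟨F.map RatFunc.C * ξ, hG, ?_, fun j => ?_⟩
  · rw [← hstate, ← Matrix.mul_assoc, res_mul, Matrix.one_mul]
    exact hξrh
  · exact eq_energy hγ hX hdare hG hξrh hstate rfl j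

/-- The weighted column norms of `J(Q)` come arbitrarily close to the lower bound. -/
theorem exists_weighted_col_le (h : Setup P P0 s ch Φ N M Nt Mt U V Ut Vt Min Mout A B C D)
    {γ : Fin m → ℝ} (hγ : ∀ i, 0 < γ i) {X : Matrix (Fin n) (Fin n) ℝ} (hX : X.PosDef)
    (hdare : IsDARE A B C D γ X) {ε : ℝ} (hε : 0 < ε) : ∃ Q : TM m, RHInfM Q ∧ ∀ j,
      ∑ i, γ i * Jmat U M Nt (ch.W Φ) Q i j <
        bvec A B C D s (ch.W Φ) j ⬝ᵥ (X *ᵥ bvec A B C D s (ch.W Φ) j) + ε := by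
  obtain ⟨hN, hM, hNt, hMt, hU, hV, hUt, hVt⟩ := h.stable_all
  obtain ⟨Gm, hG, hξ, hopt⟩ := h.exists_optimal hγ hX hdare
  set Ah := Ahat A B C D with hAh
  set T := Gm * Matrix.diagonal fun j => (phi s (ch.W Φ) j)⁻¹ with hT
  have hTrh : MatIn rhSubring T := hG.mul (MatIn.diagonal h.phi_inv_rh)
  have hTG : T * Matrix.diagonal (phi s (ch.W Φ)) = Gm := by
    rw [hT, Matrix.mul_assoc, Matrix.diagonal_mul_diagonal]
    simp [fun j => inv_mul_cancel₀ (h.phi_ne_zero j)]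
  have hMd := isUnit_iff_ne_zero.2 h.cop.det_M
  set y := M⁻¹ * (T - U * Nt) * Matrix.diagonal fun j => (eta s ch j)⁻¹ with hy
  have hetad : Matrix.diagonal (eta s ch) * (Matrix.diagonal fun j => (eta s ch j)⁻¹) = 1 := by
    rw [Matrix.diagonal_mul_diagonal]
    simp [fun j => mul_inv_cancel₀ (h.eta_ne_zero j)]
  have hy' : y = M⁻¹ * (Gm * (Matrix.diagonal fun j => (eta s ch j * phi s (ch.W Φ) j)⁻¹) -
      U * ntOut Mt P0) := by
    rw [hy, Matrix.mul_assoc, Matrix.sub_mul]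
    congr 2
    · rw [hT, Matrix.mul_assoc, Matrix.diagonal_mul_diagonal]
      congr 2
      ext j
      rw [mul_inv, mul_comm]
    · rw [h.Nt_eq, Matrix.mul_assoc, Matrix.mul_assoc, hetad, Matrix.mul_one]
  have hin : MatIn rhSubring (Gm * (Matrix.diagonal fun j => (eta s ch j * phi s (ch.W Φ) j)⁻¹) -
      U * ntOut Mt P0) :=
    (hG.mul (MatIn.diagonal fun j => (h.eta_mul_phi_rh j).2)).sub (hU.mul h.ntOut_rh)
  have hyp : MatIn properSubring y := by
    rw [hy']
    exact h.M_inv_proper.mul (hin.mono rhSubring_le_proper)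
  have hMT : M⁻¹ * (T - U * Nt) = Vt - Mout⁻¹ * (Min⁻¹ * (1 - T)) := by
    have h1 : T - U * Nt = M * Vt - (1 - T) := by
      rw [← (fromBlocks_bezout' h.cop.bezout').1]
      abel
    rw [h1, Matrix.mul_sub, ← Matrix.mul_assoc, Matrix.nonsing_inv_mul _ hMd, Matrix.one_mul,
      h.M_inv_eq, Matrix.mul_assoc]
  have hr : Min⁻¹ = (-(D⁻¹ * C)).map RatFunc.C * res Ah * (B * D⁻¹).map RatFunc.C +
      D⁻¹.map RatFunc.C := (isRealization_inv h.real h.isUnit_D).2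
  have hMinT : Min⁻¹ * (1 - T) = (-(D⁻¹ * C)).map RatFunc.C *
      (res Ah * ((B * D⁻¹).map RatFunc.C * (1 - T))) + D⁻¹.map RatFunc.C * (1 - T) := by
    rw [hr, Matrix.add_mul]
    simp only [Matrix.mul_assoc]
  have hyn : ∀ w : ℂ, 1 < ‖w‖ → MatIn (noPoleSubring w) y := by
    intro w hw i k
    have hle := rhSubring_le_noPole hw.le
    by_cases hwk : w = s k
    · subst hwk
      rw [hy']
      exact ((h.M_inv_noPole_s k).mul (hin.mono hle)) i k
    · rw [hy, Matrix.mul_diagonal]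
      refine NoPole.mul ?_ (h.eta_inv_noPole k hw.le hwk)
      rw [hMT, Matrix.sub_apply]
      refine (noPoleSubring w).sub_mem (hle (hVt i k)) ?_
      refine noPole_mul_col (fun a b => h.outer.2.2.2 a b w hw) (fun l => ?_) i
      rw [hMinT, Matrix.add_apply]
      refine NoPole.add (noPole_mul_col (MatIn.const (C_mem_noPole w) _) (fun a => ?_) l)
        (((MatIn.const (C_mem_noPole w) _).mul (MatIn.one.sub (hTrh.mono hle))) l k)
      have h1 := congrFun (congrFun (xi_identity Ah (B * D⁻¹) (bMat A B C D s (ch.W Φ)) T s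
        (ch.W Φ)) a) k
      rw [hTG, Matrix.sub_apply, Matrix.mul_diagonal, Matrix.smul_apply, smul_eq_mul,
        eq_sub_iff_add_eq] at h1
      have h2 := congrArg (fun x => x * (phi s (ch.W Φ) k)⁻¹) h1
      simp only [mul_assoc, mul_inv_cancel₀ (h.phi_ne_zero k), mul_one] at h2
      rw [← h2]
      exact NoPole.mul (NoPole.add (hle (hξ a k)) ((noPole_X w).mul (h.noPole_theta k hw.le hwk a)))
        (hle (h.phi_inv_rh k))
  obtain ⟨q, hqm, hq, hdvd⟩ := exists_common_denom hyn
  have hQ : ∀ r ∈ Set.Ioo (0 : ℝ) 1, MatIn rhSubring ((shrink q r • y) * (ntOut Mt P0)⁻¹) :=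
    fun r hr => MatIn.mul (fun i j => shrink_mul_rh hqm.ne_zero hq hr.1 hr.2 (hyp i j) (hdvd i j))
      h.ntOut_inv.2
  have hTQ : ∀ r, (U + M * ((shrink q r • y) * (ntOut Mt P0)⁻¹)) * Nt =
      U * Nt + shrink q r • (T - U * Nt) := by
    intro r
    have h1 : M * ((shrink q r • y) * (ntOut Mt P0)⁻¹) * Nt =
        shrink q r • (M * y * ((ntOut Mt P0)⁻¹ * ntOut Mt P0) * Matrix.diagonal (eta s ch)) := by
      conv_lhs => rw [h.Nt_eq]
      simp only [Matrix.mul_assoc, Matrix.mul_smul, Matrix.smul_mul]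
    rw [Matrix.add_mul, h1, mul_eq_one_comm.1 h.ntOut_inv.1, Matrix.mul_one, hy,
      ← Matrix.mul_assoc, ← Matrix.mul_assoc, Matrix.mul_nonsing_inv _ hMd, Matrix.one_mul,
      Matrix.mul_assoc, mul_eq_one_comm.1 hetad, Matrix.mul_one]
  have hlim : ∀ j, Filter.Tendsto (fun r => ∑ i, γ i * Jmat U M Nt (ch.W Φ)
      ((shrink q r • y) * (ntOut Mt P0)⁻¹) i j) (nhdsWithin 1 (Set.Ioo 0 1))
      (nhds (bvec A B C D s (ch.W Φ) j ⬝ᵥ (X *ᵥ bvec A B C D s (ch.W Φ) j))) := by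
    intro j
    rw [← hopt j]
    refine tendsto_finsetSum _ fun i _ => Filter.Tendsto.const_mul _ ?_
    have h1 := tendsto_h2sq_shrink hqm hq (rhSubring.mul_mem ((hU.mul hNt) i j) (h.W_mem j))
      (rhSubring.mul_mem ((hTrh.sub (hU.mul hNt)) i j) (h.W_mem j))
    have h2 : (U * Nt) i j * ch.W Φ j + (T - U * Nt) i j * ch.W Φ j = T i j * ch.W Φ j := by
      rw [Matrix.sub_apply]; ring
    have h3 : h2sq (T i j * ch.W Φ j) = h2sq (Gm i j) := by
      rw [← h.h2sq_mul_phi j (hTrh i j), ← hTG, Matrix.mul_diagonal]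
    rw [h2, h3] at h1
    refine h1.congr fun r => ?_
    rw [Jmat, Matrix.of_apply, hTQ, Matrix.add_apply, Matrix.smul_apply, smul_eq_mul, add_mul,
      mul_assoc]
  have hev : ∀ᶠ r in nhdsWithin (1 : ℝ) (Set.Ioo 0 1), ∀ j, ∑ i, γ i * Jmat U M Nt (ch.W Φ)
      ((shrink q r • y) * (ntOut Mt P0)⁻¹) i j <
        bvec A B C D s (ch.W Φ) j ⬝ᵥ (X *ᵥ bvec A B C D s (ch.W Φ) j) + ε :=
    Filter.eventually_all.2 fun j => (hlim j).eventually_lt_const (by linarith)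
  have := right_nhdsWithin_Ioo_neBot (zero_lt_one (α := ℝ))
  obtain ⟨r, hr, hr01⟩ := (hev.and self_mem_nhdsWithin).exists
  exact ⟨_, rhInfM_iff.2 (hQ r hr01), hr⟩

end Setup

end

section

/-! ### The stabilization radius through Riccati and Lyapunov equations -/

section Quadratic

variable {n : ℕ} {Z : Matrix (Fin n) (Fin n) ℝ}

theorem mul_inv_of_posDef {X : Matrix (Fin n) (Fin n) ℝ} (hX : X.PosDef) : X * X⁻¹ = 1 :=
  Matrix.mul_nonsing_inv _ ((Matrix.isUnit_iff_isUnit_det _).1 hX.isUnit)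

theorem quad_vecMulVec (b x : Fin n → ℝ) :
    x ⬝ᵥ (Matrix.vecMulVec b b *ᵥ x) = (b ⬝ᵥ x) ^ 2 := by
  rw [Matrix.vecMulVec_mulVec, dotProduct_smul, MulOpposite.smul_eq_mul_unop,
    MulOpposite.unop_op, dotProduct_comm x b, sq]

theorem quad_sub_smul_vecMulVec (c : ℝ) (b x : Fin n → ℝ) :
    x ⬝ᵥ ((Z - c • Matrix.vecMulVec b b) *ᵥ x) = x ⬝ᵥ (Z *ᵥ x) - c * (b ⬝ᵥ x) ^ 2 := by
  rw [Matrix.sub_mulVec, dotProduct_sub, Matrix.smul_mulVec, dotProduct_smul, quad_vecMulVec,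
    smul_eq_mul]

/-- The Cauchy–Schwarz inequality for the pair of dual quadratic forms of `Z` and `Z⁻¹`. -/
theorem sq_dotProduct_le (hZ : Z.PosDef) (b x : Fin n → ℝ) :
    (b ⬝ᵥ x) ^ 2 ≤ (b ⬝ᵥ (Z⁻¹ *ᵥ b)) * (x ⬝ᵥ (Z *ᵥ x)) := by
  have hsym : Zᵀ = Z := by simpa [Matrix.IsHermitian] using hZ.isHermitian
  set t := b ⬝ᵥ (Z⁻¹ *ᵥ b) with ht
  have hZb : Z *ᵥ (Z⁻¹ *ᵥ b) = b := by
    rw [Matrix.mulVec_mulVec, mul_inv_of_posDef hZ, Matrix.one_mulVec]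
  have key : ∀ c : ℝ, 0 ≤ x ⬝ᵥ (Z *ᵥ x) - 2 * c * (b ⬝ᵥ x) + c ^ 2 * t := by
    intro c
    have h1 := quad_nonneg hZ.posSemidef (x - c • (Z⁻¹ *ᵥ b))
    rw [Matrix.mulVec_sub, Matrix.mulVec_smul, hZb, sub_dotProduct, dotProduct_sub, dotProduct_sub,
      smul_dotProduct, smul_dotProduct, dotProduct_smul, dotProduct_smul,
      dotProduct_mulVec_comm hsym (Z⁻¹ *ᵥ b) x, hZb, dotProduct_comm (Z⁻¹ *ᵥ b) b, dotProduct_comm x b,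
      ← ht] at h1
    simp only [smul_eq_mul] at h1
    linarith
  have ht0 : 0 ≤ t := quad_nonneg hZ.inv.posSemidef b
  rcases ht0.eq_or_lt with h0 | h0
  · have hb : b = 0 := by
      by_contra hb
      exact (quad_pos hZ.inv hb).ne' h0.symm
    rw [hb, zero_dotProduct, ← h0]
    norm_num
  · have h1 := key ((b ⬝ᵥ x) / t)
    have h2 : (b ⬝ᵥ x) / t * t = b ⬝ᵥ x := div_mul_cancel₀ _ h0.ne'
    have h3 : t * (x ⬝ᵥ (Z *ᵥ x) - 2 * ((b ⬝ᵥ x) / t) * (b ⬝ᵥ x) + ((b ⬝ᵥ x) / t) ^ 2 * t) =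
        t * (x ⬝ᵥ (Z *ᵥ x)) - (b ⬝ᵥ x) ^ 2 := by
      field_simp
      ring
    have h4 := mul_nonneg h0.le h1
    linarith

end Quadratic

namespace Setup

variable {m n : ℕ} {P P0 : TM m} {s : Fin m → ℝ} {ch : Channel m} {Φ : Fin m → ℝ[X]}
  {N M Nt Mt U V Ut Vt Min Mout : TM m} {A : Matrix (Fin n) (Fin n) ℝ}
  {B : Matrix (Fin n) (Fin m) ℝ} {C : Matrix (Fin m) (Fin n) ℝ} {D : Matrix (Fin m) (Fin m) ℝ}

theorem isUnit_Ahat (h : Setup P P0 s ch Φ N M Nt Mt U V Ut Vt Min Mout A B C D) :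
    IsUnit (Ahat A B C D) := (isUnit_and_inv_charpoly h.antistable).1

theorem existsUnique_dare (h : Setup P P0 s ch Φ N M Nt Mt U V Ut Vt Min Mout A B C D)
    {γ : Fin m → ℝ} (hγ : ∀ i, 0 < γ i) :
    ∃! X : Matrix (Fin n) (Fin n) ℝ, X.PosDef ∧ IsDARE A B C D γ X := by
  obtain ⟨Z, hZ⟩ := lyap_exists h.antistable
    ((B * D⁻¹) * Matrix.diagonal (fun i => (γ i)⁻¹) * (B * D⁻¹)ᵀ)
  have hZp : Z.PosDef := lyap_posDef h.antistable (controllable_Ahat h.isUnit_D h.ctr)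
    (fun i => inv_pos.2 (hγ i)) hZ
  have hZd := (Matrix.isUnit_iff_isUnit_det _).1 hZp.isUnit
  refine ⟨Z⁻¹, ⟨hZp.inv, ?_⟩, fun X hX => ?_⟩
  · rw [isDARE_iff h.isUnit_D h.isUnit_Ahat hγ hZp.inv, Matrix.nonsing_inv_nonsing_inv _ hZd]
    exact hZ
  · have h1 := (isDARE_iff h.isUnit_D h.isUnit_Ahat hγ hX.1).1 hX.2
    rw [← lyap_eq h.antistable h1 hZ,
      Matrix.nonsing_inv_nonsing_inv _ ((Matrix.isUnit_iff_isUnit_det _).1 hX.1.isUnit)]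

theorem existsUnique_lyap (h : Setup P P0 s ch Φ N M Nt Mt U V Ut Vt Min Mout A B C D)
    (i : Fin m) : ∃! Y : Matrix (Fin n) (Fin n) ℝ, Y.PosSemidef ∧ IsLyap A B C D i Y := by
  obtain ⟨Y, hY⟩ := lyap_exists h.antistable (Matrix.vecMulVec (inCol B D i) (inCol B D i))
  refine ⟨Y, ⟨lyap_posSemidef h.antistable ?_ hY, hY⟩, fun Z hZ => lyap_eq h.antistable hZ.2 hY⟩
  simpa using Matrix.posSemidef_vecMulVec_self_star (inCol B D i)

theorem Jmat_nonneg (U M Nt : TM m) (W : Fin m → RatFunc ℝ) (Q : TM m) (i j : Fin m) :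
    0 ≤ Jmat U M Nt W Q i j := h2sq_nonneg _

theorem mem_riccatiSet_of_specRad_lt
    (h : Setup P P0 s ch Φ N M Nt Mt U V Ut Vt Min Mout A B C D) {Q : TM m} (hQ : RHInfM Q)
    {r : ℝ} (hr : specRad (Jmat U M Nt (ch.W Φ) Q) < r) :
    r ∈ riccatiSet A B C D s (ch.W Φ) := by
  rw [← specRad_transpose] at hr
  obtain ⟨γ, hγ, hγr⟩ := exists_pos_mulVec_le (J := (Jmat U M Nt (ch.W Φ) Q)ᵀ) (fun i j => Jmat_nonneg U M Nt (ch.W Φ) Q j i) hr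
  obtain ⟨X, hX, -⟩ := h.existsUnique_dare hγ
  refine ⟨γ, hγ, X, hX.1, hX.2, fun j => ?_⟩
  refine (h.le_weighted_col hγ hX.1 hX.2 hQ j).trans ((le_of_eq ?_).trans (hγr j).le)
  rw [Matrix.mulVec, dotProduct]
  exact Finset.sum_congr rfl fun i _ => mul_comm _ _

theorem exists_specRad_le (h : Setup P P0 s ch Φ N M Nt Mt U V Ut Vt Min Mout A B C D)
    {μ ε : ℝ} (hμ0 : 0 ≤ μ) (hμ : μ ∈ riccatiSet A B C D s (ch.W Φ)) (hε : 0 < ε) :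
    ∃ Q : TM m, RHInfM Q ∧ specRad (Jmat U M Nt (ch.W Φ) Q) ≤ μ + ε := by
  obtain ⟨γ, hγ, X, hX, hdare, hb⟩ := hμ
  obtain ⟨c, hc, hcγ⟩ : ∃ c : ℝ, 0 < c ∧ ∀ i, c ≤ γ i := by
    rcases isEmpty_or_nonempty (Fin m) with he | hne
    · exact ⟨1, one_pos, fun i => he.elim i⟩
    · obtain ⟨i, -, hi⟩ := Finset.exists_min_image Finset.univ γ Finset.univ_nonempty
      exact ⟨γ i, hγ i, fun j => hi j (Finset.mem_univ j)⟩
  obtain ⟨Q, hQ, hle⟩ := h.exists_weighted_col_le hγ hX hdare (mul_pos hε hc)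
  refine ⟨Q, hQ, ?_⟩
  rw [← specRad_transpose]
  refine specRad_le_of_mulVec_le (J := (Jmat U M Nt (ch.W Φ) Q)ᵀ)
    (fun i j => Jmat_nonneg U M Nt (ch.W Φ) Q j i) hγ (by linarith) fun j => ?_
  have h1 : ((Jmat U M Nt (ch.W Φ) Q)ᵀ *ᵥ γ) j = ∑ i, γ i * Jmat U M Nt (ch.W Φ) Q i j := by
    rw [Matrix.mulVec, dotProduct]
    exact Finset.sum_congr rfl fun i _ => mul_comm _ _
  rw [h1]
  nlinarith [hle j, hb j, hcγ j]

theorem nonneg_of_mem_riccatiSet (hm : 0 < m) {W : Fin m → RatFunc ℝ} {μ : ℝ}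
    (hμ : μ ∈ riccatiSet A B C D s W) : 0 ≤ μ := by
  obtain ⟨γ, hγ, X, hX, -, hb⟩ := hμ
  have h1 := (quad_nonneg hX.posSemidef _).trans (hb ⟨0, hm⟩)
  by_contra hlt
  exact absurd (mul_neg_of_neg_of_pos (not_le.1 hlt) (hγ ⟨0, hm⟩)) (not_lt.2 h1)

theorem bddBelow_specRad (U M Nt : TM m) (W : Fin m → RatFunc ℝ) :
    BddBelow {r | ∃ Q : TM m, RHInfM Q ∧ r = specRad (Jmat U M Nt W Q)} := by
  refine ⟨0, ?_⟩
  rintro r ⟨Q, -, rfl⟩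
  exact specRad_nonneg _

theorem rhInfM_zero : RHInfM (0 : TM m) := fun _ _ => mem_rhSubring.1 rhSubring.zero_mem

theorem nonempty_riccatiSet (h : Setup P P0 s ch Φ N M Nt Mt U V Ut Vt Min Mout A B C D) :
    (riccatiSet A B C D s (ch.W Φ)).Nonempty :=
  ⟨_, h.mem_riccatiSet_of_specRad_lt rhInfM_zero (lt_add_one _)⟩

theorem rhoMin_eq_riccati (hm : 0 < m)
    (h : Setup P P0 s ch Φ N M Nt Mt U V Ut Vt Min Mout A B C D) :
    rhoMin U M Nt (ch.W Φ) = sInf (riccatiSet A B C D s (ch.W Φ)) := by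
  apply le_antisymm
  · refine le_csInf h.nonempty_riccatiSet fun μ hμ => le_of_forall_pos_le_add fun ε hε => ?_
    obtain ⟨Q, hQ, hle⟩ := h.exists_specRad_le (nonneg_of_mem_riccatiSet hm hμ) hμ hε
    exact (csInf_le (bddBelow_specRad U M Nt (ch.W Φ)) ⟨Q, hQ, rfl⟩).trans hle
  · refine le_csInf ⟨_, 0, rhInfM_zero, rfl⟩ ?_
    rintro r ⟨Q, hQ, rfl⟩
    refine le_of_forall_pos_le_add fun ε hε => ?_
    exact csInf_le ⟨0, fun μ hμ => nonneg_of_mem_riccatiSet hm hμ⟩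
      (h.mem_riccatiSet_of_specRad_lt hQ (lt_add_of_pos_right _ hε))

/-- The weighted sum of the Lyapunov solutions inverts the Riccati solution. -/
theorem sum_lyap (γ : Fin m → ℝ) {Y : Fin m → Matrix (Fin n) (Fin n) ℝ}
    (hY : ∀ i, IsLyap A B C D i (Y i)) : ∑ j, γ j • Y j =
      Ahat A B C D * (∑ j, γ j • Y j) * (Ahat A B C D)ᵀ -
        (B * D⁻¹) * Matrix.diagonal γ * (B * D⁻¹)ᵀ := by
  have h1 : (B * D⁻¹) * Matrix.diagonal γ * (B * D⁻¹)ᵀ =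
      ∑ j, γ j • Matrix.vecMulVec (inCol B D j) (inCol B D j) := by
    ext a b
    rw [Matrix.mul_apply, Matrix.sum_apply]
    refine Finset.sum_congr rfl fun j _ => ?_
    rw [Matrix.mul_diagonal, Matrix.transpose_apply, Matrix.smul_apply, Matrix.vecMulVec_apply,
      smul_eq_mul, inCol, Matrix.col_apply, Matrix.col_apply]
    ring
  rw [h1, Matrix.mul_sum, Matrix.sum_mul, ← Finset.sum_sub_distrib]
  refine Finset.sum_congr rfl fun j _ => ?_
  rw [Matrix.mul_smul, Matrix.smul_mul, ← smul_sub]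
  congr 1
  exact hY j

theorem lmiSet_subset (h : Setup P P0 s ch Φ N M Nt Mt U V Ut Vt Min Mout A B C D) :
    lmiSet A B C D s (ch.W Φ) ⊆ riccatiSet A B C D s (ch.W Φ) := by
  rintro μ ⟨hμ, γ, hγ, Y, hY, hpos⟩
  have hZ := sum_lyap γ fun i => (hY i).2
  set Z := ∑ j, γ j • Y j with hZdef
  have hZp : Z.PosDef := lyap_posDef h.antistable (controllable_Ahat h.isUnit_D h.ctr) hγ hZ
  have hZd := (Matrix.isUnit_iff_isUnit_det _).1 hZp.isUnit
  have hγ' : ∀ i, 0 < (γ i)⁻¹ := fun i => inv_pos.2 (hγ i)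
  refine ⟨fun i => (γ i)⁻¹, hγ', Z⁻¹, hZp.inv, ?_, fun i => ?_⟩
  · rw [isDARE_iff h.isUnit_D h.isUnit_Ahat hγ' hZp.inv, Matrix.nonsing_inv_nonsing_inv _ hZd]
    simpa only [inv_inv] using hZ
  · set b := bvec A B C D s (ch.W Φ) i with hb
    have h1 := quad_nonneg (hpos i).posSemidef (Z⁻¹ *ᵥ b)
    rw [quad_sub_smul_vecMulVec, Matrix.mulVec_mulVec, mul_inv_of_posDef hZp, Matrix.one_mulVec,
      dotProduct_comm (Z⁻¹ *ᵥ b) b] at h1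
    set t := b ⬝ᵥ (Z⁻¹ *ᵥ b) with ht
    rcases (quad_nonneg hZp.inv.posSemidef b).eq_or_lt with h0 | h0
    · rw [← ht] at h0
      rw [← h0]
      exact (mul_pos hμ (hγ' i)).le
    · have h2 : γ i / μ * t ≤ 1 := by
        rw [← ht] at h0
        by_contra hlt
        nlinarith
      rw [div_mul_eq_mul_div, div_le_one hμ] at h2
      rw [← div_eq_mul_inv, le_div_iff₀ (hγ i)]
      linarith

theorem mem_lmiSet_of_lt (h : Setup P P0 s ch Φ N M Nt Mt U V Ut Vt Min Mout A B C D)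
    {μ ν : ℝ} (hμ0 : 0 ≤ μ) (hμ : μ ∈ riccatiSet A B C D s (ch.W Φ)) (hν : μ < ν) :
    ν ∈ lmiSet A B C D s (ch.W Φ) := by
  obtain ⟨γ, hγ, X, hX, hdare, hb⟩ := hμ
  have hν0 : 0 < ν := hμ0.trans_lt hν
  choose Y hY _ using h.existsUnique_lyap
  have hγ' : ∀ i, 0 < (γ i)⁻¹ := fun i => inv_pos.2 (hγ i)
  refine ⟨hν0, fun i => (γ i)⁻¹, hγ', Y, hY, fun i => ?_⟩
  have hZ := sum_lyap (fun i => (γ i)⁻¹) fun i => (hY i).2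
  rw [lyap_eq h.antistable hZ ((isDARE_iff h.isUnit_D h.isUnit_Ahat hγ hX).1 hdare)]
  set b := bvec A B C D s (ch.W Φ) i with hbdef
  have hXi := hX.inv
  refine Matrix.PosDef.of_dotProduct_mulVec_pos ?_ fun x hx => ?_
  · refine Matrix.IsHermitian.sub hXi.isHermitian ?_
    simp [Matrix.IsHermitian]
  · rw [star_trivial, quad_sub_smul_vecMulVec]
    have h1 := sq_dotProduct_le hXi b x
    rw [Matrix.nonsing_inv_nonsing_inv _ ((Matrix.isUnit_iff_isUnit_det _).1 hX.isUnit)] at h1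
    have hx0 := quad_pos hXi hx
    have h2 : (b ⬝ᵥ x) ^ 2 ≤ μ * γ i * (x ⬝ᵥ (X⁻¹ *ᵥ x)) :=
      h1.trans (mul_le_mul_of_nonneg_right (hb i) hx0.le)
    have h3 : (γ i)⁻¹ / ν * (b ⬝ᵥ x) ^ 2 ≤ μ / ν * (x ⬝ᵥ (X⁻¹ *ᵥ x)) := by
      refine (mul_le_mul_of_nonneg_left h2 (div_pos (hγ' i) hν0).le).trans (le_of_eq ?_)
      have := (hγ i).ne'
      field_simp
    have h4 : μ / ν < 1 := (div_lt_one hν0).2 hν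
    nlinarith

theorem riccati_eq_lmi (hm : 0 < m)
    (h : Setup P P0 s ch Φ N M Nt Mt U V Ut Vt Min Mout A B C D) :
    sInf (riccatiSet A B C D s (ch.W Φ)) = sInf (lmiSet A B C D s (ch.W Φ)) := by
  have hb : BddBelow (lmiSet A B C D s (ch.W Φ)) := ⟨0, fun μ hμ => hμ.1.le⟩
  have hlt : ∀ μ ∈ riccatiSet A B C D s (ch.W Φ), ∀ ε > 0, μ + ε ∈ lmiSet A B C D s (ch.W Φ) :=
    fun μ hμ ε hε => h.mem_lmiSet_of_lt (nonneg_of_mem_riccatiSet hm hμ) hμ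
      (lt_add_of_pos_right _ hε)
  obtain ⟨μ₀, hμ₀⟩ := h.nonempty_riccatiSet
  apply le_antisymm
  · exact csInf_le_csInf ⟨0, fun μ hμ => nonneg_of_mem_riccatiSet hm hμ⟩
      ⟨_, hlt μ₀ hμ₀ 1 one_pos⟩ h.lmiSet_subset
  · exact le_csInf ⟨μ₀, hμ₀⟩ fun μ hμ => le_of_forall_pos_le_add fun ε hε =>
      csInf_le hb (hlt μ hμ ε hε)

end Setup

end

section

/-! ### Parametrization of the stabilizing controllers -/

namespace Setup

variable {m n : ℕ} {P P0 : TM m} {s : Fin m → ℝ} {ch : Channel m} {Φ : Fin m → ℝ[X]}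
  {N M Nt Mt U V Ut Vt Min Mout : TM m} {A : Matrix (Fin n) (Fin n) ℝ}
  {B : Matrix (Fin n) (Fin m) ℝ} {C : Matrix (Fin m) (Fin n) ℝ} {D : Matrix (Fin m) (Fin m) ℝ}

theorem nominal_mul_H (P K : TM m) (ch : Channel m) :
    nominal P ch.H K * ch.H = K * (1 + P * ch.H * K)⁻¹ * (P * ch.H) := by
  rw [nominal, Matrix.mul_assoc]

/-- Every internally stabilizing controller comes from a parameter `Q`. -/
theorem exists_param (h : Setup P P0 s ch Φ N M Nt Mt U V Ut Vt Min Mout A B C D) {K : TM m}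
    (hK : InternallyStable (P * ch.H) K) :
    ∃ Q : TM m, RHInfM Q ∧ nominal P ch.H K * ch.H = (U + M * Q) * Nt := by
  obtain ⟨hN, hM, hNt, hMt, hU, hV, hUt, hVt⟩ := h.stable_all
  obtain ⟨hdet, hS, hSG, hKS, hKSG⟩ := hK
  rw [rhInfM_iff] at hS hSG hKS hKSG
  rw [nominal_mul_H]
  set G := P * ch.H with hG
  set S := (1 + G * K)⁻¹ with hSdef
  have hSi : (1 + G * K) * S = 1 := Matrix.mul_nonsing_inv _ (isUnit_iff_ne_zero.2 hdet)
  have hMtd := isUnit_iff_ne_zero.2 h.cop.det_Mt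
  have hMti : Mt⁻¹ = V + G * U := h.cop.Mt_inv
  have hMtG : Mt * G = Nt := h.cop.Mt_mul
  set Q := Vt * (K * S) * V + Vt * (K * S * G) * U - Ut * S * V - Ut * (S * G) * U with hQ
  have hQ1 : Q = (Vt * K - Ut) * S * Mt⁻¹ := by
    rw [hQ, hMti, Matrix.mul_add, Matrix.sub_mul, Matrix.sub_mul]
    simp only [Matrix.mul_assoc, Matrix.sub_mul]
    abel
  have hkey : (U + M * Q) * Mt = K * S := by
    have h1 : M * Q * Mt = (M * Vt) * K * S - (M * Ut) * S := by
      rw [hQ1, Matrix.mul_assoc, Matrix.mul_assoc _ Mt⁻¹ Mt, Matrix.nonsing_inv_mul _ hMtd,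
        Matrix.mul_one, Matrix.sub_mul, Matrix.mul_sub]
      simp only [Matrix.mul_assoc]
    have hb := fromBlocks_bezout' h.cop.bezout'
    have h2 : U * Mt = U * Mt * S + U * Nt * K * S := by
      calc U * Mt = U * Mt * ((1 + G * K) * S) := by rw [hSi, Matrix.mul_one]
        _ = U * Mt * S + U * (Mt * G) * K * S := by
            simp only [Matrix.add_mul, Matrix.mul_add, Matrix.mul_assoc, Matrix.one_mul]
        _ = _ := by rw [hMtG]
    rw [Matrix.add_mul, h1, hb.2.1, eq_sub_of_add_eq hb.1, Matrix.sub_mul, Matrix.sub_mul,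
      Matrix.one_mul]
    nth_rewrite 1 [h2]
    abel
  refine ⟨Q, rhInfM_iff.2 ?_, ?_⟩
  · exact (((((hVt.mul hKS).mul hV).add ((hVt.mul hKSG).mul hU)).sub ((hUt.mul hS).mul hV)).sub
      ((hUt.mul hSG).mul hU))
  · rw [← hMtG, ← hkey, Matrix.mul_assoc (U + M * Q)]

/-- Every parameter `Q` comes from a proper internally stabilizing controller. -/
theorem exists_controller (h : Setup P P0 s ch Φ N M Nt Mt U V Ut Vt Min Mout A B C D) {Q : TM m}
    (hQ : RHInfM Q) : ∃ K : TM m, ProperM K ∧ InternallyStable (P * ch.H) K ∧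
      nominal P ch.H K * ch.H = (U + M * Q) * Nt := by
  obtain ⟨hN, hM, hNt, hMt, hU, hV, hUt, hVt⟩ := h.stable_all
  rw [rhInfM_iff] at hQ
  set Uq := U + M * Q with hUq
  set Vq := V - N * Q with hVq
  have hUqs : MatIn rhSubring Uq := hU.add (hM.mul hQ)
  have hVqs : MatIn rhSubring Vq := hV.sub (hN.mul hQ)
  have hbez : Mt * Vq + Nt * Uq = 1 := by
    have hb := fromBlocks_bezout h.cop.bezout
    rw [hUq, hVq, Matrix.mul_sub, Matrix.mul_add, ← Matrix.mul_assoc, ← Matrix.mul_assoc, hb.2.2.1,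
      ← hb.2.2.2]
    abel
  have hVinf : (atInf Vq).det ≠ 0 := by
    have h1 := congrArg atInf hbez
    rw [atInf_add, atInf_mul (hNt.mono rhSubring_le_proper) (hUqs.mono rhSubring_le_proper),
      atInf_eq_zero h.X_Nt_proper, Matrix.zero_mul, add_zero, atInf_one,
      atInf_mul (hMt.mono rhSubring_le_proper) (hVqs.mono rhSubring_le_proper)] at h1
    have h2 := congrArg Matrix.det h1
    rw [Matrix.det_mul, Matrix.det_one] at h2
    exact right_ne_zero_of_mul (h2.trans_ne one_ne_zero)
  obtain ⟨hVd, hVp⟩ := inv_proper_of_atInf (hVqs.mono rhSubring_le_proper) hVinf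
  have hVu := isUnit_iff_ne_zero.2 hVd
  set K := Uq * Vq⁻¹ with hK
  set G := P * ch.H with hG
  have hKV : K * Vq = Uq := by
    rw [hK, Matrix.mul_assoc, Matrix.nonsing_inv_mul _ hVu, Matrix.mul_one]
  have hinv : (1 + G * K) * (Vq * Mt) = 1 := by
    have hMtd := isUnit_iff_ne_zero.2 h.cop.det_Mt
    have h1 : Mt * ((1 + G * K) * (Vq * Mt)) = Mt := by
      calc Mt * ((1 + G * K) * (Vq * Mt)) = (Mt * Vq + (Mt * G) * (K * Vq)) * Mt := by
            simp only [Matrix.add_mul, Matrix.mul_add, Matrix.mul_assoc, Matrix.one_mul]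
        _ = Mt := by rw [h.cop.Mt_mul, hKV, hbez, Matrix.one_mul]
    have h2 := congrArg (fun F => Mt⁻¹ * F) h1
    simpa only [← Matrix.mul_assoc, Matrix.nonsing_inv_mul _ hMtd, Matrix.one_mul] using h2
  have hS : (1 + G * K)⁻¹ = Vq * Mt := Matrix.inv_eq_right_inv hinv
  have hKS : K * (1 + G * K)⁻¹ = Uq * Mt := by rw [hS, ← Matrix.mul_assoc, hKV]
  refine ⟨K, (hUqs.mono rhSubring_le_proper).mul hVp, ⟨?_, ?_, ?_, ?_, ?_⟩, ?_⟩
  · intro h0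
    have := congrArg Matrix.det hinv
    rw [Matrix.det_mul, h0, zero_mul, Matrix.det_one] at this
    exact zero_ne_one this
  · rw [hS, rhInfM_iff]
    exact hVqs.mul hMt
  · rw [hS, Matrix.mul_assoc, h.cop.Mt_mul, rhInfM_iff]
    exact hVqs.mul hNt
  · rw [hKS, rhInfM_iff]
    exact hUqs.mul hMt
  · rw [hKS, Matrix.mul_assoc, h.cop.Mt_mul, rhInfM_iff]
    exact hUqs.mul hNt
  · rw [nominal_mul_H, hKS, Matrix.mul_assoc, h.cop.Mt_mul]

theorem nominal_rh (h : Setup P P0 s ch Φ N M Nt Mt U V Ut Vt Min Mout A B C D) {F Q : TM m}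
    (hQ : RHInfM Q) (hF : F * ch.H = (U + M * Q) * Nt) :
    MatIn rhSubring F ∧ ∀ i j, impulse (F i j) 0 = 0 := by
  obtain ⟨hN, hM, hNt, hMt, hU, hV, hUt, hVt⟩ := h.stable_all
  rw [rhInfM_iff] at hQ
  have h1 : F = (U + M * Q) * Nt * Matrix.diagonal fun j => (inZInv (ch.meanPoly j))⁻¹ := by
    rw [← hF, Channel.H, Matrix.mul_assoc, Matrix.diagonal_mul_diagonal]
    simp [fun j => mul_inv_cancel₀ (h.H_ne_zero j)]
  have hHi : MatIn rhSubring (Matrix.diagonal fun j => (inZInv (ch.meanPoly j))⁻¹) :=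
    MatIn.diagonal fun j => (h.mean j).inv_mem_rh
  refine ⟨?_, fun i j => ?_⟩
  · rw [h1]
    exact ((hU.add (hM.mul hQ)).mul hNt).mul hHi
  · have h2 : atInf F = 0 := by
      refine atInf_eq_zero ?_
      rw [h1, ← Matrix.smul_mul, ← Matrix.mul_smul]
      exact (((hU.add (hM.mul hQ)).mono rhSubring_le_proper).mul h.X_Nt_proper).mul
        (hHi.mono rhSubring_le_proper)
    exact congrFun (congrFun h2 i) j

theorem Jmat_eq (h : Setup P P0 s ch Φ N M Nt Mt U V Ut Vt Min Mout A B C D) {F Q : TM m}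
    (hF : F * ch.H = (U + M * Q) * Nt) (i j : Fin m) :
    Jmat U M Nt (ch.W Φ) Q i j = h2sq (F i j * inZInv (Φ j)) := by
  rw [Jmat, Matrix.of_apply, ← hF, Channel.H, Matrix.mul_diagonal, Channel.W]
  congr 1
  have := h.H_ne_zero j
  field_simp

end Setup

/-! ### The energy spectral density as a mean of squared moduli -/

namespace Channel

variable {m : ℕ} (ch : Channel m)

/-- The centred response of subchannel `i` to an input sample delayed by `c`, as a polynomial
in `z⁻¹`. -/
def omPoly (i : Fin m) (c : Fin (ch.dmax i + 1)) : ℝ[X] :=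
  ∑ k : Fin (ch.dmax i + 1), Polynomial.monomial (k : ℕ) (ch.h i k c - ch.mean i k)

theorem cov_symm (i : Fin m) (j l : Fin (ch.dmax i + 1)) : ch.cov i j l = ch.cov i l j :=
  Finset.sum_congr rfl fun c _ => by ring

theorem autocorr_natAbs (i : Fin m) (t : ℤ) : ch.autocorr i t.natAbs =
    ∑ j : Fin (ch.dmax i + 1), ∑ l : Fin (ch.dmax i + 1),
      if ((j : ℕ) : ℤ) - ((l : ℕ) : ℤ) = t then ch.cov i j l else 0 := by
  rcases le_total 0 t with ht | ht
  · rw [autocorr, Finset.sum_comm]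
    refine Finset.sum_congr rfl fun j _ => Finset.sum_congr rfl fun l _ => ?_
    rw [ch.cov_symm]
    refine if_congr ?_ rfl rfl
    omega
  · rw [autocorr]
    refine Finset.sum_congr rfl fun j _ => Finset.sum_congr rfl fun l _ => ?_
    refine if_congr ?_ rfl rfl
    omega

end Channel

theorem noPole_zpow_X {w : ℂ} (hw : w ≠ 0) (t : ℤ) :
    NoPole ((RatFunc.X : RatFunc ℝ) ^ t) w ∧ evalC w ((RatFunc.X : RatFunc ℝ) ^ t) = w ^ t := by
  have hX : NoPole (RatFunc.X⁻¹ : RatFunc ℝ) w := NoPole.inv (by rwa [evalC_X])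
  obtain ⟨k, rfl | rfl⟩ := t.eq_nat_or_neg
  · rw [zpow_natCast, zpow_natCast, evalC_pow (noPole_X w), evalC_X]
    exact ⟨(noPoleSubring w).pow_mem (noPole_X w) k, rfl⟩
  · rw [zpow_neg, zpow_neg, zpow_natCast, zpow_natCast, ← inv_pow, ← inv_pow]
    exact ⟨(noPoleSubring w).pow_mem hX k, by rw [evalC_pow hX, evalC_X_inv hw]⟩

variable {m : ℕ} {ch : Channel m}

theorem evalC_density (i : Fin m) {w : ℂ} (hw : w ≠ 0) :
    evalC w (ch.density i) = ∑ j : Fin (ch.dmax i + 1), ∑ l : Fin (ch.dmax i + 1),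
      (ch.cov i j l : ℂ) * w ^ (((l : ℕ) : ℤ) - ((j : ℕ) : ℤ)) := by
  rw [Channel.density, evalC_sum]
  · have h1 : ∀ t ∈ Finset.Icc (-(ch.dmax i : ℤ)) (ch.dmax i : ℤ),
        evalC w (RatFunc.C (ch.autocorr i t.natAbs) * RatFunc.X ^ (-t)) =
        ∑ j : Fin (ch.dmax i + 1), ∑ l : Fin (ch.dmax i + 1),
          if ((j : ℕ) : ℤ) - ((l : ℕ) : ℤ) = t then
            (ch.cov i j l : ℂ) * w ^ (((l : ℕ) : ℤ) - ((j : ℕ) : ℤ)) else 0 := by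
      intro t _
      rw [evalC_mul (noPole_C _ w) (noPole_zpow_X hw _).1, (noPole_zpow_X hw _).2, evalC_C,
        ch.autocorr_natAbs]
      push_cast
      rw [Finset.sum_mul]
      refine Finset.sum_congr rfl fun j _ => ?_
      rw [Finset.sum_mul]
      refine Finset.sum_congr rfl fun l _ => ?_
      split_ifs with h
      · rw [← h, neg_sub]
      · simp
    rw [Finset.sum_congr rfl h1, Finset.sum_comm]
    refine Finset.sum_congr rfl fun j _ => ?_
    rw [Finset.sum_comm]
    refine Finset.sum_congr rfl fun l _ => ?_
    rw [Finset.sum_ite_eq, if_pos]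
    rw [Finset.mem_Icc]
    have := j.2
    have := l.2
    omega
  · exact fun t _ => (noPole_C _ w).mul (noPole_zpow_X hw _).1

theorem norm_sq_spectralFactor {Φ : Fin m → ℝ[X]} (hΦ : ch.IsSpectralFactor Φ) (i : Fin m) {w : ℂ}
    (hw : ‖w‖ = 1) : ‖evalC w (inZInv (Φ i))‖ ^ 2 =
      ∑ c, ch.prob i c * ‖evalC w (inZInv (ch.omPoly i c))‖ ^ 2 := by
  have hw0 : w ≠ 0 := by rintro rfl; norm_num at hw
  have hconj : starRingEnd ℂ w = w⁻¹ := by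
    rw [Complex.inv_def, Complex.normSq_eq_norm_sq, hw]; simp
  have hcpoly : ∀ p : ℝ[X], aeval w p = starRingEnd ℂ (aeval w⁻¹ p) := by
    intro p
    rw [← hconj, Polynomial.aeval_conj, Complex.conj_conj]
  have h1 : ((‖evalC w (inZInv (Φ i))‖ ^ 2 : ℝ) : ℂ) = evalC w (ch.density i) := by
    rw [(hΦ i).2, substInv_inZInv, evalC_mul (rhSubring_le_noPole hw.ge (inZInv_mem_rh _))
      (noPole_algebraMap _ w), evalC_algebraMap, evalC_inZInv _ hw0, hcpoly, Complex.mul_conj,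
      Complex.normSq_eq_norm_sq]
  have h2 : ∀ c, ((‖evalC w (inZInv (ch.omPoly i c))‖ ^ 2 : ℝ) : ℂ) =
      ∑ j : Fin (ch.dmax i + 1), ∑ l : Fin (ch.dmax i + 1),
        (((ch.h i j c - ch.mean i j) * (ch.h i l c - ch.mean i l) : ℝ) : ℂ) *
          w ^ (((l : ℕ) : ℤ) - ((j : ℕ) : ℤ)) := by
    intro c
    have h3 : ∀ x : ℂ, aeval x (ch.omPoly i c) = ∑ k : Fin (ch.dmax i + 1),
        ((ch.h i k c - ch.mean i k : ℝ) : ℂ) * x ^ (k : ℕ) := by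
      intro x
      simp [Channel.omPoly, aeval_monomial, sub_mul]
    rw [evalC_inZInv _ hw0, ← Complex.normSq_eq_norm_sq, ← Complex.mul_conj, ← hcpoly, h3, h3,
      Finset.sum_mul_sum]
    refine Finset.sum_congr rfl fun j _ => Finset.sum_congr rfl fun l _ => ?_
    rw [zpow_sub₀ hw0, zpow_natCast, zpow_natCast, Complex.ofReal_mul, inv_pow]
    ring
  apply Complex.ofReal_injective
  rw [h1, evalC_density i hw0]
  push_cast
  have h4 : ∀ c, (ch.prob i c : ℂ) * (‖evalC w (inZInv (ch.omPoly i c))‖ : ℂ) ^ 2 =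
      (ch.prob i c : ℂ) * ∑ j : Fin (ch.dmax i + 1), ∑ l : Fin (ch.dmax i + 1),
        (((ch.h i j c - ch.mean i j) * (ch.h i l c - ch.mean i l) : ℝ) : ℂ) *
          w ^ (((l : ℕ) : ℤ) - ((j : ℕ) : ℤ)) := by
    intro c
    rw [← h2]
    push_cast
    rfl
  rw [Finset.sum_congr rfl fun c _ => h4 c]
  simp only [Finset.mul_sum]
  symm
  rw [Finset.sum_comm]
  refine Finset.sum_congr rfl fun j _ => ?_
  rw [Finset.sum_comm]
  refine Finset.sum_congr rfl fun l _ => ?_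
  rw [Channel.cov]
  push_cast
  rw [Finset.sum_mul]
  refine Finset.sum_congr rfl fun c _ => ?_
  ring

theorem h2sq_eq_sum {ι : Type*} [Fintype ι] {f : RatFunc ℝ} {g : ι → RatFunc ℝ} (p : ι → ℝ)
    (hg : ∀ c, g c ∈ rhSubring)
    (h : ∀ w : ℂ, ‖w‖ = 1 → ‖evalC w f‖ ^ 2 = ∑ c, p c * ‖evalC w (g c)‖ ^ 2) :
    h2sq f = ∑ c, p c * h2sq (g c) := by
  simp only [h2sq, fun θ : ℝ => h _ (norm_exp_mul_I θ)]
  rw [intervalIntegral.integral_finsetSum, Finset.mul_sum]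
  · refine Finset.sum_congr rfl fun c _ => ?_
    rw [intervalIntegral.integral_const_mul]
    ring
  · intro c _
    have := continuous_evalC_circle (f := g c) fun w hw => rhSubring_le_noPole hw.ge (hg c)
    exact Continuous.intervalIntegrable (by fun_prop) _ _

theorem h2sq_mul_spectralFactor {Φ : Fin m → ℝ[X]} (hΦ : ch.IsSpectralFactor Φ) (j : Fin m)
    {f : RatFunc ℝ} (hf : f ∈ rhSubring) : h2sq (f * inZInv (Φ j)) =
      ∑ c, ch.prob j c * h2sq (f * inZInv (ch.omPoly j c)) := by
  refine h2sq_eq_sum _ (fun c => rhSubring.mul_mem hf (inZInv_mem_rh _)) fun w hw => ?_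
  have hle := rhSubring_le_noPole (w := w) hw.ge
  rw [evalC_mul (hle hf) (hle (inZInv_mem_rh _)), norm_mul, mul_pow, norm_sq_spectralFactor hΦ j hw,
    Finset.mul_sum]
  refine Finset.sum_congr rfl fun c _ => ?_
  rw [evalC_mul (hle hf) (hle (inZInv_mem_rh _)), norm_mul, mul_pow]
  ring

end

section

/-! ### The closed loop as a linear recursion with random coefficients -/

section Recursion

variable {m : ℕ} {ch : Channel m} {F : TM m}

/-- The response of output `i` to a unit sample of input `l` that is delayed by `c`. -/
def kap (ch : Channel m) (F : TM m) (i l : Fin m) (c : Fin (ch.dmax l + 1)) (t : ℕ) : ℝ :=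
  impulse (F i l * inZInv (ch.omPoly l c)) t

theorem kap_eq (hF : MatIn rhSubring F) (i l : Fin m) (c : Fin (ch.dmax l + 1)) (t : ℕ) :
    kap ch F i l c t = ∑ j : Fin (ch.dmax l + 1),
      if (j : ℕ) ≤ t then (ch.h l j c - ch.mean l j) * impulse (F i l) (t - j) else 0 := by
  rw [kap, impulse_mul (rhSubring_le_proper (hF i l)) (rhSubring_le_proper (inZInv_mem_rh _))]
  have h1 : ∀ p : ℕ × ℕ, impulse (F i l) p.1 * impulse (inZInv (ch.omPoly l c)) p.2 =
      ∑ j : Fin (ch.dmax l + 1), if (j : ℕ) = p.2 then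
        (ch.h l j c - ch.mean l j) * impulse (F i l) p.1 else 0 := by
    intro p
    rw [impulse_inZInv, Channel.omPoly, finsetSum_coeff, Finset.mul_sum]
    refine Finset.sum_congr rfl fun j _ => ?_
    rw [coeff_monomial]
    split_ifs
    · ring
    · ring
  rw [Finset.sum_congr rfl fun p _ => h1 p, Finset.sum_comm]
  refine Finset.sum_congr rfl fun j _ => ?_
  rw [Finset.Nat.sum_antidiagonal_eq_sum_range_succ_mk]
  split_ifs with hj
  · rw [Finset.sum_eq_single (t - j)]
    · rw [if_pos (by simp; omega)]
    · intro n hn hne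
      rw [Finset.mem_range] at hn
      exact if_neg (by simp; omega)
    · intro h
      simp at h
  · refine Finset.sum_eq_zero fun n hn => if_neg ?_
    simp
    omega

theorem sum_prob_mul_om (l : Fin m) (j : Fin (ch.dmax l + 1)) :
    ∑ c, ch.prob l c * (ch.h l j c - ch.mean l j) = 0 := by
  simp only [mul_sub, Finset.sum_sub_distrib, ← Finset.sum_mul, ch.prob_sum, one_mul]
  rw [Channel.mean, sub_self]

theorem sum_prob_mul_kap (hF : MatIn rhSubring F) (i l : Fin m) (t : ℕ) :
    ∑ c, ch.prob l c * kap ch F i l c t = 0 := by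
  simp only [kap_eq hF, Finset.mul_sum]
  rw [Finset.sum_comm]
  refine Finset.sum_eq_zero fun j _ => ?_
  split_ifs with hj
  · simp only [← mul_assoc]
    rw [← Finset.sum_mul, sum_prob_mul_om, zero_mul]
  · simp

theorem kap_zero (hF : MatIn rhSubring F) (hF0 : ∀ i j, impulse (F i j) 0 = 0) (i l : Fin m)
    (c : Fin (ch.dmax l + 1)) : kap ch F i l c 0 = 0 := by
  rw [kap, impulse_zero_mul (rhSubring_le_proper (hF i l)) (rhSubring_le_proper (inZInv_mem_rh _)),
    hF0, zero_mul]

theorem sum_shift (k j : ℕ) (f g : ℕ → ℝ) :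
    (∑ n ∈ Finset.range (k + 1), if j ≤ n then f (n - j) * g (k - n) else 0) =
      ∑ n ∈ Finset.range (k + 1), if j ≤ k - n then f n * g (k - n - j) else 0 := by
  rw [← Finset.sum_filter, ← Finset.sum_filter]
  refine Finset.sum_nbij' (fun n => n - j) (fun n => n + j) ?_ ?_ ?_ ?_ ?_
  · intro n hn
    simp only [Finset.mem_filter, Finset.mem_range] at hn ⊢
    omega
  · intro n hn
    simp only [Finset.mem_filter, Finset.mem_range] at hn ⊢
    omega
  · intro n hn
    simp only [Finset.mem_filter, Finset.mem_range] at hn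
    omega
  · intro n hn
    omega
  · intro n hn
    simp only [Finset.mem_filter, Finset.mem_range] at hn
    congr 2
    omega

theorem conv_unc (hF : MatIn rhSubring F) (hF0 : ∀ i j, impulse (F i j) 0 = 0) (i l : Fin m)
    (c : ℕ → Fin (ch.dmax l + 1)) (u : ℕ → ℝ) (k : ℕ) :
    (∑ n ∈ Finset.range (k + 1), impulse (F i l) (k - n) * ∑ j : Fin (ch.dmax l + 1),
      if (j : ℕ) ≤ n then (ch.h l j (c (n - j)) - ch.mean l j) * u (n - j) else 0) =
      ∑ n ∈ Finset.range k, kap ch F i l (c n) (k - n) * u n := by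
  have h1 : ∑ n ∈ Finset.range k, kap ch F i l (c n) (k - n) * u n =
      ∑ n ∈ Finset.range (k + 1), kap ch F i l (c n) (k - n) * u n := by
    rw [Finset.sum_range_succ, Nat.sub_self, kap_zero hF hF0, zero_mul, add_zero]
  rw [h1]
  simp only [kap_eq hF, Finset.mul_sum, Finset.sum_mul]
  rw [Finset.sum_comm]
  conv_rhs => rw [Finset.sum_comm]
  refine Finset.sum_congr rfl fun j _ => ?_
  have h2 := sum_shift k j (fun n => (ch.h l j (c n) - ch.mean l j) * u n) (impulse (F i l))
  refine Eq.trans (Finset.sum_congr rfl fun n _ => ?_) (h2.trans (Finset.sum_congr rfl fun n _ => ?_))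
  · split_ifs <;> ring
  · split_ifs <;> ring

variable {Ω : Type} {χ : (i : Fin m) → ℕ → Ω → Fin (ch.dmax i + 1)} {v e u d : ℕ → Ω → Fin m → ℝ}

theorem out_eq (hF : MatIn rhSubring F) (hF0 : ∀ i j, impulse (F i j) 0 = 0)
    (herr : ∀ k ω i, e k ω i = v k ω i - d k ω i)
    (hunc : ∀ k ω i, d k ω i = ∑ j : Fin (ch.dmax i + 1),
      if (j : ℕ) ≤ k then (ch.h i j (χ i (k - j) ω) - ch.mean i j) * u (k - j) ω i else 0)
    (k : ℕ) (ω : Ω) (i : Fin m) :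
    ∑ n ∈ Finset.range (k + 1), ∑ l, impulse (F i l) (k - n) * e n ω l =
      (∑ n ∈ Finset.range k, ∑ l, impulse (F i l) (k - n) * v n ω l) -
      ∑ n ∈ Finset.range k, ∑ l, kap ch F i l (χ l n ω) (k - n) * u n ω l := by
  have h1 : ∑ n ∈ Finset.range k, ∑ l, impulse (F i l) (k - n) * v n ω l =
      ∑ n ∈ Finset.range (k + 1), ∑ l, impulse (F i l) (k - n) * v n ω l := by
    rw [Finset.sum_range_succ, Nat.sub_self]
    simp [hF0]
  have h2 : ∑ n ∈ Finset.range k, ∑ l, kap ch F i l (χ l n ω) (k - n) * u n ω l =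
      ∑ n ∈ Finset.range (k + 1), ∑ l, impulse (F i l) (k - n) * d n ω l := by
    rw [Finset.sum_comm]
    conv_rhs => rw [Finset.sum_comm]
    refine Finset.sum_congr rfl fun l _ => ?_
    rw [← conv_unc hF hF0 i l (fun n => χ l n ω) (fun n => u n ω l) k]
    exact Finset.sum_congr rfl fun n _ => by rw [hunc]
  rw [h1, h2, ← Finset.sum_sub_distrib]
  refine Finset.sum_congr rfl fun n _ => ?_
  rw [← Finset.sum_sub_distrib]
  refine Finset.sum_congr rfl fun l _ => ?_
  rw [herr]
  ring

/-- The signals `u` solve a linear recursion with random coefficients driven by `v`. -/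
def IsRecursion (ch : Channel m) (F : TM m) (χ : (i : Fin m) → ℕ → Ω → Fin (ch.dmax i + 1))
    (v u : ℕ → Ω → Fin m → ℝ) : Prop :=
  ∀ k ω i, u k ω i = (∑ n ∈ Finset.range k, ∑ l, impulse (F i l) (k - n) * v n ω l) -
      ∑ n ∈ Finset.range k, ∑ l, kap ch F i l (χ l n ω) (k - n) * u n ω l

theorem IsClosedLoop.isRecursion (hF : MatIn rhSubring F) (hF0 : ∀ i j, impulse (F i j) 0 = 0)
    (h : IsClosedLoop ch F χ v e u d) : IsRecursion ch F χ v u := fun k ω i => by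
  rw [h.out, out_eq hF hF0 h.err h.unc]

/-- The solution of a Volterra recursion. -/
def volterra (a : ℕ → Fin m → ℝ) (κ : ℕ → ℕ → Fin m → Fin m → ℝ) (k : ℕ) (i : Fin m) : ℝ :=
  a k i - ∑ n : Fin k, ∑ l, κ k n i l * volterra a κ n l
termination_by k
decreasing_by exact n.2

theorem exists_closedLoop (hF : MatIn rhSubring F) (hF0 : ∀ i j, impulse (F i j) 0 = 0)
    (χ : (i : Fin m) → ℕ → Ω → Fin (ch.dmax i + 1)) (v : ℕ → Ω → Fin m → ℝ) :
    ∃ e u d : ℕ → Ω → Fin m → ℝ, IsClosedLoop ch F χ v e u d := by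
  let u : ℕ → Ω → Fin m → ℝ := fun k ω => volterra
    (fun k i => ∑ n ∈ Finset.range k, ∑ l, impulse (F i l) (k - n) * v n ω l)
    (fun k n i l => kap ch F i l (χ l n ω) (k - n)) k
  let d : ℕ → Ω → Fin m → ℝ := fun k ω i => ∑ j : Fin (ch.dmax i + 1),
    if (j : ℕ) ≤ k then (ch.h i j (χ i (k - j) ω) - ch.mean i j) * u (k - j) ω i else 0
  refine ⟨fun k ω i => v k ω i - d k ω i, u, d, fun _ _ _ => rfl, fun k ω i => ?_,
    fun _ _ _ => rfl⟩
  rw [out_eq (e := fun k ω i => v k ω i - d k ω i) (d := d) (u := u) (v := v) (χ := χ) hF hF0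
    (fun _ _ _ => rfl) (fun _ _ _ => rfl)]
  have h1 : u k ω i = _ - ∑ n : Fin k, ∑ l, kap ch F i l (χ l n ω) (k - n) * u n ω l :=
    volterra.eq_def _ _ k i
  rw [h1]
  congr 1
  exact Fin.sum_univ_eq_sum_range (fun n => ∑ l, kap ch F i l (χ l n ω) (k - n) * u n ω l) k

end Recursion

end

section

/-! ### Independence and orthogonality -/

theorem indep_sup_right_of_indep {Ω : Type*} {a b c mΩ : MeasurableSpace Ω} {μ : Measure Ω}
    [IsProbabilityMeasure μ] (ha : a ≤ mΩ) (hb : b ≤ mΩ) (hc : c ≤ mΩ) (hac : Indep a c μ)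
    (hbac : Indep b (a ⊔ c) μ) : Indep a (b ⊔ c) μ := by
  refine IndepSets.indep (p1 := {s | MeasurableSet[a] s})
    (p2 := {t | ∃ B C, MeasurableSet[b] B ∧ MeasurableSet[c] C ∧ t = B ∩ C}) ha (sup_le hb hc)
    (@MeasurableSpace.isPiSystem_measurableSet Ω a) ?_
    (@MeasurableSpace.generateFrom_measurableSet Ω a).symm ?_ ?_
  · rintro _ ⟨B, C, hB, hC, rfl⟩ _ ⟨B', C', hB', hC', rfl⟩ -
    refine ⟨B ∩ B', C ∩ C', hB.inter hB', hC.inter hC', ?_⟩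
    rw [Set.inter_inter_inter_comm]
  · apply le_antisymm
    · refine sup_le (fun B hB => ?_) fun C hC => ?_
      · exact MeasurableSpace.measurableSet_generateFrom
          ⟨B, Set.univ, hB, MeasurableSet.univ, (Set.inter_univ B).symm⟩
      · exact MeasurableSpace.measurableSet_generateFrom
          ⟨Set.univ, C, MeasurableSet.univ, hC, (Set.univ_inter C).symm⟩
    · refine MeasurableSpace.generateFrom_le ?_
      rintro _ ⟨B, C, hB, hC, rfl⟩
      exact MeasurableSet.inter (le_sup_left (a := b) (b := c) B hB)
        (le_sup_right (a := b) (b := c) C hC)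
  · rw [IndepSets_iff]
    rintro A _ hA ⟨B, C, hB, hC, rfl⟩
    rw [Indep_iff] at hac hbac
    have hAC : MeasurableSet[a ⊔ c] (A ∩ C) :=
      MeasurableSet.inter (le_sup_left (a := a) (b := c) A hA) (le_sup_right (a := a) (b := c) C hC)
    rw [Set.inter_left_comm, hbac B (A ∩ C) hB hAC, hac A C hA hC,
      hbac B C hB (le_sup_right (a := a) (b := c) C hC)]
    ring

section SecondMoment

variable {Ω : Type*} [MeasurableSpace Ω] {Pr : Measure Ω}

theorem integral_sq_sub_sum {ι : Type*} (s : Finset ι) {Y : Ω → ℝ} {X : ι → Ω → ℝ}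
    (hY : MemLp Y 2 Pr) (hX : ∀ q ∈ s, MemLp (X q) 2 Pr)
    (hYX : ∀ q ∈ s, ∫ ω, Y ω * X q ω ∂Pr = 0)
    (hXX : ∀ q ∈ s, ∀ r ∈ s, q ≠ r → ∫ ω, X q ω * X r ω ∂Pr = 0) :
    ∫ ω, (Y ω - ∑ q ∈ s, X q ω) ^ 2 ∂Pr = ∫ ω, Y ω ^ 2 ∂Pr + ∑ q ∈ s, ∫ ω, X q ω ^ 2 ∂Pr := by
  classical
  induction s using Finset.induction_on with
  | empty => simp
  | insert a s ha ih =>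
    have hXs : ∀ q ∈ s, MemLp (X q) 2 Pr := fun q hq => hX q (Finset.mem_insert_of_mem hq)
    have ih := ih hXs (fun q hq => hYX q (Finset.mem_insert_of_mem hq))
      fun q hq r hr => hXX q (Finset.mem_insert_of_mem hq) r (Finset.mem_insert_of_mem hr)
    have hXa := hX a (Finset.mem_insert_self a s)
    have hZ : MemLp (fun ω => Y ω - ∑ q ∈ s, X q ω) 2 Pr := hY.sub (memLp_finsetSum s hXs)
    have hcross : ∫ ω, (Y ω - ∑ q ∈ s, X q ω) * X a ω ∂Pr = 0 := by
      have h1 : ∀ ω, (Y ω - ∑ q ∈ s, X q ω) * X a ω = Y ω * X a ω - ∑ q ∈ s, X q ω * X a ω := by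
        intro ω
        rw [sub_mul, Finset.sum_mul]
      have hI : ∀ q ∈ s, Integrable (fun ω => X q ω * X a ω) Pr :=
        fun q hq => (hXs q hq).integrable_mul hXa
      have hIY : Integrable (fun ω => Y ω * X a ω) Pr := hY.integrable_mul hXa
      simp only [h1]
      rw [integral_sub hIY (integrable_finsetSum _ hI), integral_finsetSum _ hI,
        hYX a (Finset.mem_insert_self a s), Finset.sum_eq_zero, sub_zero]
      intro q hq
      refine hXX q (Finset.mem_insert_of_mem hq) a (Finset.mem_insert_self a s) ?_
      rintro rfl
      exact ha hq
    have h2 : ∀ ω, (Y ω - ∑ q ∈ insert a s, X q ω) ^ 2 = (Y ω - ∑ q ∈ s, X q ω) ^ 2 -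
        2 * ((Y ω - ∑ q ∈ s, X q ω) * X a ω) + X a ω ^ 2 := by
      intro ω
      rw [Finset.sum_insert ha]
      ring
    simp only [h2]
    have hI : Integrable (fun ω => 2 * ((Y ω - ∑ q ∈ s, X q ω) * X a ω)) Pr :=
      (hZ.integrable_mul hXa).const_mul 2
    have hI2 : Integrable (fun ω => (Y ω - ∑ q ∈ s, X q ω) ^ 2 -
        2 * ((Y ω - ∑ q ∈ s, X q ω) * X a ω)) Pr := hZ.integrable_sq.sub hI
    rw [integral_add hI2 hXa.integrable_sq, integral_sub hZ.integrable_sq hI,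
      integral_const_mul, hcross, ih, Finset.sum_insert ha]
    ring

theorem lintegral_enorm_sq {f : Ω → ℝ} (hf : MemLp f 2 Pr) :
    ∫⁻ ω, ‖f ω‖ₑ ^ 2 ∂Pr = ENNReal.ofReal (∫ ω, f ω ^ 2 ∂Pr) := by
  rw [ofReal_integral_eq_lintegral_ofReal hf.integrable_sq
    (Filter.Eventually.of_forall fun ω => sq_nonneg _)]
  refine lintegral_congr fun ω => ?_
  rw [← sq_abs, ENNReal.ofReal_pow (abs_nonneg _), ← Real.norm_eq_abs, ofReal_norm]

end SecondMoment

section Loop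

variable {m : ℕ} {ch : Channel m} {F : TM m} {Ω : Type}
  {χ : (i : Fin m) → ℕ → Ω → Fin (ch.dmax i + 1)} {v u : ℕ → Ω → Fin m → ℝ}

/-- Everything but the delay `χ_q`. -/
abbrev rest (χ : (i : Fin m) → ℕ → Ω → Fin (ch.dmax i + 1)) (v : ℕ → Ω → Fin m → ℝ)
    (q : Fin m × ℕ) : MeasurableSpace Ω :=
  (⨆ k, MeasurableSpace.comap (v k) inferInstance) ⊔
    ⨆ r ∈ ({q}ᶜ : Set (Fin m × ℕ)), MeasurableSpace.comap (χ r.1 r.2) inferInstance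

theorem measurable_noise (χ : (i : Fin m) → ℕ → Ω → Fin (ch.dmax i + 1)) (v : ℕ → Ω → Fin m → ℝ)
    (q : Fin m × ℕ) (k : ℕ) (i : Fin m) : Measurable[rest χ v q] fun ω => v k ω i := by
  have h1 : Measurable[rest χ v q] (v k) :=
    (comap_measurable (v k)).mono ((le_iSup (fun k => MeasurableSpace.comap (v k) inferInstance)
      k).trans le_sup_left) le_rfl
  exact (measurable_pi_apply i).comp h1

theorem measurable_delay (χ : (i : Fin m) → ℕ → Ω → Fin (ch.dmax i + 1)) (v : ℕ → Ω → Fin m → ℝ)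
    {q : Fin m × ℕ} {l : Fin m} {n : ℕ} (h : (l, n) ≠ q) : Measurable[rest χ v q] (χ l n) :=
  (comap_measurable (χ l n)).mono ((le_iSup₂_of_le (f := fun (r : Fin m × ℕ)
    (_ : r ∈ ({q}ᶜ : Set (Fin m × ℕ))) => MeasurableSpace.comap (χ r.1 r.2) inferInstance)
    (l, n) h le_rfl).trans le_sup_right) le_rfl

theorem measurable_signal (hu : IsRecursion ch F χ v u) (q : Fin m × ℕ) (k : ℕ) (hk : k ≤ q.2)
    (i : Fin m) : Measurable[rest χ v q] fun ω => u k ω i := by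
  induction k using Nat.strong_induction_on generalizing i with
  | _ k ih =>
    have h1 : (fun ω => u k ω i) = fun ω =>
      (∑ n ∈ Finset.range k, ∑ l, impulse (F i l) (k - n) * v n ω l) -
      ∑ n ∈ Finset.range k, ∑ l, kap ch F i l (χ l n ω) (k - n) * u n ω l := by
      ext ω
      exact hu k ω i
    rw [h1]
    refine Measurable.sub ?_ ?_
    · refine Finset.measurable_sum _ fun n _ => Finset.measurable_sum _ fun l _ => ?_
      exact (measurable_noise χ v q n l).const_mul _
    · refine Finset.measurable_sum _ fun n hn => Finset.measurable_sum _ fun l _ => ?_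
      have hn' := Finset.mem_range.1 hn
      have hne : (l, n) ≠ q := by
        rintro rfl
        simp at hk
        omega
      exact Measurable.mul ((measurable_of_countable fun c => kap ch F i l c (k - n)).comp
        (measurable_delay χ v hne)) (ih n hn' (by omega) l)

variable [MeasurableSpace Ω] {Pr : Measure Ω}

theorem memLp_comp_mul {κ : Type*} [Fintype κ] [MeasurableSpace κ] [DiscreteMeasurableSpace κ]
    {c : Ω → κ} (hc : Measurable c) (f : κ → ℝ) {Z : Ω → ℝ} (hZ : MemLp Z 2 Pr) :
    MemLp (fun ω => f (c ω) * Z ω) 2 Pr := by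
  have hf : Measurable fun ω => f (c ω) := (measurable_of_countable f).comp hc
  refine hZ.of_le_mul (c := ∑ x, |f x|) (hf.aestronglyMeasurable.mul hZ.1)
    (Filter.Eventually.of_forall fun ω => ?_)
  rw [norm_mul]
  refine mul_le_mul_of_nonneg_right ?_ (norm_nonneg _)
  exact Finset.single_le_sum (f := fun x => |f x|) (fun x _ => abs_nonneg _) (Finset.mem_univ (c ω))

theorem rest_le (hχ : IsDelayProcess ch Pr χ) (hv : IsWhiteNoise Pr v) (q : Fin m × ℕ) :
    rest χ v q ≤ ‹MeasurableSpace Ω› :=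
  sup_le (iSup_le fun k => (hv.meas k).comap_le) (iSup₂_le fun r _ => (hχ.meas r.1 r.2).comap_le)

theorem indep_delay_rest [IsProbabilityMeasure Pr] (hχ : IsDelayProcess ch Pr χ) (hv : IsWhiteNoise Pr v)
    (hvχ : IndepFun (fun ω k => v k ω) (fun ω i k => χ i k ω) Pr) (q : Fin m × ℕ) :
    Indep (MeasurableSpace.comap (χ q.1 q.2) inferInstance) (rest χ v q) Pr := by
  have hle : ∀ r : Fin m × ℕ, MeasurableSpace.comap (χ r.1 r.2) inferInstance ≤
      ‹MeasurableSpace Ω› := fun r => (hχ.meas r.1 r.2).comap_le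
  refine indep_sup_right_of_indep (hle q) (iSup_le fun k => (hv.meas k).comap_le)
    (iSup₂_le fun r _ => hle r) ?_ ?_
  · have h1 := indep_iSup_of_disjoint hle hχ.indep (S := {q}) (T := {q}ᶜ)
      disjoint_compl_right
    simpa only [Set.mem_singleton_iff, iSup_iSup_eq_left] using h1
  · refine indep_of_indep_of_le_left (indep_of_indep_of_le_right hvχ ?_) ?_
    · have h2 : ∀ r : Fin m × ℕ, MeasurableSpace.comap (χ r.1 r.2) inferInstance ≤
          MeasurableSpace.comap (fun ω i k => χ i k ω) inferInstance := by
        intro r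
        refine Measurable.comap_le ?_
        exact ((measurable_pi_apply r.2).comp (measurable_pi_apply r.1)).comp
          (comap_measurable (fun ω i k => χ i k ω))
      exact sup_le (h2 q) (iSup₂_le fun r _ => h2 r)
    · refine iSup_le fun k => Measurable.comap_le ?_
      exact (measurable_pi_apply k).comp (comap_measurable (fun ω k => v k ω))

theorem integral_comp_delay [IsProbabilityMeasure Pr] (hχ : IsDelayProcess ch Pr χ) (l : Fin m) (n : ℕ)
    (f : Fin (ch.dmax l + 1) → ℝ) : ∫ ω, f (χ l n ω) ∂Pr = ∑ c, ch.prob l c * f c := by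
  have := Measure.isProbabilityMeasure_map (μ := Pr) (hχ.meas l n).aemeasurable
  rw [← integral_map (hχ.meas l n).aemeasurable (measurable_of_countable f).aestronglyMeasurable,
    integral_fintype (Integrable.of_finite)]
  refine Finset.sum_congr rfl fun c _ => ?_
  rw [measureReal_def, Measure.map_apply (hχ.meas l n) (measurableSet_singleton c), hχ.law,
    ENNReal.toReal_ofReal (ch.prob_nonneg l c), smul_eq_mul]

theorem integral_delay_mul [IsProbabilityMeasure Pr] (hχ : IsDelayProcess ch Pr χ) (hv : IsWhiteNoise Pr v)
    (hvχ : IndepFun (fun ω k => v k ω) (fun ω i k => χ i k ω) Pr) (l : Fin m) (n : ℕ)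
    (f : Fin (ch.dmax l + 1) → ℝ) {Z : Ω → ℝ} (hZ : Measurable[rest χ v (l, n)] Z) :
    ∫ ω, f (χ l n ω) * Z ω ∂Pr = (∑ c, ch.prob l c * f c) * ∫ ω, Z ω ∂Pr := by
  have hind : IndepFun (χ l n) Z Pr :=
    indep_of_indep_of_le_right (indep_delay_rest hχ hv hvχ (l, n)) hZ.comap_le
  have hZ' : Measurable Z := hZ.mono (rest_le hχ hv _) le_rfl
  rw [← integral_comp_delay hχ l n f]
  exact hind.integral_fun_comp_mul_comp (g := id) (hχ.meas l n).aemeasurable hZ'.aemeasurable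
    (measurable_of_countable f).aestronglyMeasurable measurable_id.aestronglyMeasurable

theorem memLp_input (hv : IsWhiteNoise Pr v) (F : TM m) (k : ℕ) (i : Fin m) :
    MemLp (fun ω => ∑ n ∈ Finset.range k, ∑ l, impulse (F i l) (k - n) * v n ω l) 2 Pr :=
  memLp_finsetSum _ fun n _ => memLp_finsetSum _ fun l _ => (hv.sq_integrable n l).const_mul _

theorem memLp_signal (hχ : IsDelayProcess ch Pr χ) (hv : IsWhiteNoise Pr v)
    (hu : IsRecursion ch F χ v u) (k : ℕ) (i : Fin m) : MemLp (fun ω => u k ω i) 2 Pr := by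
  induction k using Nat.strong_induction_on generalizing i with
  | _ k ih =>
    have h1 : (fun ω => u k ω i) = fun ω =>
      (∑ n ∈ Finset.range k, ∑ l, impulse (F i l) (k - n) * v n ω l) -
      ∑ n ∈ Finset.range k, ∑ l, kap ch F i l (χ l n ω) (k - n) * u n ω l := by
      ext ω
      exact hu k ω i
    rw [h1]
    refine (memLp_input hv F k i).sub ?_
    refine memLp_finsetSum _ fun n hn => memLp_finsetSum _ fun l _ => ?_
    exact memLp_comp_mul (hχ.meas l n) (fun c => kap ch F i l c (k - n))
      (ih n (Finset.mem_range.1 hn) l)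

/-- The mean energy at lag `t` of the response of output `i` to the uncertainty in channel `l`. -/
def lagEnergy (ch : Channel m) (F : TM m) (i l : Fin m) (t : ℕ) : ℝ :=
  ∑ c, ch.prob l c * kap ch F i l c t ^ 2

theorem noise_orthogonal (hv : IsWhiteNoise Pr v) {n n' : ℕ} {l l' : Fin m}
    (h : (n, l) ≠ (n', l')) : ∫ ω, v n ω l * v n' ω l' ∂Pr = 0 := by
  by_cases hn : n = n'
  · subst hn
    exact hv.cov_diag n l l' fun hl => h (by rw [hl])
  · have hind := (hv.indep.indepFun hn).comp (measurable_pi_apply l) (measurable_pi_apply l')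
    have h1 := hind.integral_fun_mul_eq_mul_integral
      ((measurable_pi_apply l).comp (hv.meas n)).aestronglyMeasurable
      ((measurable_pi_apply l').comp (hv.meas n')).aestronglyMeasurable
    refine h1.trans ?_
    have h2 : ∫ ω, ((fun x : Fin m → ℝ => x l) ∘ v n) ω ∂Pr = 0 := hv.mean_zero n l
    rw [h2, zero_mul]

theorem integral_sq_noise (hv : IsWhiteNoise Pr v) (n : ℕ) (l : Fin m) :
    ∫ ω, v n ω l ^ 2 ∂Pr = ∫ ω, v 0 ω l ^ 2 ∂Pr := by
  have h1 := (hv.ident n).comp (u := fun x : Fin m → ℝ => x l ^ 2) (by fun_prop)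
  exact h1.integral_eq

theorem integral_sq_input (hv : IsWhiteNoise Pr v) (F : TM m) (k : ℕ) (i : Fin m) :
    ∫ ω, (∑ n ∈ Finset.range k, ∑ l, impulse (F i l) (k - n) * v n ω l) ^ 2 ∂Pr =
      ∑ n ∈ Finset.range k, ∑ l, impulse (F i l) (k - n) ^ 2 * ∫ ω, v 0 ω l ^ 2 ∂Pr := by
  have h1 := integral_sq_sub_sum (Pr := Pr) (Finset.range k ×ˢ (Finset.univ : Finset (Fin m)))
    (Y := fun _ => 0) (X := fun q ω => impulse (F i q.2) (k - q.1) * v q.1 ω q.2)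
    MemLp.zero (fun q _ => (hv.sq_integrable q.1 q.2).const_mul _) (by simp) ?_
  · simp only [zero_sub, neg_sq] at h1
    simp only [Finset.sum_product] at h1
    rw [h1]
    simp only [mul_pow, integral_const_mul, integral_sq_noise hv]
    simp
  · intro q _ r _ hqr
    have h2 : ∀ ω, impulse (F i q.2) (k - q.1) * v q.1 ω q.2 *
        (impulse (F i r.2) (k - r.1) * v r.1 ω r.2) =
        (impulse (F i q.2) (k - q.1) * impulse (F i r.2) (k - r.1)) *
          (v q.1 ω q.2 * v r.1 ω r.2) := fun ω => by ring
    simp only [h2]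
    rw [integral_const_mul, noise_orthogonal hv hqr, mul_zero]

/-- The second moments of the signals obey a deterministic Volterra recursion. -/
theorem integral_sq_signal [IsProbabilityMeasure Pr] (hF : MatIn rhSubring F) (hχ : IsDelayProcess ch Pr χ)
    (hv : IsWhiteNoise Pr v) (hvχ : IndepFun (fun ω k => v k ω) (fun ω i k => χ i k ω) Pr)
    (hu : IsRecursion ch F χ v u) (k : ℕ) (i : Fin m) : ∫ ω, u k ω i ^ 2 ∂Pr =
      (∑ n ∈ Finset.range k, ∑ l, impulse (F i l) (k - n) ^ 2 * ∫ ω, v 0 ω l ^ 2 ∂Pr) +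
      ∑ n ∈ Finset.range k, ∑ l, lagEnergy ch F i l (k - n) * ∫ ω, u n ω l ^ 2 ∂Pr := by
  have hL := memLp_signal hχ hv hu
  have h1 := integral_sq_sub_sum (Pr := Pr) (Finset.range k ×ˢ (Finset.univ : Finset (Fin m)))
    (Y := fun ω => ∑ n ∈ Finset.range k, ∑ l, impulse (F i l) (k - n) * v n ω l)
    (X := fun q ω => kap ch F i q.2 (χ q.2 q.1 ω) (k - q.1) * u q.1 ω q.2)
    (memLp_input hv F k i) (fun q _ => memLp_comp_mul (hχ.meas q.2 q.1)
      (fun c => kap ch F i q.2 c (k - q.1)) (hL q.1 q.2)) ?_ ?_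
  · simp only [Finset.sum_product] at h1
    simp only [fun ω => hu k ω i]
    rw [h1, integral_sq_input hv]
    congr 1
    refine Finset.sum_congr rfl fun n _ => Finset.sum_congr rfl fun l _ => ?_
    simp only [mul_pow]
    rw [integral_delay_mul hχ hv hvχ l n (fun c => kap ch F i l c (k - n) ^ 2)
      ((measurable_signal hu (l, n) n le_rfl l).pow_const 2)]
    rfl
  · rintro ⟨n, l⟩ _
    have h2 : ∀ ω, (∑ n ∈ Finset.range k, ∑ l, impulse (F i l) (k - n) * v n ω l) *
        (kap ch F i l (χ l n ω) (k - n) * u n ω l) = kap ch F i l (χ l n ω) (k - n) *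
        ((∑ n ∈ Finset.range k, ∑ l, impulse (F i l) (k - n) * v n ω l) * u n ω l) :=
      fun ω => by ring
    simp only [h2]
    rw [integral_delay_mul hχ hv hvχ l n (fun c => kap ch F i l c (k - n)), sum_prob_mul_kap hF,
      zero_mul]
    refine Measurable.mul ?_ (measurable_signal hu (l, n) n le_rfl l)
    exact Finset.measurable_sum _ fun n' _ => Finset.measurable_sum _ fun l' _ =>
      (measurable_noise χ v (l, n) n' l').const_mul _
  · have key : ∀ (n n' : ℕ) (l l' : Fin m), n' ≤ n → (l', n') ≠ (l, n) →
        ∫ ω, kap ch F i l (χ l n ω) (k - n) * u n ω l *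
          (kap ch F i l' (χ l' n' ω) (k - n') * u n' ω l') ∂Pr = 0 := by
      intro n n' l l' hn hne
      simp only [mul_assoc]
      rw [integral_delay_mul hχ hv hvχ l n (fun c => kap ch F i l c (k - n)), sum_prob_mul_kap hF,
        zero_mul]
      refine Measurable.mul (measurable_signal hu (l, n) n le_rfl l) (Measurable.mul ?_
        (measurable_signal hu (l, n) n' hn l'))
      exact (measurable_of_countable fun c => kap ch F i l' c (k - n')).comp
        (measurable_delay χ v hne)
    rintro ⟨n, l⟩ _ ⟨n', l'⟩ _ hne
    rcases le_total n' n with h | h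
    · exact key n n' l l' h fun h0 => hne (by simp_all)
    · simp only [mul_comm (kap ch F i l _ _ * _)]
      exact key n' n l' l h fun h0 => hne (by simp_all)

end Loop

end

section

/-! ### Nonnegative Volterra recursions -/

section Volterra

theorem sum_range_reflect_mul (k : ℕ) (f g : ℕ → ℝ) :
    ∑ n ∈ Finset.range k, f (k - n) * g n = ∑ t ∈ Finset.range k, f (t + 1) * g (k - 1 - t) := by
  rw [← Finset.sum_range_reflect]
  refine Finset.sum_congr rfl fun t ht => ?_
  have := Finset.mem_range.1 ht
  congr 2
  omega

theorem sum_range_lag_le {a : ℕ → ℝ} {A : ℝ} (ha : ∀ t, 0 ≤ a t) (h : HasSum a A) (k : ℕ) :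
    ∑ n ∈ Finset.range k, a (k - n) ≤ A := by
  have h1 := sum_range_reflect_mul k a fun _ => 1
  simp only [mul_one] at h1
  rw [h1]
  have h2 := sum_le_hasSum (Finset.range (k + 1)) (fun t _ => ha t) h
  rw [Finset.sum_range_succ'] at h2
  linarith [ha 0]

theorem tendsto_sum_range_succ {a : ℕ → ℝ} {A : ℝ} (h0 : a 0 = 0) (h : HasSum a A) :
    Filter.Tendsto (fun T => ∑ t ∈ Finset.range T, a (t + 1)) Filter.atTop (nhds A) := by
  refine (((Filter.tendsto_add_atTop_iff_nat 1).2 h.tendsto_sum_nat)).congr fun T => ?_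
  rw [Finset.sum_range_succ', h0, add_zero]

variable {m : ℕ} {a : Fin m → Fin m → ℕ → ℝ} {J : Matrix (Fin m) (Fin m) ℝ}
  {x y : ℕ → Fin m → ℝ}

theorem volterra_le (ha : ∀ i l t, 0 ≤ a i l t) (haJ : ∀ i l, HasSum (a i l) (J i l))
    {Y : Fin m → ℝ} (hY : ∀ k i, y k i ≤ Y i)
    (hx : ∀ k i, x k i = y k i + ∑ n ∈ Finset.range k, ∑ l, a i l (k - n) * x n l)
    (hJ : specRad J < 1) : ∃ c : ℝ, ∀ k i, x k i ≤ c := by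
  have hJ0 : ∀ i l, 0 ≤ J i l := fun i l => (haJ i l).nonneg (ha i l)
  obtain ⟨w, hw, hJw⟩ := exists_pos_mulVec_le hJ0 hJ
  simp only [one_mul] at hJw
  set b : ℝ := ∑ i, |Y i| / (w i - (J *ᵥ w) i) with hb
  have hgap : ∀ i, 0 < w i - (J *ᵥ w) i := fun i => sub_pos.2 (hJw i)
  have hterm : ∀ i, 0 ≤ |Y i| / (w i - (J *ᵥ w) i) := fun i => div_nonneg (abs_nonneg _) (hgap i).le
  have hb0 : 0 ≤ b := Finset.sum_nonneg fun i _ => hterm i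
  have hYb : ∀ i, Y i ≤ b * (w i - (J *ᵥ w) i) := by
    intro i
    have h1 : |Y i| / (w i - (J *ᵥ w) i) ≤ b :=
      Finset.single_le_sum (f := fun i => |Y i| / (w i - (J *ᵥ w) i)) (fun i _ => hterm i)
        (Finset.mem_univ i)
    rw [div_le_iff₀ (hgap i)] at h1
    exact (le_abs_self _).trans h1
  have key : ∀ k i, x k i ≤ b * w i := by
    intro k
    induction k using Nat.strong_induction_on with
    | _ k ih =>
      intro i
      have h1 : ∑ n ∈ Finset.range k, ∑ l, a i l (k - n) * x n l ≤ ∑ l, J i l * (b * w l) := by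
        rw [Finset.sum_comm]
        refine Finset.sum_le_sum fun l _ => ?_
        calc ∑ n ∈ Finset.range k, a i l (k - n) * x n l
            ≤ ∑ n ∈ Finset.range k, a i l (k - n) * (b * w l) :=
              Finset.sum_le_sum fun n hn => mul_le_mul_of_nonneg_left
                (ih n (Finset.mem_range.1 hn) l) (ha i l _)
          _ = (∑ n ∈ Finset.range k, a i l (k - n)) * (b * w l) :=
              (Finset.sum_mul _ _ _).symm
          _ ≤ J i l * (b * w l) := mul_le_mul_of_nonneg_right
              (sum_range_lag_le (ha i l) (haJ i l) k) (mul_nonneg hb0 (hw l).le)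
      have h2 : ∑ l, J i l * (b * w l) = b * (J *ᵥ w) i := by
        rw [Matrix.mulVec, dotProduct, Finset.mul_sum]
        exact Finset.sum_congr rfl fun l _ => by ring
      rw [hx]
      have := hY k i
      have := hYb i
      linarith
  refine ⟨∑ i, b * w i, fun k i => (key k i).trans ?_⟩
  exact Finset.single_le_sum (f := fun i => b * w i) (fun i _ => mul_nonneg hb0 (hw i).le)
    (Finset.mem_univ i)

variable {g : Fin m → ℕ → ℝ} {G : Fin m → ℝ}

theorem volterra_mono (ha : ∀ i l t, 0 ≤ a i l t) (hg : ∀ i t, 0 ≤ g i t) (hx0 : ∀ k i, 0 ≤ x k i)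
    (hx : ∀ k i, x k i = ∑ t ∈ Finset.range k, g i (t + 1) +
      ∑ l, ∑ t ∈ Finset.range k, a i l (t + 1) * x (k - 1 - t) l) (k : ℕ) (i : Fin m) :
    x k i ≤ x (k + 1) i := by
  induction k using Nat.strong_induction_on generalizing i with
  | _ k ih =>
    rw [hx k, hx (k + 1)]
    refine add_le_add ?_ (Finset.sum_le_sum fun l _ => ?_)
    · rw [Finset.sum_range_succ]
      exact le_add_of_nonneg_right (hg i _)
    · rw [Finset.sum_range_succ]
      refine le_add_of_le_of_nonneg (Finset.sum_le_sum fun t ht => ?_)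
        (mul_nonneg (ha i l _) (hx0 _ l))
      refine mul_le_mul_of_nonneg_left ?_ (ha i l _)
      have ht' := Finset.mem_range.1 ht
      have h1 := ih (k - 1 - t) (by omega) l
      rwa [show k - 1 - t + 1 = k + 1 - 1 - t by omega] at h1

/-- A bounded nonnegative solution of a Volterra recursion dominates a supersolution. -/
theorem exists_supersolution (ha : ∀ i l t, 0 ≤ a i l t) (ha0 : ∀ i l, a i l 0 = 0)
    (haJ : ∀ i l, HasSum (a i l) (J i l)) (hg : ∀ i t, 0 ≤ g i t) (hg0 : ∀ i, g i 0 = 0)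
    (hgG : ∀ i, HasSum (g i) (G i)) (hx0 : ∀ k i, 0 ≤ x k i) {c : ℝ} (hc : ∀ k i, x k i ≤ c)
    (hx : ∀ k i, x k i = ∑ n ∈ Finset.range k, g i (k - n) +
      ∑ n ∈ Finset.range k, ∑ l, a i l (k - n) * x n l) :
    ∃ w : Fin m → ℝ, (∀ i, 0 ≤ w i) ∧ ∀ i, G i + (J *ᵥ w) i ≤ w i := by
  have hx' : ∀ k i, x k i = ∑ t ∈ Finset.range k, g i (t + 1) +
      ∑ l, ∑ t ∈ Finset.range k, a i l (t + 1) * x (k - 1 - t) l := by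
    intro k i
    have h1 := sum_range_reflect_mul k (g i) fun _ => 1
    simp only [mul_one] at h1
    rw [hx, h1, Finset.sum_comm]
    congr 1
    exact Finset.sum_congr rfl fun l _ => sum_range_reflect_mul k (a i l) fun n => x n l
  have hmono : ∀ i, Monotone fun k => x k i := fun i =>
    monotone_nat_of_le_succ fun k => volterra_mono ha hg hx0 hx' k i
  have hbdd : ∀ i, BddAbove (Set.range fun k => x k i) := fun i => ⟨c, by
    rintro _ ⟨k, rfl⟩
    exact hc k i⟩
  have hlim : ∀ i, Filter.Tendsto (fun k => x k i) Filter.atTop (nhds (⨆ k, x k i)) := fun i =>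
    tendsto_atTop_ciSup (hmono i) (hbdd i)
  refine ⟨fun i => ⨆ k, x k i, fun i => (hx0 0 i).trans (le_ciSup (hbdd i) 0), fun i => ?_⟩
  have hT : ∀ T : ℕ, ∑ t ∈ Finset.range T, g i (t + 1) +
      ∑ l, (∑ t ∈ Finset.range T, a i l (t + 1)) * (⨆ k, x k l) ≤ ⨆ k, x k i := by
    intro T
    have h1 : Filter.Tendsto (fun k => ∑ t ∈ Finset.range T, g i (t + 1) +
        ∑ l, ∑ t ∈ Finset.range T, a i l (t + 1) * x (k - 1 - t) l) Filter.atTop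
        (nhds (∑ t ∈ Finset.range T, g i (t + 1) +
          ∑ l, ∑ t ∈ Finset.range T, a i l (t + 1) * (⨆ k, x k l))) := by
      refine Filter.Tendsto.const_add _ (tendsto_finsetSum _ fun l _ =>
        tendsto_finsetSum _ fun t _ => Filter.Tendsto.const_mul _ ?_)
      refine (hlim l).comp ?_
      refine Filter.tendsto_atTop.2 fun b => ?_
      filter_upwards [Filter.eventually_ge_atTop (b + 1 + t)] with k hk
      omega
    simp only [Finset.sum_mul]
    refine le_of_tendsto h1 ?_
    filter_upwards [Filter.eventually_ge_atTop T] with k hk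
    refine le_trans ?_ (le_ciSup (hbdd i) k)
    simp only [hx' k i]
    have hsub : Finset.range T ⊆ Finset.range k := Finset.range_mono hk
    refine add_le_add ?_ (Finset.sum_le_sum fun l _ => ?_)
    · exact Finset.sum_le_sum_of_subset_of_nonneg hsub fun t _ _ => hg i _
    · exact Finset.sum_le_sum_of_subset_of_nonneg hsub fun t _ _ => mul_nonneg (ha i l _) (hx0 _ l)
  refine le_of_tendsto' (f := fun T => ∑ t ∈ Finset.range T, g i (t + 1) +
      ∑ l, (∑ t ∈ Finset.range T, a i l (t + 1)) * (⨆ k, x k l)) (x := Filter.atTop) ?_ hT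
  refine (tendsto_sum_range_succ (hg0 i) (hgG i)).add ?_
  rw [Matrix.mulVec, dotProduct]
  exact tendsto_finsetSum _ fun l _ => (tendsto_sum_range_succ (ha0 i l) (haJ i l)).mul_const _

theorem specRad_lt_one_of_supersolution (hJ : ∀ i l, 0 ≤ J i l) (hG : ∀ i, 0 ≤ G i)
    (hGJ : ∀ i, G i = 0 → ∀ l, J i l = 0) {w : Fin m → ℝ} (hw : ∀ i, 0 ≤ w i)
    (h : ∀ i, G i + (J *ᵥ w) i ≤ w i) : specRad J < 1 := by
  have hev : ∀ᶠ δ in nhdsWithin (0 : ℝ) (Set.Ioi 0), ∀ i, 0 < G i → δ * ∑ l, J i l < G i := by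
    refine Filter.eventually_all.2 fun i => ?_
    by_cases hGi : 0 < G i
    · have h1 : Filter.Tendsto (fun δ : ℝ => δ * ∑ l, J i l) (nhdsWithin 0 (Set.Ioi 0))
          (nhds (0 * ∑ l, J i l)) :=
        (Filter.Tendsto.mul_const _ Filter.tendsto_id).mono_left nhdsWithin_le_nhds
      rw [zero_mul] at h1
      filter_upwards [h1.eventually_lt_const hGi] with δ hδ _
      exact hδ
    · exact Filter.Eventually.of_forall fun δ h0 => absurd h0 hGi
  obtain ⟨δ, hδ, hδ0⟩ := (hev.and self_mem_nhdsWithin).exists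
  have hδ0 : 0 < δ := hδ0
  refine specRad_lt_one_of_mulVec_lt hJ (w := fun i => w i + δ)
    (fun i => add_pos_of_nonneg_of_pos (hw i) hδ0) fun i => ?_
  have h1 : (J *ᵥ fun i => w i + δ) i = (J *ᵥ w) i + δ * ∑ l, J i l := by
    simp only [Matrix.mulVec, dotProduct, mul_add, Finset.sum_add_distrib, Finset.mul_sum]
    congr 1
    exact Finset.sum_congr rfl fun l _ => mul_comm _ _
  rw [h1]
  rcases (hG i).eq_or_lt with h0 | h0
  · have h2 : (J *ᵥ w) i = 0 := by
      simp [Matrix.mulVec, dotProduct, hGJ i h0.symm]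
    rw [h2, Finset.sum_eq_zero fun l _ => hGJ i h0.symm l]
    linarith [hw i]
  · linarith [h i, hδ i h0]

end Volterra

/-! ### Existence of the random processes -/

section Sampling

variable {m : ℕ} (ch : Channel m)

/-- The law of a delay. -/
def delayLaw (i : Fin m) : Measure (Fin (ch.dmax i + 1)) :=
  ∑ j, ENNReal.ofReal (ch.prob i j) • Measure.dirac j

theorem delayLaw_singleton (i : Fin m) (j : Fin (ch.dmax i + 1)) :
    delayLaw ch i {j} = ENNReal.ofReal (ch.prob i j) := by
  rw [delayLaw, Measure.finsetSum_apply, Finset.sum_eq_single j]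
  · simp
  · intro k _ hk
    simp [hk]
  · simp

instance (i : Fin m) : IsProbabilityMeasure (delayLaw ch i) := ⟨by
  rw [delayLaw, Measure.finsetSum_apply]
  simp only [Measure.smul_apply, measure_univ, smul_eq_mul, mul_one]
  rw [← ENNReal.ofReal_sum_of_nonneg fun j _ => ch.prob_nonneg i j, ch.prob_sum, ENNReal.ofReal_one]⟩

/-- Sample space of the delays and of the noise. -/
abbrev Sample : Type := ((q : Fin m × ℕ) → Fin (ch.dmax q.1 + 1)) × (ℕ → Fin m → ℝ)

/-- Independent delays and independent standard normal noise. -/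
def sampleLaw : Measure (Sample ch) :=
  (Measure.infinitePi fun q : Fin m × ℕ => delayLaw ch q.1).prod
    (Measure.infinitePi fun _ : ℕ => Measure.pi fun _ : Fin m => gaussianReal 0 1)

instance : IsProbabilityMeasure (sampleLaw ch) := by
  rw [sampleLaw]
  infer_instance

theorem measurePreserving_delay (q : Fin m × ℕ) :
    MeasurePreserving (fun ω : Sample ch => ω.1 q) (sampleLaw ch) (delayLaw ch q.1) :=
  (measurePreserving_eval_infinitePi (fun q : Fin m × ℕ => delayLaw ch q.1) q).comp
    measurePreserving_fst

theorem measurePreserving_noise (k : ℕ) :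
    MeasurePreserving (fun ω : Sample ch => ω.2 k) (sampleLaw ch)
      (Measure.pi fun _ : Fin m => gaussianReal 0 1) :=
  (measurePreserving_eval_infinitePi (fun _ : ℕ => Measure.pi fun _ : Fin m => gaussianReal 0 1)
    k).comp measurePreserving_snd

theorem measurePreserving_noise_apply (k : ℕ) (i : Fin m) :
    MeasurePreserving (fun ω : Sample ch => ω.2 k i) (sampleLaw ch) (gaussianReal 0 1) :=
  (measurePreserving_eval (fun _ : Fin m => gaussianReal 0 1) i).comp (measurePreserving_noise ch k)

theorem isDelayProcess_sample :
    IsDelayProcess ch (sampleLaw ch) fun i k (ω : Sample ch) => ω.1 (i, k) where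
  meas i k := (measurePreserving_delay ch (i, k)).measurable
  indep := by
    rw [iIndepFun_iff_map_fun_eq_infinitePi_map
      fun q => (measurePreserving_delay ch q).measurable]
    simp only [fun q : Fin m × ℕ => (measurePreserving_delay ch (q.1, q.2)).map_eq]
    exact measurePreserving_fst.map_eq
  law i k j := by
    rw [(measurePreserving_delay ch (i, k)).measure_preimage
      (measurableSet_singleton j).nullMeasurableSet, delayLaw_singleton]

theorem integral_comp_of_measurePreserving {α β : Type*} [MeasurableSpace α] [MeasurableSpace β]
    {μ : Measure α} {ν : Measure β} {f : α → β} (hf : MeasurePreserving f μ ν) {g : β → ℝ}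
    (hg : Measurable g) : ∫ ω, g (f ω) ∂μ = ∫ x, g x ∂ν := by
  rw [← hf.map_eq, integral_map hf.measurable.aemeasurable hg.aestronglyMeasurable]

theorem integral_sq_gaussian : ∫ x, x ^ 2 ∂(gaussianReal 0 1) = 1 := by
  have h1 := variance_fun_id_gaussianReal (μ := 0) (v := 1)
  rw [variance_eq_integral measurable_id'.aemeasurable] at h1
  simpa using h1

theorem isWhiteNoise_sample : IsWhiteNoise (sampleLaw ch) fun k (ω : Sample ch) => ω.2 k where
  meas k := (measurePreserving_noise ch k).measurable
  indep := by
    rw [iIndepFun_iff_map_fun_eq_infinitePi_map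
      fun k => (measurePreserving_noise ch k).measurable]
    simp only [fun k : ℕ => (measurePreserving_noise ch k).map_eq]
    exact measurePreserving_snd.map_eq
  ident k := ⟨(measurePreserving_noise ch k).measurable.aemeasurable,
    (measurePreserving_noise ch 0).measurable.aemeasurable, by
      rw [(measurePreserving_noise ch k).map_eq, (measurePreserving_noise ch 0).map_eq]⟩
  sq_integrable k i :=
    (memLp_id_gaussianReal' 2 (by simp)).comp_measurePreserving
      (measurePreserving_noise_apply ch k i)
  mean_zero k i := by
    have h1 := integral_comp_of_measurePreserving (measurePreserving_noise_apply ch k i)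
      (g := fun x => x) measurable_id
    rw [h1, integral_id_gaussianReal]
  cov_diag k i j hij := by
    have h1 := integral_comp_of_measurePreserving (measurePreserving_noise ch k)
      (g := fun x => x i * x j) (by fun_prop)
    have h2 := (iIndepFun_pi (μ := fun _ : Fin m => gaussianReal 0 1) (X := fun _ x => x)
      fun _ => measurable_id.aemeasurable).indepFun hij
    have h3 := integral_comp_of_measurePreserving
      (measurePreserving_eval (fun _ : Fin m => gaussianReal 0 1) i) (g := fun x => x) measurable_id
    rw [h1, h2.integral_fun_mul_eq_mul_integral (measurable_pi_apply i).aestronglyMeasurable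
      (measurable_pi_apply j).aestronglyMeasurable]
    have h4 : ∫ x : Fin m → ℝ, x i ∂(Measure.pi fun _ : Fin m => gaussianReal 0 1) = 0 :=
      h3.trans integral_id_gaussianReal
    rw [h4, zero_mul]

theorem integral_sq_noise_sample (k : ℕ) (i : Fin m) :
    ∫ ω : Sample ch, ω.2 k i ^ 2 ∂(sampleLaw ch) = 1 :=
  (integral_comp_of_measurePreserving (measurePreserving_noise_apply ch k i)
    (g := fun x => x ^ 2) (by fun_prop)).trans integral_sq_gaussian

theorem indep_sample : IndepFun (fun (ω : Sample ch) (k : ℕ) => ω.2 k)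
    (fun (ω : Sample ch) (i : Fin m) (k : ℕ) => ω.1 (i, k)) (sampleLaw ch) := by
  have h1 : IndepFun (fun ω : Sample ch => ω.1) (fun ω : Sample ch => ω.2) (sampleLaw ch) :=
    indepFun_prod (X := id) (Y := id) measurable_id measurable_id
  have h2 : Measurable fun (x : (q : Fin m × ℕ) → Fin (ch.dmax q.1 + 1)) (i : Fin m) (k : ℕ) =>
      x (i, k) :=
    measurable_pi_lambda _ fun i => measurable_pi_lambda _ fun k => measurable_pi_apply (i, k)
  exact (h1.comp h2 measurable_id).symm

end Sampling

end

section

/-! ### Mean-square stability and the spectral radius -/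

section MeanSquare

variable {m : ℕ} {ch : Channel m} {F : TM m} {Φ : Fin m → ℝ[X]}

theorem lagEnergy_nonneg (ch : Channel m) (F : TM m) (i l : Fin m) (t : ℕ) :
    0 ≤ lagEnergy ch F i l t :=
  Finset.sum_nonneg fun c _ => mul_nonneg (ch.prob_nonneg l c) (sq_nonneg _)

theorem lagEnergy_zero (hF : MatIn rhSubring F) (hF0 : ∀ i j, impulse (F i j) 0 = 0)
    (i l : Fin m) : lagEnergy ch F i l 0 = 0 := by
  simp [lagEnergy, kap_zero hF hF0]

theorem hasSum_lagEnergy (hΦ : ch.IsSpectralFactor Φ) (hF : MatIn rhSubring F) (i l : Fin m) :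
    HasSum (lagEnergy ch F i l) (h2sq (F i l * inZInv (Φ l))) := by
  rw [h2sq_mul_spectralFactor hΦ l (hF i l)]
  exact hasSum_sum fun c _ => (hasSum_sq_impulse (mem_rhSubring.1
    (rhSubring.mul_mem (hF i l) (inZInv_mem_rh _)))).mul_left _

/-- The energy gains from the uncertainties to the control signals. -/
def gainMat (F : TM m) (Φ : Fin m → ℝ[X]) : Matrix (Fin m) (Fin m) ℝ :=
  Matrix.of fun i l => h2sq (F i l * inZInv (Φ l))

variable {Ω : Type} [MeasurableSpace Ω] {Pr : Measure Ω}
  {χ : (i : Fin m) → ℕ → Ω → Fin (ch.dmax i + 1)} {v e u d : ℕ → Ω → Fin m → ℝ}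

theorem boundedVariance_of_integral_le {x : ℕ → Ω → Fin m → ℝ}
    (hx : ∀ k i, MemLp (fun ω => x k ω i) 2 Pr) {c : ℝ} (hc : ∀ k i, ∫ ω, x k ω i ^ 2 ∂Pr ≤ c) :
    BoundedVariance Pr x := by
  refine ⟨c.toNNReal, fun k i => ?_⟩
  rw [lintegral_enorm_sq (hx k i)]
  exact ENNReal.ofReal_le_ofReal (hc k i)

theorem exists_integral_sq_le [IsProbabilityMeasure Pr] (hΦ : ch.IsSpectralFactor Φ)
    (hF : MatIn rhSubring F) (hJ : specRad (gainMat F Φ) < 1) (hχ : IsDelayProcess ch Pr χ)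
    (hv : IsWhiteNoise Pr v) (hvχ : IndepFun (fun ω k => v k ω) (fun ω i k => χ i k ω) Pr)
    (hu : IsRecursion ch F χ v u) : ∃ c : ℝ, ∀ k i, ∫ ω, u k ω i ^ 2 ∂Pr ≤ c := by
  refine volterra_le (a := lagEnergy ch F) (J := gainMat F Φ) (lagEnergy_nonneg ch F)
    (hasSum_lagEnergy hΦ hF) (Y := fun i => ∑ l, h2sq (F i l) * ∫ ω, v 0 ω l ^ 2 ∂Pr) ?_
    (integral_sq_signal hF hχ hv hvχ hu) hJ
  intro k i
  rw [Finset.sum_comm]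
  refine Finset.sum_le_sum fun l _ => ?_
  rw [← Finset.sum_mul]
  exact mul_le_mul_of_nonneg_right (sum_range_lag_le (fun t => sq_nonneg _)
    (hasSum_sq_impulse (mem_rhSubring.1 (hF i l))) k) (integral_nonneg fun ω => sq_nonneg _)

theorem IsClosedLoop.memLp_unc (h : IsClosedLoop ch F χ v e u d) (hχ : IsDelayProcess ch Pr χ)
    (hL : ∀ k i, MemLp (fun ω => u k ω i) 2 Pr) (k : ℕ) (i : Fin m) :
    MemLp (fun ω => d k ω i) 2 Pr := by
  simp only [h.unc]
  refine memLp_finsetSum _ fun j _ => ?_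
  split_ifs
  · exact memLp_comp_mul (hχ.meas i _) (fun c => ch.h i j c - ch.mean i j) (hL _ i)
  · exact MemLp.zero

theorem IsClosedLoop.integral_sq_unc_le [IsProbabilityMeasure Pr]
    (h : IsClosedLoop ch F χ v e u d) (hχ : IsDelayProcess ch Pr χ) (hv : IsWhiteNoise Pr v)
    (hvχ : IndepFun (fun ω k => v k ω) (fun ω i k => χ i k ω) Pr) (hu : IsRecursion ch F χ v u)
    {c : ℝ} (hc : ∀ k i, ∫ ω, u k ω i ^ 2 ∂Pr ≤ c) (k : ℕ) (i : Fin m) :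
    ∫ ω, d k ω i ^ 2 ∂Pr ≤ (ch.dmax i + 1) * ∑ j, ch.cov i j j * c := by
  have hL := memLp_signal hχ hv hu
  have hcov : ∀ j, 0 ≤ ch.cov i j j := fun j =>
    Finset.sum_nonneg fun c _ => mul_nonneg (ch.prob_nonneg i c) (mul_self_nonneg _)
  have hc0 : 0 ≤ c := (integral_nonneg fun ω => sq_nonneg (u 0 ω i)).trans (hc 0 i)
  set f : Fin (ch.dmax i + 1) → Ω → ℝ := fun j ω =>
    if (j : ℕ) ≤ k then (ch.h i j (χ i (k - j) ω) - ch.mean i j) * u (k - j) ω i else 0 with hf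
  have hfL : ∀ j, MemLp (f j) 2 Pr := by
    intro j
    rw [hf]
    dsimp only
    split_ifs
    · exact memLp_comp_mul (hχ.meas i _) (fun c => ch.h i j c - ch.mean i j) (hL _ i)
    · exact MemLp.zero
  have h1 : ∫ ω, d k ω i ^ 2 ∂Pr ≤ ∫ ω, (ch.dmax i + 1) * ∑ j, f j ω ^ 2 ∂Pr := by
    refine integral_mono (h.memLp_unc hχ hL k i).integrable_sq
      ((integrable_finsetSum _ fun j _ => (hfL j).integrable_sq).const_mul _) fun ω => ?_
    have := sq_sum_le_card_mul_sum_sq (s := Finset.univ) (f := fun j => f j ω)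
    rw [Finset.card_univ, Fintype.card_fin] at this
    simp only [h.unc]
    exact_mod_cast this
  refine h1.trans ?_
  rw [integral_const_mul, integral_finsetSum _ fun j _ => (hfL j).integrable_sq]
  refine mul_le_mul_of_nonneg_left (Finset.sum_le_sum fun j _ => ?_) (by positivity)
  by_cases hj : (j : ℕ) ≤ k
  · have h2 : ∀ ω, f j ω ^ 2 = (ch.h i j (χ i (k - j) ω) - ch.mean i j) ^ 2 *
        u (k - j) ω i ^ 2 := fun ω => by rw [hf]; simp only [if_pos hj, mul_pow]
    simp only [h2]
    rw [integral_delay_mul hχ hv hvχ i (k - j) (fun c => (ch.h i j c - ch.mean i j) ^ 2)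
      ((measurable_signal hu (i, k - j) (k - j) le_rfl i).pow_const 2)]
    have h3 : ∑ c, ch.prob i c * (ch.h i j c - ch.mean i j) ^ 2 = ch.cov i j j := by
      simp only [Channel.cov, sq]
    rw [h3]
    exact mul_le_mul_of_nonneg_left (hc _ i) (hcov j)
  · have h2 : ∀ ω, f j ω ^ 2 = 0 := fun ω => by rw [hf]; simp [if_neg hj]
    simp only [h2, integral_zero]
    exact mul_nonneg (hcov j) hc0

theorem boundedVariance_of_specRad_lt_one [IsProbabilityMeasure Pr] (hΦ : ch.IsSpectralFactor Φ)
    (hF : MatIn rhSubring F) (hF0 : ∀ i j, impulse (F i j) 0 = 0)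
    (hJ : specRad (gainMat F Φ) < 1) (hχ : IsDelayProcess ch Pr χ) (hv : IsWhiteNoise Pr v)
    (hvχ : IndepFun (fun ω k => v k ω) (fun ω i k => χ i k ω) Pr)
    (h : IsClosedLoop ch F χ v e u d) : BoundedVariance Pr e ∧ BoundedVariance Pr u := by
  have hu := h.isRecursion hF hF0
  have hL := memLp_signal hχ hv hu
  obtain ⟨c, hc⟩ := exists_integral_sq_le hΦ hF hJ hχ hv hvχ hu
  refine ⟨?_, boundedVariance_of_integral_le hL hc⟩
  have hdL := h.memLp_unc hχ hL
  have heL : ∀ k i, MemLp (fun ω => e k ω i) 2 Pr := by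
    intro k i
    simp only [h.err]
    exact (hv.sq_integrable k i).sub (hdL k i)
  have hbound : ∀ k i, ∫ ω, e k ω i ^ 2 ∂Pr ≤ 2 * ∫ ω, v 0 ω i ^ 2 ∂Pr +
      2 * ((ch.dmax i + 1) * ∑ j, ch.cov i j j * c) := by
    intro k i
    have h1 : ∫ ω, e k ω i ^ 2 ∂Pr ≤ ∫ ω, (2 * v k ω i ^ 2 + 2 * d k ω i ^ 2) ∂Pr := by
      refine integral_mono (heL k i).integrable_sq
        (((hv.sq_integrable k i).integrable_sq.const_mul 2).add
          ((hdL k i).integrable_sq.const_mul 2)) fun ω => ?_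
      simp only [h.err]
      nlinarith [sq_nonneg (v k ω i + d k ω i)]
    rw [integral_add ((hv.sq_integrable k i).integrable_sq.const_mul 2)
      ((hdL k i).integrable_sq.const_mul 2), integral_const_mul, integral_const_mul,
      integral_sq_noise hv] at h1
    have h2 := h.integral_sq_unc_le hχ hv hvχ hu hc k i
    linarith
  refine boundedVariance_of_integral_le heL (c := ∑ i, |2 * ∫ ω, v 0 ω i ^ 2 ∂Pr +
      2 * ((ch.dmax i + 1) * ∑ j, ch.cov i j j * c)|) fun k i => ?_
  refine (hbound k i).trans ((le_abs_self _).trans ?_)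
  exact Finset.single_le_sum (f := fun i => |2 * ∫ ω, v 0 ω i ^ 2 ∂Pr +
      2 * ((ch.dmax i + 1) * ∑ j, ch.cov i j j * c)|) (fun i _ => abs_nonneg _) (Finset.mem_univ i)

theorem specRad_lt_one_of_boundedVariance (hΦ : ch.IsSpectralFactor Φ)
    (hF : MatIn rhSubring F) (hF0 : ∀ i j, impulse (F i j) 0 = 0)
    (h : ∀ e u d : ℕ → Sample ch → Fin m → ℝ,
      IsClosedLoop ch F (fun i k ω => ω.1 (i, k)) (fun k ω => ω.2 k) e u d →
        BoundedVariance (sampleLaw ch) u) : specRad (gainMat F Φ) < 1 := by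
  have hχ := isDelayProcess_sample ch
  have hv := isWhiteNoise_sample ch
  have hvχ := indep_sample ch
  obtain ⟨e, u, d, hcl⟩ := exists_closedLoop hF hF0 (fun i k (ω : Sample ch) => ω.1 (i, k))
    (fun k ω => ω.2 k)
  have hu := hcl.isRecursion hF hF0
  have hL := memLp_signal hχ hv hu
  obtain ⟨c, hc⟩ := h e u d hcl
  have hcu : ∀ k i, ∫ ω, u k ω i ^ 2 ∂(sampleLaw ch) ≤ c := by
    intro k i
    have h1 := hc k i
    rw [lintegral_enorm_sq (hL k i)] at h1
    exact (ENNReal.ofReal_le_iff_le_toReal ENNReal.coe_ne_top).1 h1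
  have hJ0 : ∀ i l, 0 ≤ gainMat F Φ i l := fun i l => h2sq_nonneg _
  have hsq : ∀ i l, HasSum (fun t => impulse (F i l) t ^ 2) (h2sq (F i l)) := fun i l =>
    hasSum_sq_impulse (mem_rhSubring.1 (hF i l))
  obtain ⟨w, hw0, hw⟩ := exists_supersolution (a := lagEnergy ch F) (J := gainMat F Φ)
    (g := fun i t => ∑ l, impulse (F i l) t ^ 2) (G := fun i => ∑ l, h2sq (F i l))
    (x := fun k i => ∫ ω, u k ω i ^ 2 ∂(sampleLaw ch)) (lagEnergy_nonneg ch F)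
    (lagEnergy_zero hF hF0) (hasSum_lagEnergy hΦ hF)
    (fun i t => Finset.sum_nonneg fun l _ => sq_nonneg _) (fun i => by simp [hF0])
    (fun i => hasSum_sum fun l _ => hsq i l)
    (fun k i => integral_nonneg fun ω => sq_nonneg _) hcu fun k i => by
      have h1 := integral_sq_signal hF hχ hv hvχ hu k i
      simp only [integral_sq_noise_sample, mul_one] at h1
      exact h1
  refine specRad_lt_one_of_supersolution (G := fun i => ∑ l, h2sq (F i l)) hJ0
    (fun i => Finset.sum_nonneg fun l _ => h2sq_nonneg _) (fun i hi l => ?_) hw0 hw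
  have h1 : h2sq (F i l) = 0 :=
    (Finset.sum_eq_zero_iff_of_nonneg fun l _ => h2sq_nonneg _).1 hi l (Finset.mem_univ l)
  have h2 : ∀ t, impulse (F i l) t = 0 := by
    intro t
    have h3 := hsq i l
    rw [h1, hasSum_zero_iff_of_nonneg fun t => sq_nonneg _] at h3
    exact pow_eq_zero_iff two_ne_zero |>.1 (congrFun h3 t)
  have h4 : lagEnergy ch F i l = 0 := by
    ext t
    simp [lagEnergy, kap_eq hF, h2]
  have h5 := hasSum_lagEnergy hΦ hF i l
  rw [h4] at h5
  exact h5.unique hasSum_zero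

end MeanSquare

namespace Setup

variable {m n : ℕ} {P P0 : TM m} {s : Fin m → ℝ} {ch : Channel m} {Φ : Fin m → ℝ[X]}
  {N M Nt Mt U V Ut Vt Min Mout : TM m} {A : Matrix (Fin n) (Fin n) ℝ}
  {B : Matrix (Fin n) (Fin m) ℝ} {C : Matrix (Fin m) (Fin n) ℝ} {D : Matrix (Fin m) (Fin m) ℝ}

theorem Jmat_eq_gainMat (h : Setup P P0 s ch Φ N M Nt Mt U V Ut Vt Min Mout A B C D) {F Q : TM m}
    (hF : F * ch.H = (U + M * Q) * Nt) : Jmat U M Nt (ch.W Φ) Q = gainMat F Φ := by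
  ext i j
  exact h.Jmat_eq hF i j

theorem stabilizable_iff (h : Setup P P0 s ch Φ N M Nt Mt U V Ut Vt Min Mout A B C D) :
    MeanSquareStabilizable P ch ↔ rhoMin U M Nt (ch.W Φ) < 1 := by
  constructor
  · rintro ⟨K, -, hK, hms⟩
    obtain ⟨Q, hQ, hF⟩ := h.exists_param hK
    obtain ⟨hFrh, hF0⟩ := h.nominal_rh hQ hF
    refine (csInf_le (bddBelow_specRad U M Nt (ch.W Φ)) ⟨Q, hQ, rfl⟩).trans_lt ?_
    rw [h.Jmat_eq_gainMat hF]
    refine specRad_lt_one_of_boundedVariance h.spec hFrh hF0 fun e u d hcl => ?_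
    exact (hms (Sample ch) (sampleLaw ch) _ _ e u d (isDelayProcess_sample ch)
      (isWhiteNoise_sample ch) (indep_sample ch) hcl).2
  · intro hlt
    rw [rhoMin] at hlt
    obtain ⟨r, ⟨Q, hQ, rfl⟩, hr⟩ := exists_lt_of_csInf_lt (by exact ⟨_, 0, rhInfM_zero, rfl⟩) hlt
    obtain ⟨K, hKp, hK, hF⟩ := h.exists_controller hQ
    obtain ⟨hFrh, hF0⟩ := h.nominal_rh hQ hF
    rw [h.Jmat_eq_gainMat hF] at hr
    exact ⟨K, hKp, hK, fun Ω _ Pr _ χ v e u d hχ hv hvχ hcl =>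
      boundedVariance_of_specRad_lt_one h.spec hFrh hF0 hr hχ hv hvχ hcl⟩

end Setup

end

end MSStab

end

open MSStab in
theorem theorem3 {m n : ℕ} (hm : 0 < m)
    -- plant with input-decoupled nonminimum-phase zeros
    (P P0 : TM m) (s : Fin m → ℝ)
    (hP : P = P0 * zeroFactor s)
    (hP0 : MinPhasePlant P0) (hdeg : RelDegOne P0)
    (hs : ∀ i, 1 < |s i|)
    (hsP0 : ∀ i j l, NoPole (P0 j l) (s i : ℂ))
    -- channel, its minimum-phase mean and its minimum-phase spectral factor
    (ch : Channel m) (Φ : Fin m → Polynomial ℝ)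
    (hH : ∀ i, MinPhasePoly (ch.meanPoly i)) (hΦ : ch.IsSpectralFactor Φ)
    -- doubly coprime factorization of `P H`
    (N M Nt Mt U V Ut Vt : TM m)
    (hcop : DoublyCoprime (P * ch.H) N M Nt Mt U V Ut Vt)
    -- inner-outer factorization of `M`, and a minimal realization of the inner factor
    (Min Mout : TM m) (hin : IsInner Min) (hout : IsOuter Mout) (hM : M = Min * Mout)
    (A : Matrix (Fin n) (Fin n) ℝ) (B : Matrix (Fin n) (Fin m) ℝ)
    (C : Matrix (Fin m) (Fin n) ℝ) (D : Matrix (Fin m) (Fin m) ℝ)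
    (hreal : IsRealization Min A B C D) (hctr : Controllable A B) (hobs : Observable A C) :
    -- the expressions are well defined
    (IsUnit D ∧ (∀ i, IsUnit (Ahat A B C D - s i • (1 : Matrix (Fin n) (Fin n) ℝ))) ∧
      (∀ i, IsUnit (Polynomial.aeval (Ahat A B C D) (ch.W Φ i).denom)) ∧
      (∀ γ : Fin m → ℝ, (∀ i, 0 < γ i) →
        ∃! X : Matrix (Fin n) (Fin n) ℝ, X.PosDef ∧ IsDARE A B C D γ X) ∧
      (∀ i, ∃! Y : Matrix (Fin n) (Fin n) ℝ, Y.PosSemidef ∧ IsLyap A B C D i Y)) ∧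
    rhoMin U M Nt (ch.W Φ) = sInf (riccatiSet A B C D s (ch.W Φ)) ∧
    rhoMin U M Nt (ch.W Φ) = sInf (lmiSet A B C D s (ch.W Φ)) ∧
    (MeanSquareStabilizable P ch ↔ rhoMin U M Nt (ch.W Φ) < 1) := by
  have h : Setup P P0 s ch Φ N M Nt Mt U V Ut Vt Min Mout A B C D :=
    ⟨hP, hP0, hdeg, hs, hsP0, hH, hΦ, hcop, hin, hout, hM, hreal, hctr, hobs⟩
  exact ⟨⟨h.isUnit_D, h.isUnit_sub, h.isUnit_denom_W, fun γ hγ => h.existsUnique_dare hγ,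
    h.existsUnique_lyap⟩, h.rhoMin_eq_riccati hm, (h.rhoMin_eq_riccati hm).trans
    (h.riccati_eq_lmi hm), h.stabilizable_iff⟩
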